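/- Let $n\ge 4$, $\theta_0\in(0,\pi)$ and $\kappa\in\mathbb{R}\setminus\{0\}$. Consider $N=n+1$ point vortices on the unit sphere $S^2\subset\mathbb{R}^3$: $x_s=(\sin\theta_0\cos\frac{2\pi s}{n},\ \sin\theta_0\sin\frac{2\pi s}{n},\ \cos\theta_0)$ with vorticity $\kappa_s=1$ for $s=0,\dots,n-1$, and $x_n=(0,0,1)$ with vorticity $\kappa_n=\kappa$ (the configuration $x_e$ of type $\mathbf{C}_{nv}(R,p)$). Let $$H(x)=-\sum_{i<j}\kappa_i\kappa_j\ln(1-x_i\cdot x_j),\qquad \Phi(x)=\sum_i\kappa_i x_i,\qquad \omega_x(v,w)=\sum_i\kappa_i\,x_i\cdot(v_i\times w_i)$$ be the Hamiltonian, the momentum map and the symplectic form on the space of $N$ distinct points of $S^2$. A point $x$ is a relative equilibrium with angular velocity $\xi\in\mathbb{R}^3$ if it is a critical point of $H_\xi=H-\langle\Phi,\xi\rangle$. With $\mu=\Phi(x)$, its symplectic slice is $\mathcal{N}=(\mathfrak{so}(3)_\mu\cdot x)^\perp\cap\operatorname{Ker}D\Phi(x)$, and $L_{\mathcal N}$ is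 the linear map of $\mathcal{N}$ given by $\omega(u,L_{\mathcal N}v)=d^2H_\xi(x)(u,v)$ for $u,v\in\mathcal{N}$. The relative equilibrium is spectrally stable if all complex eigenvalues of $L_{\mathcal N}$ are purely imaginary (zero included), and elliptic if it is spectrally stable and $d^2H_\xi(x)|_{\mathcal N}$ is not definite (neither positive definite nor negative definite). Put $$a=(n\cos\theta_0-n+2)(1+\cos\theta_0)^2,\qquad b=(n-1)\cos\theta_0\,\bigl(n\sin^2\theta_0+2(n-1)\cos\theta_0\bigr),$$ $$\kappa_0=\frac{c_n-(n-1)(1+\cos^2\theta_0)}{(1+\cos\theta_0)^2},\qquad c_n=\begin{cases}n^2/4&n\text{ even},\\(n^2-1)/4&n\text{ odd}.\end{cases}$$ Assume that $\mu=\Phi(x_e)\ne0$. Then $x_e$ is an elliptic relative equilibrium if and only if $$\kappa\ge\kappa_0,\qquad \bigl(\kappa=\kappa_0\ \text{ or }\ \kappa(\kappa+n\cos\theta_0)(a\kappa-b)\ge0\bigr),\qquad 8a\kappa\le\bigl(n\sin^2\theta_0+4(n-1)\cos\theta_0\bigr)^2 .$$ For $a\neq0$, $\kappa(\kappa+n\cos\theta_0)(a\kappa-b)=a\kappa(\kappa+n\cos\theta_0)(\kappa-\kappa_1)$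 with $\kappa_1=b/a$. In particular, if $\kappa\ne\kappa_0$ and $a\ne0$, then $x_e$ is elliptic if and only if $\kappa\ge\kappa_0$, $a\kappa(\kappa+n\cos\theta_0)(\kappa-\kappa_1)\ge0$ and $8a\kappa\le(n\sin^2\theta_0+4(n-1)\cos\theta_0)^2$. -/

import Mathlib

open scoped Matrix

namespace PointVortex

noncomputable section

/-- Configurations of `N` points in `ℝ³`.  Since tangent vectors to `(S²)^N` are also families of
`N` vectors of `ℝ³`, the same type is used for them. -/
abbrev Config (N : ℕ) : Type := Fin N → Fin 3 → ℝ

variable {N : ℕ}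

/-- The phase space: `N` pairwise distinct points of the unit sphere. -/
def phaseSpace (N : ℕ) : Set (Config N) :=
  {x | (∀ i, x i ⬝ᵥ x i = 1) ∧ Function.Injective x}

/-- The Hamiltonian `H = -∑_{i<j} κᵢ κⱼ ln(1 - xᵢ·xⱼ)`. On the unit sphere
`1 - xᵢ·xⱼ = ‖xᵢ - xⱼ‖² / 2`. -/
def hamiltonian (k : Fin N → ℝ) (x : Config N) : ℝ :=
  -∑ i, ∑ j ∈ Finset.Ioi i, k i * k j * Real.log (1 - x i ⬝ᵥ x j)

/-- The momentum map `Φ(x) = ∑ᵢ κᵢ xᵢ`. -/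
def momentum (k : Fin N → ℝ) (x : Config N) : Fin 3 → ℝ :=
  ∑ i, k i • x i

/-- The augmented Hamiltonian `H_ξ = H - ⟨Φ, ξ⟩`. -/
def augHamiltonian (k : Fin N → ℝ) (ξ : Fin 3 → ℝ) (x : Config N) : ℝ :=
  hamiltonian k x - momentum k x ⬝ᵥ ξ

/-- The radial retraction of `(ℝ³ ∖ {0})^N` onto `(S²)^N`. -/
def retract (x : Config N) : Config N :=
  fun i => (Real.sqrt (x i ⬝ᵥ x i))⁻¹ • x i

/-- `v` is tangent to `(S²)^N` at `x`. -/
def IsTangent (x v : Config N) : Prop := ∀ i, x i ⬝ᵥ v i = 0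

/-- The differential at `x` of the restriction of `H_ξ` to `(S²)^N`, on a tangent vector. -/
def dAugHamiltonian (k : Fin N → ℝ) (ξ : Fin 3 → ℝ) (x v : Config N) : ℝ :=
  fderiv ℝ (fun y => augHamiltonian k ξ (retract y)) x v

/-- The Hessian at a critical point `x` of the restriction of `H_ξ` to `(S²)^N`, on tangent
vectors. (At a critical point the Hessian does not depend on the local parametrization of
the manifold; the one used here is the radial projection of the tangent space.) -/
def hessian (k : Fin N → ℝ) (ξ : Fin 3 → ℝ) (x v w : Config N) : ℝ :=
  fderiv ℝ (fderiv ℝ (fun y => augHamiltonian k ξ (retract y))) x v w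

/-- The symplectic form `∑ᵢ κᵢ sin θᵢ dθᵢ ∧ dφᵢ`, that is, the area form of the unit sphere
weighted by the vorticities. -/
def symplecticForm (k : Fin N → ℝ) (x v w : Config N) : ℝ :=
  ∑ i, k i * (x i ⬝ᵥ (v i ⨯₃ w i))

/-- `x` is a relative equilibrium with angular velocity `ξ`: a point of the phase space
which is a critical point of `H_ξ`. -/
def IsRelativeEquilibrium (k : Fin N → ℝ) (x : Config N) (ξ : Fin 3 → ℝ) : Prop :=
  x ∈ phaseSpace N ∧ ∀ v, IsTangent x v → dAugHamiltonian k ξ x v = 0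

/-- The symplectic slice `(𝔰𝔬(3)_μ · x)^⊥ ∩ Ker DΦ(x)`, where `μ = Φ(x)`.
With `𝔰𝔬(3) ≃ ℝ³`, an element `η` acts by `xᵢ ↦ η × xᵢ`, and `𝔰𝔬(3)_μ = {η | η × μ = 0}`. -/
def symplecticSlice (k : Fin N → ℝ) (x : Config N) : Submodule ℝ (Config N) where
  carrier := {v | IsTangent x v ∧ ∑ i, k i • v i = 0 ∧
    ∀ η : Fin 3 → ℝ, η ⨯₃ momentum k x = 0 → ∑ i, v i ⬝ᵥ (η ⨯₃ x i) = 0}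
  zero_mem' := by simp [IsTangent]
  add_mem' := by
    rintro v w ⟨hv, hv', hv''⟩ ⟨hw, hw', hw''⟩
    refine ⟨fun i => ?_, ?_, fun η hη => ?_⟩
    · simp [dotProduct_add, hv i, hw i]
    · simp [smul_add, Finset.sum_add_distrib, hv', hw']
    · simp [add_dotProduct, Finset.sum_add_distrib, hv'' η hη, hw'' η hη]
  smul_mem' := by
    rintro c v ⟨hv, hv', hv''⟩
    refine ⟨fun i => ?_, ?_, fun η hη => ?_⟩
    · simp [hv i]
    · simp only [Pi.smul_apply, smul_comm _ c, ← Finset.smul_sum, hv', smul_zero]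
    · simp only [Pi.smul_apply, smul_dotProduct, ← Finset.smul_sum, hv'' η hη, smul_zero]

/-- `L` is the linearization on the symplectic slice `𝒩`, that is `L = J_𝒩 d²H_ξ|_𝒩` with
`J_𝒩⁻¹` the matrix of `ω|_𝒩`; equivalently `ω(u, L v) = d²H_ξ(u, v)` for `u, v ∈ 𝒩`. -/
def IsLinearization (k : Fin N → ℝ) (x : Config N) (ξ : Fin 3 → ℝ)
    (L : symplecticSlice k x →ₗ[ℝ] symplecticSlice k x) : Prop :=
  ∀ u v : symplecticSlice k x,
    symplecticForm k x (u : Config N) (L v : Config N) = hessian k ξ x u v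

/-- Spectral stability: every complex eigenvalue of the linearization on the symplectic slice
is purely imaginary. -/
def SpectrallyStable (k : Fin N → ℝ) (x : Config N) (ξ : Fin 3 → ℝ) : Prop :=
  ∃ L, IsLinearization k x ξ L ∧ ∀ z : ℂ, Polynomial.aeval z L.charpoly = 0 → z.re = 0

/-- The restriction of the Hessian `d²H_ξ` to the symplectic slice is (positive or negative)
definite. -/
def HessianDefinite (k : Fin N → ℝ) (x : Config N) (ξ : Fin 3 → ℝ) : Prop :=
  (∀ v ∈ symplecticSlice k x, v ≠ 0 → 0 < hessian k ξ x v v) ∨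
    (∀ v ∈ symplecticSlice k x, v ≠ 0 → hessian k ξ x v v < 0)

/-- `x` is an elliptic relative equilibrium: it is a relative equilibrium, spectrally stable, and
the Hessian on the symplectic slice is not definite. -/
def IsElliptic (k : Fin N → ℝ) (x : Config N) : Prop :=
  ∃ ξ, IsRelativeEquilibrium k x ξ ∧ SpectrallyStable k x ξ ∧ ¬ HessianDefinite k x ξ

/-- The configuration `C_{nv}(R,p)`: a regular ring of `n` vortices at co-latitude `θ`, with
longitudes `2πs/n`, followed by a vortex at the North pole. -/
def ringPole (n : ℕ) (θ : ℝ) : Config (n + 1) :=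
  Fin.snoc (α := fun _ => Fin 3 → ℝ)
    (fun s : Fin n => ![Real.sin θ * Real.cos (2 * Real.pi * (s : ℕ) / n),
      Real.sin θ * Real.sin (2 * Real.pi * (s : ℕ) / n), Real.cos θ])
    ![0, 0, 1]

/-- The vorticities of `C_{nv}(R,p)`: `1` for the vortices of the ring, `κ` for the pole. -/
def ringPoleVorticity (n : ℕ) (κ : ℝ) : Fin (n + 1) → ℝ :=
  Fin.snoc (α := fun _ => ℝ) (fun _ : Fin n => 1) κ

/-- `c_n = n²/4` for `n` even and `(n² - 1)/4` for `n` odd. -/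
def cConst (n : ℕ) : ℝ := if Even n then (n : ℝ) ^ 2 / 4 else ((n : ℝ) ^ 2 - 1) / 4

/-- `a = (n cos θ - n + 2)(1 + cos θ)²`. -/
def aConst (n : ℕ) (θ : ℝ) : ℝ := (n * Real.cos θ - n + 2) * (1 + Real.cos θ) ^ 2

/-- `b = (n - 1) cos θ (n sin² θ + 2 (n - 1) cos θ)`. -/
def bConst (n : ℕ) (θ : ℝ) : ℝ :=
  ((n : ℝ) - 1) * Real.cos θ * (n * Real.sin θ ^ 2 + 2 * ((n : ℝ) - 1) * Real.cos θ)

/-- `κ₀ = (c_n - (n - 1)(1 + cos² θ)) / (1 + cos θ)²`. -/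
def kappaZero (n : ℕ) (θ : ℝ) : ℝ :=
  (cConst n - ((n : ℝ) - 1) * (1 + Real.cos θ ^ 2)) / (1 + Real.cos θ) ^ 2

/-- `κ₁ = b / a`, meaningful when `a ≠ 0`. -/
def kappaOne (n : ℕ) (θ : ℝ) : ℝ := bConst n θ / aConst n θ

/-- The quantity `a κ (κ + n cos θ) (κ - κ₁)`, with the denominator of `κ₁` cleared so that it also
makes sense for `a = 0`; see `modeOne_eq`. -/
def modeOne (n : ℕ) (θ κ : ℝ) : ℝ :=
  κ * (κ + n * Real.cos θ) * (aConst n θ * κ - bConst n θ)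

theorem modeOne_eq (n : ℕ) (θ κ : ℝ) (ha : aConst n θ ≠ 0) :
    modeOne n θ κ = aConst n θ * κ * (κ + n * Real.cos θ) * (κ - kappaOne n θ) := by
  unfold modeOne kappaOne
  field_simp

end

end PointVortex

open scoped Matrix

namespace PointVortex

noncomputable section

/-! Tangent vectors are written in the frame (co-latitude `a`, longitude `b`) on the ring and as
`(p, q)` at the pole. Since `μ ≠ 0` is vertical, its stabilizer is the group of rotations about the
axis, and the slice conditions become `∑ a = ∑ b = 0` and `κ (p + iq) = -G`, where `G` is the
horizontal momentum of the ring (`ringMoment`). The slice is thus a space of pairs of mean-zero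
functions on `ℤ/n`, and the discrete Fourier transform splits the Hessian and the symplectic form
into `2 × 2` blocks.

The interactions inside the ring give Dirichlet forms with weights `1 / (1 - cos (φ_s - φ_t))`,
whose eigenvalue at frequency `l` is `l (n - l)` (`parseval_dirichletForm`). With `A = ringCoeff`,
the block of `sin² θ · d²H` at a frequency `2 ≤ l ≤ n - 2` is `diag (A - l (n - l), l (n - l))` in
conjugate coordinates, so the rescaled eigenvalues satisfy `η² = -(A - l (n - l)) l (n - l)`. All
are imaginary iff `A ≥ c_n = max l (n - l)`, which is `κ ≥ κ₀`.

Only the frequencies `±1` move the pole. In the coordinates (coefficient of `a`, `G`) the Hessian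
block is the real symmetric matrix `M` with entries `P, Q, Q, T` (`modeOneP`, `modeOneQ`,
`modeOneT`), and the symplectic block is `∓i` times the real symmetric matrix `S` with entries `-2
cos θ, 1, 1, n / (2κ)`, of determinant `-(κ + n cos θ) / κ ≠ 0`. The eigenvalues are imaginary iff
the real quadratic `det (M - σ S)` has real roots. Its discriminant is a positive factor times the
difference of the two sides of the third condition (`modeOne_discriminant`). Hence spectral
stability amounts to the first and third conditions (`spectrallyStable_ringPole_iff`).

The Hessian is positive on the longitude part of frequency `2`, so definite means positive definite:
`A > c_n` and a positive first block. Then `P > 0` is automatic (`modeOneP_pos`) and `P T - Q² =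
-modeOne / (2κ²)`, so the Hessian is definite iff `κ > κ₀` and `modeOne < 0`
(`hessianDefinite_ringPole_iff`). As the angular velocity is unique, ellipticity is the first
criterion without the second. -/

/-! ### Discrete Fourier analysis on the ring -/

/-- The primitive `n`-th root of unity `exp (2πi/n)`. -/
def rootOfUnity (n : ℕ) : ℂ := Complex.exp (2 * Real.pi * Complex.I / n)

/-- The longitude of the `s`-th vortex of the ring. -/
def ringAngle (n : ℕ) (s : Fin n) : ℝ := 2 * Real.pi * (s : ℕ) / n

/-- The Fourier mode of frequency `l`. -/
def mode (n : ℕ) (l : ℤ) (s : Fin n) : ℂ := rootOfUnity n ^ (l * (s : ℕ))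

/-- The Fourier coefficient of `f` at the frequency `l`, with kernel `exp (2πi l s / n)`. -/
def fourierCoeff {n : ℕ} (f : Fin n → ℂ) (l : ℤ) : ℂ := ∑ s, f s * mode n l s

/-- The Dirichlet form with weights `1 / (1 - cos (φ_s - φ_t))`. -/
def dirichletForm {n : ℕ} (f g : Fin n → ℂ) : ℂ :=
  1 / 2 * ∑ s, ∑ t, ((1 / (1 - Real.cos (ringAngle n s - ringAngle n t)) : ℝ) : ℂ) *
    ((f s - f t) * (g s - g t))

theorem rootOfUnity_ne_zero (n : ℕ) : rootOfUnity n ≠ 0 := Complex.exp_ne_zero _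

theorem isPrimitiveRoot_rootOfUnity {n : ℕ} (hn : n ≠ 0) : IsPrimitiveRoot (rootOfUnity n) n :=
  Complex.isPrimitiveRoot_exp n hn

theorem mode_eq_exp (n : ℕ) (l : ℤ) (s : Fin n) :
    mode n l s = Complex.exp ((l * ringAngle n s : ℝ) * Complex.I) := by
  rw [mode, rootOfUnity, ← Complex.exp_int_mul]
  congr 1
  simp only [ringAngle]
  push_cast
  ring

theorem conj_mode (n : ℕ) (l : ℤ) (s : Fin n) :
    (starRingEnd ℂ) (mode n l s) = mode n (-l) s := by
  rw [mode_eq_exp, mode_eq_exp, ← Complex.exp_conj]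
  congr 1
  simp

theorem mode_add (n : ℕ) (l m : ℤ) (s : Fin n) :
    mode n (l + m) s = mode n l s * mode n m s := by
  rw [mode, mode, mode, add_mul, zpow_add₀ (rootOfUnity_ne_zero n)]

theorem mode_zero (n : ℕ) (s : Fin n) : mode n 0 s = 1 := by simp [mode]

theorem mode_ne_zero (n : ℕ) (l : ℤ) (s : Fin n) : mode n l s ≠ 0 :=
  zpow_ne_zero _ (rootOfUnity_ne_zero n)

theorem mode_period {n : ℕ} (s : Fin n) : mode n n s = 1 := by
  have hn : n ≠ 0 := by rintro rfl; exact s.elim0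
  rw [mode, zpow_mul, zpow_natCast, zpow_natCast,
    (isPrimitiveRoot_rootOfUnity hn).pow_eq_one, one_pow]

theorem mode_sub_period {n : ℕ} (l : ℤ) (s : Fin n) : mode n (n - l) s = mode n (-l) s := by
  rw [sub_eq_add_neg, mode_add, mode_period, one_mul]

theorem sum_mode {n : ℕ} (hn : n ≠ 0) (l : ℤ) :
    ∑ s, mode n l s = if (n : ℤ) ∣ l then (n : ℂ) else 0 := by
  have hz := isPrimitiveRoot_rootOfUnity hn
  have h1 : ∑ s, mode n l s = ∑ i ∈ Finset.range n, (rootOfUnity n ^ l) ^ i := by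
    rw [← Fin.sum_univ_eq_sum_range]
    refine Finset.sum_congr rfl fun s _ => ?_
    rw [mode, zpow_mul, zpow_natCast]
  rw [h1]
  split_ifs with h
  · simp [(hz.zpow_eq_one_iff_dvd l).2 h]
  · have hne : rootOfUnity n ^ l ≠ 1 := fun h' => h ((hz.zpow_eq_one_iff_dvd l).1 h')
    refine eq_zero_of_ne_zero_of_mul_left_eq_zero (sub_ne_zero_of_ne hne.symm) ?_
    rw [mul_neg_geom_sum, ← zpow_natCast, ← zpow_mul, mul_comm, zpow_mul, zpow_natCast,
      hz.pow_eq_one, one_zpow, sub_self]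

theorem fourierCoeff_mode {n : ℕ} (hn : n ≠ 0) (l m : ℤ) :
    fourierCoeff (mode n l) m = if (n : ℤ) ∣ l + m then (n : ℂ) else 0 := by
  rw [← sum_mode hn]
  exact Finset.sum_congr rfl fun s _ => (mode_add n l m s).symm

theorem fourierCoeff_sub_period {n : ℕ} (f : Fin n → ℂ) (l : ℤ) :
    fourierCoeff f (n - l) = fourierCoeff f (-l) :=
  Finset.sum_congr rfl fun s _ => by rw [mode_sub_period]

theorem fourierCoeff_zero {n : ℕ} (f : Fin n → ℂ) : fourierCoeff f 0 = ∑ s, f s := by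
  simp [fourierCoeff, mode_zero]

theorem fourierCoeff_add {n : ℕ} (f g : Fin n → ℂ) (l : ℤ) :
    fourierCoeff (f + g) l = fourierCoeff f l + fourierCoeff g l := by
  simp [fourierCoeff, add_mul, Finset.sum_add_distrib]

theorem fourierCoeff_smul {n : ℕ} (c : ℂ) (f : Fin n → ℂ) (l : ℤ) :
    fourierCoeff (c • f) l = c * fourierCoeff f l := by
  simp [fourierCoeff, Finset.mul_sum, mul_assoc]

@[simp]
theorem fourierCoeff_zero_fun {n : ℕ} (l : ℤ) : fourierCoeff (0 : Fin n → ℂ) l = 0 := by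
  simp [fourierCoeff]

theorem conj_fourierCoeff {n : ℕ} (f : Fin n → ℂ) (l : ℤ) :
    (starRingEnd ℂ) (fourierCoeff f l) = fourierCoeff (fun s => (starRingEnd ℂ) (f s)) (-l) := by
  simp [fourierCoeff, conj_mode]

/-- The Fourier matrix is a Vandermonde matrix with the distinct nodes `exp (2πi s / n)`, hence
invertible. -/
theorem eq_zero_of_fourierCoeff_eq_zero {n : ℕ} (f : Fin n → ℂ)
    (h : ∀ l : ℕ, l < n → fourierCoeff f l = 0) : f = 0 := by
  rcases Nat.eq_zero_or_pos n with rfl | hn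
  · exact Subsingleton.elim _ _
  refine Matrix.eq_zero_of_forall_pow_sum_mul_pow_eq_zero
    (f := fun s : Fin n => rootOfUnity n ^ (s : ℕ)) (fun s t hst => ?_) fun i => ?_
  · exact Fin.ext ((isPrimitiveRoot_rootOfUnity hn.ne').pow_inj s.2 t.2 hst)
  · rw [← h i i.2]
    refine Finset.sum_congr rfl fun s _ => ?_
    rw [mode, ← pow_mul, mul_comm (s : ℕ), ← zpow_natCast]
    simp

/-! ### Weighted geometric sums at roots of unity and the Dirichlet weight. -/

theorem sub_one_mul_sum_mul_pow (z : ℂ) (m : ℕ) :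
    (z - 1) * ∑ l ∈ Finset.range m, (l : ℂ) * z ^ l
      = m * z ^ m - z * ∑ l ∈ Finset.range m, z ^ l := by
  induction m with
  | zero => simp
  | succ m ih =>
    rw [Finset.sum_range_succ, Finset.sum_range_succ, mul_add, ih]
    push_cast
    ring

theorem sub_one_mul_sum_sq_mul_pow (z : ℂ) (m : ℕ) :
    (z - 1) * ∑ l ∈ Finset.range m, (l : ℂ) ^ 2 * z ^ l
      = m ^ 2 * z ^ m - z * (2 * ∑ l ∈ Finset.range m, (l : ℂ) * z ^ l
        + ∑ l ∈ Finset.range m, z ^ l) := by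
  induction m with
  | zero => simp
  | succ m ih =>
    rw [Finset.sum_range_succ, Finset.sum_range_succ, Finset.sum_range_succ, mul_add, ih]
    push_cast
    ring

theorem geom_sum_eq_zero_of_pow_eq_one {z : ℂ} {n : ℕ} (hz : z ^ n = 1) (h1 : z ≠ 1) :
    ∑ l ∈ Finset.range n, z ^ l = 0 := by
  refine eq_zero_of_ne_zero_of_mul_left_eq_zero (sub_ne_zero_of_ne h1.symm) ?_
  rw [mul_neg_geom_sum, hz, sub_self]

theorem sub_one_mul_sum_mul_pow_of_pow_eq_one {z : ℂ} {n : ℕ} (hz : z ^ n = 1) (h1 : z ≠ 1) :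
    (z - 1) * ∑ l ∈ Finset.range n, (l : ℂ) * z ^ l = n := by
  rw [sub_one_mul_sum_mul_pow, hz, geom_sum_eq_zero_of_pow_eq_one hz h1]
  ring

/-- Since `-(z - 1)² / (2z)` is `1 - cos` of the argument of `z`, this identity shows that `1 / (1 -
cos)` is, up to a factor `-n`, the transform of `l (n - l)`. -/
theorem sub_one_sq_mul_sum_of_pow_eq_one {z : ℂ} {n : ℕ} (hz : z ^ n = 1) (h1 : z ≠ 1) :
    (z - 1) ^ 2 * ∑ l ∈ Finset.range n, ((l : ℂ) * (n - l)) * z ^ l = 2 * n * z := by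
  have h2 := sub_one_mul_sum_mul_pow_of_pow_eq_one hz h1
  have h3 := sub_one_mul_sum_sq_mul_pow z n
  rw [hz, geom_sum_eq_zero_of_pow_eq_one hz h1] at h3
  have h4 : ∑ l ∈ Finset.range n, ((l : ℂ) * (n - l)) * z ^ l
      = n * ∑ l ∈ Finset.range n, (l : ℂ) * z ^ l
        - ∑ l ∈ Finset.range n, (l : ℂ) ^ 2 * z ^ l := by
    rw [Finset.mul_sum, ← Finset.sum_sub_distrib]
    exact Finset.sum_congr rfl fun l _ => by ring
  rw [h4]
  linear_combination (n * (z - 1) + 2 * z) * h2 - (z - 1) * h3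

theorem mode_mul_mode_neg_ne_one {n : ℕ} {s t : Fin n} (h : s ≠ t) :
    mode n 1 s * mode n (-1) t ≠ 1 := by
  have hn : n ≠ 0 := by rintro rfl; exact s.elim0
  have hz := isPrimitiveRoot_rootOfUnity hn
  intro h'
  apply h
  have h2 : mode n 1 s = mode n 1 t := by
    have := mode_add n (-1) 1 t
    rw [neg_add_cancel, mode_zero] at this
    calc mode n 1 s = mode n 1 s * (mode n (-1) t * mode n 1 t) := by rw [← this, mul_one]
      _ = mode n 1 t := by rw [← mul_assoc, h', one_mul]
  simp only [mode, one_mul, zpow_natCast] at h2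
  exact Fin.ext (hz.pow_inj s.2 t.2 h2)

theorem mode_mul_mode_neg_pow {n : ℕ} (s t : Fin n) (l : ℕ) :
    (mode n 1 s * mode n (-1) t) ^ l = mode n l s * mode n (-l) t := by
  rw [mul_pow, mode, mode, mode, mode, ← zpow_natCast, ← zpow_natCast, ← zpow_mul, ← zpow_mul]
  congr 2 <;> ring

theorem mode_mul_mode_neg_pow_eq_one {n : ℕ} (s t : Fin n) :
    (mode n 1 s * mode n (-1) t) ^ n = 1 := by
  rw [mode_mul_mode_neg_pow, ← mode_sub_period, sub_self, mode_zero, mode_period, one_mul]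

/-- With `z = exp (i (φ_s - φ_t))`, this is `2z (1 - cos) = -(z - 1)²`, the bridge from
trigonometric weights to sums of roots of unity. The form without division also covers `s = t`. -/
theorem one_sub_cos_eq {n : ℕ} (s t : Fin n) :
    2 * (mode n 1 s * mode n (-1) t) *
        ((1 - Real.cos (ringAngle n s - ringAngle n t) : ℝ) : ℂ)
      = - (mode n 1 s * mode n (-1) t - 1) ^ 2 := by
  have h : mode n 1 s * mode n (-1) t
      = Complex.exp (((ringAngle n s - ringAngle n t : ℝ) : ℂ) * Complex.I) := by
    rw [mode_eq_exp, mode_eq_exp, ← Complex.exp_add]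
    congr 1
    push_cast
    ring
  rw [h]
  have h2 := Complex.exp_neg (((ringAngle n s - ringAngle n t : ℝ) : ℂ) * Complex.I)
  have h3 := Complex.two_cos ((ringAngle n s - ringAngle n t : ℝ) : ℂ)
  rw [neg_mul, h2] at h3
  have h4 := Complex.exp_ne_zero (((ringAngle n s - ringAngle n t : ℝ) : ℂ) * Complex.I)
  rw [Complex.ofReal_sub 1, Complex.ofReal_cos, Complex.ofReal_one]
  set z := Complex.exp (((ringAngle n s - ringAngle n t : ℝ) : ℂ) * Complex.I)
  have h5 : z * (2 * Complex.cos ((ringAngle n s - ringAngle n t : ℝ) : ℂ)) = z ^ 2 + 1 := by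
    rw [h3]; field_simp
  linear_combination -h5

theorem one_sub_cos_ne_zero {n : ℕ} {s t : Fin n} (h : s ≠ t) :
    1 - Real.cos (ringAngle n s - ringAngle n t) ≠ 0 := by
  intro h0
  have := one_sub_cos_eq s t
  rw [h0, Complex.ofReal_zero, mul_zero, eq_comm, neg_eq_zero, sq_eq_zero_iff, sub_eq_zero] at this
  exact mode_mul_mode_neg_ne_one h this

/-- Off the diagonal, the weight of the Dirichlet form is minus the Fourier transform of
`l (n - l)`. -/
theorem sum_mul_mode_mul_mode_neg {n : ℕ} {s t : Fin n} (h : s ≠ t) :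
    ∑ l ∈ Finset.range n, ((l : ℂ) * (n - l)) * (mode n l s * mode n (-l) t)
      = - n * ((1 / (1 - Real.cos (ringAngle n s - ringAngle n t)) : ℝ) : ℂ) := by
  have h1 := sub_one_sq_mul_sum_of_pow_eq_one (mode_mul_mode_neg_pow_eq_one s t)
    (mode_mul_mode_neg_ne_one h)
  simp only [mode_mul_mode_neg_pow] at h1
  have h2 := one_sub_cos_eq s t
  have h3 : ((1 - Real.cos (ringAngle n s - ringAngle n t) : ℝ) : ℂ) ≠ 0 :=
    Complex.ofReal_ne_zero.2 (one_sub_cos_ne_zero h)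
  have h4 : mode n 1 s * mode n (-1) t ≠ 0 := mul_ne_zero (mode_ne_zero _ _ _) (mode_ne_zero _ _ _)
  rw [one_div, Complex.ofReal_inv]
  set S := ∑ l ∈ Finset.range n, ((l : ℂ) * (n - l)) * (mode n l s * mode n (-l) t)
  rw [← div_eq_mul_inv, eq_div_iff h3]
  apply mul_left_cancel₀ (mul_ne_zero two_ne_zero h4)
  linear_combination S * h2 - h1

theorem sum_mode_mul_mode_neg {n : ℕ} {s t : Fin n} :
    ∑ l ∈ Finset.range n, (mode n l s * mode n (-l) t) = if s = t then (n : ℂ) else 0 := by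
  split_ifs with h
  · subst h
    simp [← mode_add, mode_zero]
  · simp only [← mode_mul_mode_neg_pow]
    exact geom_sum_eq_zero_of_pow_eq_one (mode_mul_mode_neg_pow_eq_one s t)
      (mode_mul_mode_neg_ne_one h)

/-! ### Parseval identities. -/

/-- The pairing is bilinear, without conjugation: frequency `l` meets `-l`. All complexified forms
below follow this convention. -/
theorem parseval {n : ℕ} (f g : Fin n → ℂ) :
    ∑ l ∈ Finset.range n, fourierCoeff f (-l) * fourierCoeff g l = n * ∑ s, f s * g s := by
  have h : ∀ l ∈ Finset.range n, fourierCoeff f (-l) * fourierCoeff g l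
      = ∑ s, ∑ t, f s * g t * (mode n l t * mode n (-l) s) := fun l _ => by
    rw [fourierCoeff, fourierCoeff, Finset.sum_mul_sum]
    exact Finset.sum_congr rfl fun s _ => Finset.sum_congr rfl fun t _ => by ring
  rw [Finset.sum_congr rfl h, Finset.sum_comm, Finset.mul_sum]
  refine Finset.sum_congr rfl fun s _ => ?_
  rw [Finset.sum_comm]
  simp only [← Finset.mul_sum, sum_mode_mul_mode_neg]
  simp [mul_comm]

theorem dirichletForm_comm {n : ℕ} (f g : Fin n → ℂ) : dirichletForm f g = dirichletForm g f := by
  simp only [dirichletForm, mul_comm (f _ - f _)]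

/-- Off the diagonal the weight is `-K / n`, with `K` the transform of `l (n - l)`; on the diagonal
the differences vanish. The symbol is zero at `l = 0`, so rows and columns of `K` sum to zero. The
square terms `f s * g s` and `f t * g t` therefore drop out, and the two cross terms agree by the
symmetry `l ↦ n - l`. -/
theorem parseval_dirichletForm {n : ℕ} (f g : Fin n → ℂ) :
    ∑ l ∈ Finset.range n, ((l : ℂ) * (n - l)) * (fourierCoeff f (-l) * fourierCoeff g l)
      = n * dirichletForm f g := by
  rcases Nat.eq_zero_or_pos n with rfl | hn
  · simp
  set K : Fin n → Fin n → ℂ := fun s t =>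
    ∑ l ∈ Finset.range n, ((l : ℂ) * (n - l)) * (mode n l s * mode n (-l) t) with hK
  have hrow : ∀ t, ∑ s, K s t = 0 := fun t => by
    simp only [hK]
    rw [Finset.sum_comm]
    refine Finset.sum_eq_zero fun l hl => ?_
    simp only [← mul_assoc]
    rw [← Finset.sum_mul, ← Finset.mul_sum, sum_mode hn.ne']
    rcases Nat.eq_zero_or_pos l with rfl | hl0
    · simp
    · rw [if_neg, mul_zero, zero_mul]
      rw [Int.natCast_dvd_natCast]
      exact Nat.not_dvd_of_pos_of_lt hl0 (Finset.mem_range.1 hl)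
  have hcol : ∀ s, ∑ t, K s t = 0 := fun s => by
    simp only [hK]
    rw [Finset.sum_comm]
    refine Finset.sum_eq_zero fun l hl => ?_
    rw [← Finset.mul_sum, ← Finset.mul_sum, sum_mode hn.ne']
    rcases Nat.eq_zero_or_pos l with rfl | hl0
    · simp
    · rw [if_neg, mul_zero, mul_zero]
      rw [Int.dvd_neg, Int.natCast_dvd_natCast]
      exact Nat.not_dvd_of_pos_of_lt hl0 (Finset.mem_range.1 hl)
  have h : ∀ l ∈ Finset.range n,
      ((l : ℂ) * (n - l)) * (fourierCoeff f (-l) * fourierCoeff g l)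
      = ∑ s, ∑ t, f t * g s * (((l : ℂ) * (n - l)) * (mode n l s * mode n (-l) t)) := fun l _ => by
    rw [mul_comm (fourierCoeff f _), fourierCoeff, fourierCoeff, Finset.sum_mul_sum,
      Finset.mul_sum]
    refine Finset.sum_congr rfl fun s _ => ?_
    rw [Finset.mul_sum]
    exact Finset.sum_congr rfl fun t _ => by ring
  have hL : ∑ l ∈ Finset.range n, ((l : ℂ) * (n - l)) * (fourierCoeff f (-l) * fourierCoeff g l)
      = ∑ s, ∑ t, f t * g s * K s t := by
    rw [Finset.sum_congr rfl h, Finset.sum_comm]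
    refine Finset.sum_congr rfl fun s _ => ?_
    rw [Finset.sum_comm]
    simp only [← Finset.mul_sum, hK]
  have hR : ∀ s t, (n : ℂ) * (((1 / (1 - Real.cos (ringAngle n s - ringAngle n t)) : ℝ) : ℂ) *
      ((f s - f t) * (g s - g t))) = - (K s t * ((f s - f t) * (g s - g t))) := fun s t => by
    rcases eq_or_ne s t with rfl | hst
    · simp
    · rw [show K s t = _ from sum_mul_mode_mul_mode_neg hst]
      ring
  have h1 : ∑ s, ∑ t, K s t * (f s * g s) = 0 := by
    simp only [← Finset.sum_mul, hcol, zero_mul, Finset.sum_const_zero]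
  have h2 : ∑ s, ∑ t, K s t * (f t * g t) = 0 := by
    rw [Finset.sum_comm]
    simp only [← Finset.sum_mul, hrow, zero_mul, Finset.sum_const_zero]
  have hsym : ∑ s, ∑ t, K s t * (f s * g t) = ∑ l ∈ Finset.range n,
      ((l : ℂ) * (n - l)) * (fourierCoeff f l * fourierCoeff g (-l)) := by
    have h' : ∀ l ∈ Finset.range n,
      ((l : ℂ) * (n - l)) * (fourierCoeff f l * fourierCoeff g (-l))
      = ∑ s, ∑ t, f s * g t * (((l : ℂ) * (n - l)) * (mode n l s * mode n (-l) t)) := fun l _ => by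
      rw [fourierCoeff, fourierCoeff, Finset.sum_mul_sum, Finset.mul_sum]
      refine Finset.sum_congr rfl fun s _ => ?_
      rw [Finset.mul_sum]
      exact Finset.sum_congr rfl fun t _ => by ring
    rw [Finset.sum_congr rfl h', Finset.sum_comm (s := Finset.range n)]
    refine Finset.sum_congr rfl fun s _ => ?_
    rw [Finset.sum_comm]
    refine Finset.sum_congr rfl fun t _ => ?_
    rw [← Finset.mul_sum, mul_comm]
  -- Reflection `l ↦ n - l`. The index `l = 0`, which the reflection would send out of the range,
  -- has weight zero and is split off.
  have hrefl : ∑ l ∈ Finset.range n, ((l : ℂ) * (n - l)) * (fourierCoeff f l * fourierCoeff g (-l))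
      = ∑ l ∈ Finset.range n, ((l : ℂ) * (n - l)) * (fourierCoeff f (-l) * fourierCoeff g l) := by
    obtain ⟨m, rfl⟩ : ∃ m, n = m + 1 := ⟨n - 1, by omega⟩
    rw [Finset.sum_range_succ', Finset.sum_range_succ']
    simp only [Nat.cast_zero, zero_mul, add_zero]
    rw [← Finset.sum_range_reflect]
    refine Finset.sum_congr rfl fun l hl => ?_
    have hl' := Finset.mem_range.1 hl
    have e1 : ((m - 1 - l + 1 : ℕ) : ℤ) = ((m + 1 : ℕ) : ℤ) - ((l + 1 : ℕ) : ℤ) := by omega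
    have e2 : ((m - 1 - l + 1 : ℕ) : ℂ) = ((m + 1 : ℕ) : ℂ) - ((l + 1 : ℕ) : ℂ) := by
      exact_mod_cast congrArg (Int.cast : ℤ → ℂ) e1
    have e3 : fourierCoeff g (-(((m + 1 : ℕ) : ℤ) - ((l + 1 : ℕ) : ℤ)))
        = fourierCoeff g ((l + 1 : ℕ) : ℤ) := by
      rw [← fourierCoeff_sub_period]
      congr 1
      ring
    rw [e1, e2, e3, fourierCoeff_sub_period]
    ring
  have key : (n : ℂ) * (∑ s, ∑ t, ((1 / (1 - Real.cos (ringAngle n s - ringAngle n t)) : ℝ) : ℂ) *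
      ((f s - f t) * (g s - g t))) = ∑ s, ∑ t, K s t * (f s * g t) + ∑ s, ∑ t, f t * g s * K s t := by
    have : ∀ s t, (n : ℂ) * (((1 / (1 - Real.cos (ringAngle n s - ringAngle n t)) : ℝ) : ℂ) *
      ((f s - f t) * (g s - g t))) = K s t * (f s * g t) + f t * g s * K s t
        - K s t * (f s * g s) - K s t * (f t * g t) := fun s t => by rw [hR]; ring
    simp only [Finset.mul_sum, this, Finset.sum_sub_distrib, Finset.sum_add_distrib]
    rw [h1, h2]
    ring
  rw [dirichletForm, mul_left_comm, key, hsym, hrefl, hL]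
  ring

/-- Parseval leaves a single term. This is the source of every eigenvalue `l (n - l)` in the
stability thresholds. -/
theorem dirichletForm_mode {n : ℕ} (l : ℕ) (hl : l < n) (g : Fin n → ℂ) :
    dirichletForm (mode n l) g = (l : ℂ) * (n - l) * fourierCoeff g l := by
  have hn : n ≠ 0 := by omega
  have hn' : (n : ℂ) ≠ 0 := Nat.cast_ne_zero.2 hn
  apply mul_left_cancel₀ hn'
  rw [← parseval_dirichletForm, Finset.sum_eq_single_of_mem l (Finset.mem_range.2 hl)]
  · rw [fourierCoeff_mode hn, if_pos (by simp)]
    ring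
  · intro m hm hml
    rw [fourierCoeff_mode hn, if_neg]
    · ring
    · intro hd
      have h1 := Finset.mem_range.1 hm
      have := Int.eq_zero_of_abs_lt_dvd hd (by rw [abs_lt]; omega)
      omega

theorem dirichletForm_mode_neg_one {n : ℕ} (hn : 2 ≤ n) (g : Fin n → ℂ) :
    dirichletForm (mode n (-1)) g = ((n : ℂ) - 1) * fourierCoeff g (-1) := by
  have h : mode n (-1) = mode n ((n - 1 : ℕ) : ℤ) := by
    ext s
    rw [← mode_sub_period]
    congr 1
    omega
  rw [h, dirichletForm_mode _ (by omega), ← fourierCoeff_sub_period, Nat.cast_sub (by omega),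
    Nat.cast_sub (by omega)]
  push_cast
  ring

/-! ### Cotangent sums. -/

/-- The quotient is `cot ((φ_s - φ_t) / 2) = i (z + 1) / (z - 1)`, and `∑ l z^l = n / (z - 1)` at an
`n`-th root of unity `z ≠ 1`. -/
theorem natCast_mul_sin_div_one_sub_cos {n : ℕ} {s t : Fin n} (h : s ≠ t) :
    (n : ℂ) * ((Real.sin (ringAngle n s - ringAngle n t) /
        (1 - Real.cos (ringAngle n s - ringAngle n t)) : ℝ) : ℂ)
      = Complex.I * (n + 2 * ∑ l ∈ Finset.range n, (l : ℂ) * (mode n l s * mode n (-l) t)) := by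
  have h1 := sub_one_mul_sum_mul_pow_of_pow_eq_one (mode_mul_mode_neg_pow_eq_one s t)
    (mode_mul_mode_neg_ne_one h)
  simp only [mode_mul_mode_neg_pow] at h1
  set S := ∑ l ∈ Finset.range n, (l : ℂ) * (mode n l s * mode n (-l) t)
  have h2 := one_sub_cos_eq s t
  have h3 : ((1 - Real.cos (ringAngle n s - ringAngle n t) : ℝ) : ℂ) ≠ 0 :=
    Complex.ofReal_ne_zero.2 (one_sub_cos_ne_zero h)
  have h4 : mode n 1 s * mode n (-1) t ≠ 0 := mul_ne_zero (mode_ne_zero _ _ _) (mode_ne_zero _ _ _)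
  have h5 := sub_ne_zero.2 (mode_mul_mode_neg_ne_one h)
  have h6 : 2 * (mode n 1 s * mode n (-1) t) * (Real.sin (ringAngle n s - ringAngle n t) : ℂ)
      = - Complex.I * ((mode n 1 s * mode n (-1) t) ^ 2 - 1) := by
    have h : mode n 1 s * mode n (-1) t
        = Complex.exp (((ringAngle n s - ringAngle n t : ℝ) : ℂ) * Complex.I) := by
      rw [mode_eq_exp, mode_eq_exp, ← Complex.exp_add]
      congr 1
      push_cast
      ring
    rw [h, Complex.ofReal_sin]
    have h2 := Complex.exp_neg (((ringAngle n s - ringAngle n t : ℝ) : ℂ) * Complex.I)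
    have h3 := Complex.two_sin ((ringAngle n s - ringAngle n t : ℝ) : ℂ)
    rw [neg_mul, h2] at h3
    have h4 := Complex.exp_ne_zero (((ringAngle n s - ringAngle n t : ℝ) : ℂ) * Complex.I)
    set z := Complex.exp (((ringAngle n s - ringAngle n t : ℝ) : ℂ) * Complex.I)
    have h5 : z * (2 * Complex.sin ((ringAngle n s - ringAngle n t : ℝ) : ℂ))
        = (1 - z ^ 2) * Complex.I := by
      rw [h3]; field_simp
    linear_combination h5
  rw [Complex.ofReal_div, mul_div_assoc', div_eq_iff h3]
  apply mul_left_cancel₀ (mul_ne_zero two_ne_zero h4)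
  apply mul_left_cancel₀ h5
  linear_combination (mode n 1 s * mode n (-1) t - 1) * n * h6 -
    Complex.I * (mode n 1 s * mode n (-1) t - 1) * (n + 2 * S) * h2
    + 2 * Complex.I * (mode n 1 s * mode n (-1) t - 1) ^ 2 * h1

/-- `∑_{t ≠ s} cot ((φ_s - φ_t) / 2) = 0`. -/
theorem sum_sin_div_one_sub_cos {n : ℕ} (s : Fin n) :
    ∑ t, Real.sin (ringAngle n s - ringAngle n t) / (1 - Real.cos (ringAngle n s - ringAngle n t))
      = 0 := by
  have hn : n ≠ 0 := by rintro rfl; exact s.elim0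
  have hn' : (n : ℂ) ≠ 0 := Nat.cast_ne_zero.2 hn
  set S : Fin n → ℂ := fun t => ∑ l ∈ Finset.range n, (l : ℂ) * (mode n l s * mode n (-l) t)
    with hS
  have hsum : ∑ t, S t = 0 := by
    simp only [hS]
    rw [Finset.sum_comm]
    refine Finset.sum_eq_zero fun l hl => ?_
    rw [← Finset.mul_sum, ← Finset.mul_sum, sum_mode hn]
    rcases Nat.eq_zero_or_pos l with rfl | hl0
    · simp
    · rw [if_neg, mul_zero, mul_zero]
      rw [Int.dvd_neg, Int.natCast_dvd_natCast]
      exact Nat.not_dvd_of_pos_of_lt hl0 (Finset.mem_range.1 hl)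
  have hdiag : 2 * S s = n * (n - 1) := by
    have h := Finset.sum_range_id_mul_two n
    have : S s = ((∑ l ∈ Finset.range n, l : ℕ) : ℂ) := by
      simp [hS, ← mode_add, mode_zero]
    rw [this, mul_comm]
    have h' : (((∑ l ∈ Finset.range n, l) * 2 : ℕ) : ℂ) = ((n * (n - 1) : ℕ) : ℂ) := by rw [h]
    rw [Nat.cast_mul, Nat.cast_mul, Nat.cast_sub (by omega)] at h'
    simpa using h'
  -- At `s = t` the quotient is `0 / 0 = 0`, whereas the off-diagonal formula would give `i n²`; the
  -- last term corrects this.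
  have hval : ∀ t, (n : ℂ) * ((Real.sin (ringAngle n s - ringAngle n t) /
        (1 - Real.cos (ringAngle n s - ringAngle n t)) : ℝ) : ℂ)
      = Complex.I * (n + 2 * S t) - if s = t then Complex.I * n ^ 2 else 0 := fun t => by
    split_ifs with h
    · subst h
      rw [hdiag]
      simp
      ring
    · rw [natCast_mul_sin_div_one_sub_cos h, sub_zero]
  have : (n : ℂ) * ((∑ t, Real.sin (ringAngle n s - ringAngle n t) /
      (1 - Real.cos (ringAngle n s - ringAngle n t)) : ℝ) : ℂ) = 0 := by
    rw [Complex.ofReal_sum, Finset.mul_sum, Finset.sum_congr rfl fun t _ => hval t,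
      Finset.sum_sub_distrib, ← Finset.mul_sum, Finset.sum_add_distrib, ← Finset.mul_sum, hsum]
    simp
    ring
  exact Complex.ofReal_eq_zero.1 ((mul_eq_zero.1 this).resolve_left hn')


/-! ### First and second derivatives of the augmented Hamiltonian -/

theorem sum_sum_Ioi_eq {N : ℕ} (P : Fin N → Fin N → ℝ) (hs : ∀ i j, P i j = P j i)
    (hd : ∀ i, P i i = 0) :
    ∑ i, ∑ j ∈ Finset.Ioi i, P i j = 1 / 2 * ∑ i, ∑ j, P i j := by
  have h1 : ∀ i, ∑ j, P i j = ∑ j ∈ Finset.Ioi i, P i j + ∑ j ∈ Finset.Iio i, P i j := fun i => by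
    rw [← Finset.sum_filter_add_sum_filter_not Finset.univ (fun j => i < j)]
    congr 1
    · congr 1; ext j; simp
    · rw [← Finset.sum_subset (s₁ := Finset.Iio i)]
      · intro j; simpa using fun h => h.le
      · intro j h1 h2
        simp only [Finset.mem_filter, Finset.mem_univ, true_and, not_lt, Finset.mem_Iio] at h1 h2
        rw [le_antisymm h1 h2, hd]
  have h2 : ∑ i, ∑ j ∈ Finset.Iio i, P i j = ∑ i, ∑ j ∈ Finset.Ioi i, P i j := by
    rw [Finset.sum_comm' (t' := Finset.univ) (s' := fun i => Finset.Ioi i) (by simp)]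
    exact Finset.sum_congr rfl fun i _ => Finset.sum_congr rfl fun j _ => hs _ _
  simp only [h1, Finset.sum_add_distrib, h2]
  ring

theorem one_sub_dotProduct_pos {u v : Fin 3 → ℝ} (hu : u ⬝ᵥ u = 1) (hv : v ⬝ᵥ v = 1)
    (h : u ≠ v) : 0 < 1 - u ⬝ᵥ v := by
  have h1 : 0 < (u - v) ⬝ᵥ (u - v) := by
    have h0 : 0 ≤ (u - v) ⬝ᵥ (u - v) := by
      simp only [dotProduct]
      exact Finset.sum_nonneg fun i _ => mul_self_nonneg _
    refine lt_of_le_of_ne h0 fun h' => h ?_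
    exact sub_eq_zero.1 (dotProduct_self_eq_zero.1 h'.symm)
  rw [sub_dotProduct, dotProduct_sub, dotProduct_sub, hu, hv, dotProduct_comm v u] at h1
  linarith

theorem contDiffAt_augHamiltonian_retract {N : ℕ} (k : Fin N → ℝ) (ξ : Fin 3 → ℝ) {x : Config N}
    (hx : x ∈ phaseSpace N) :
    ContDiffAt ℝ 2 (fun y => augHamiltonian k ξ (retract y)) x := by
  have hdot : ∀ i, ContDiff ℝ 2 (fun y : Config N => y i ⬝ᵥ y i) := fun i => by
    simp only [dotProduct]
    fun_prop
  have hr : ∀ i m, ContDiffAt ℝ 2 (fun y : Config N => retract y i m) x := fun i m => by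
    simp only [retract, Pi.smul_apply, smul_eq_mul]
    have h1 : ContDiffAt ℝ 2 (fun y : Config N => Real.sqrt (y i ⬝ᵥ y i)) x :=
      (hdot i).contDiffAt.sqrt (by rw [hx.1]; norm_num)
    refine (h1.inv (by rw [hx.1]; norm_num)).mul ?_
    fun_prop
  have hrx : retract x = x := by
    ext i m
    simp [retract, hx.1]
  simp only [augHamiltonian, hamiltonian, momentum, dotProduct, Finset.sum_apply, Pi.smul_apply,
    smul_eq_mul]
  refine ContDiffAt.sub (ContDiffAt.neg ?_) ?_
  · refine ContDiffAt.sum fun i _ => ContDiffAt.sum fun j hj => ?_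
    refine contDiffAt_const.mul (ContDiffAt.log ?_ ?_)
    · exact contDiffAt_const.sub (ContDiffAt.sum fun m _ => (hr i m).mul (hr j m))
    · rw [hrx]
      have hij : i ≠ j := (Finset.mem_Ioi.1 hj).ne
      exact (one_sub_dotProduct_pos (hx.1 i) (hx.1 j) fun h => hij (hx.2 h)).ne'
  · refine ContDiffAt.sum fun m _ => ContDiffAt.mul (ContDiffAt.sum fun i _ => ?_) contDiffAt_const
    exact contDiffAt_const.mul (hr i m)

/-! ### Derivatives computed along retracted tangent lines. -/

theorem fderiv_apply_of_hasDerivAt_line {E : Type*} [NormedAddCommGroup E] [NormedSpace ℝ E]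
    {F : E → ℝ} {x v : E} {g' : ℝ} (hF : DifferentiableAt ℝ F x)
    (hg : HasDerivAt (fun t : ℝ => F (x + t • v)) g' 0) : fderiv ℝ F x v = g' := by
  have h1 : HasDerivAt (fun t : ℝ => x + t • v) v 0 := by
    simpa using ((hasDerivAt_id (0 : ℝ)).smul_const v).const_add x
  have h2 : HasFDerivAt F (fderiv ℝ F x) (x + (0 : ℝ) • v) := by simpa using hF.hasFDerivAt
  exact (h2.comp_hasDerivAt (0 : ℝ) h1).unique hg

/-- Reduces the Hessian on the diagonal to one-variable calculus. The first derivative must be known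
near `0`, because it is differentiated again there. -/
theorem fderiv_fderiv_apply_of_hasDerivAt_line {E : Type*} [NormedAddCommGroup E]
    [NormedSpace ℝ E] {F : E → ℝ} {x v : E} {g' : ℝ → ℝ} {g'' : ℝ} (hF : ContDiffAt ℝ 2 F x)
    (hg : ∀ᶠ t in nhds (0 : ℝ), HasDerivAt (fun t : ℝ => F (x + t • v)) (g' t) t)
    (hg' : HasDerivAt g' g'' 0) : fderiv ℝ (fderiv ℝ F) x v v = g'' := by
  have hline : ∀ t : ℝ, HasDerivAt (fun t : ℝ => x + t • v) v t := fun t => by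
    simpa using ((hasDerivAt_id t).smul_const v).const_add x
  have hd : ∀ᶠ y in nhds x, DifferentiableAt ℝ F y := by
    filter_upwards [hF.eventually (by simp)] with y hy
    exact hy.differentiableAt (by simp)
  have hcont : Filter.Tendsto (fun t : ℝ => x + t • v) (nhds 0) (nhds x) := by
    simpa using (hline 0).continuousAt.tendsto
  have h1 : (fun t : ℝ => fderiv ℝ F (x + t • v) v) =ᶠ[nhds 0] g' := by
    filter_upwards [hcont.eventually hd, hg] with t ht1 ht2
    exact (ht1.hasFDerivAt.comp_hasDerivAt t (hline t)).unique ht2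
  have h2 : DifferentiableAt ℝ (fderiv ℝ F) x :=
    (hF.fderiv_right (m := 1) (by norm_num)).differentiableAt (by simp)
  have h3 : HasFDerivAt (fderiv ℝ F) (fderiv ℝ (fderiv ℝ F) x) (x + (0 : ℝ) • v) := by
    simpa using h2.hasFDerivAt
  have h4 : HasDerivAt (fun t : ℝ => fderiv ℝ F (x + t • v)) (fderiv ℝ (fderiv ℝ F) x v) 0 :=
    h3.comp_hasDerivAt (0 : ℝ) (hline 0)
  have h5 : HasDerivAt (fun t : ℝ => fderiv ℝ F (x + t • v) v)
      (fderiv ℝ (fderiv ℝ F) x v v) 0 :=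
    (ContinuousLinearMap.apply ℝ ℝ v).hasFDerivAt.comp_hasDerivAt (0 : ℝ) h4
  exact h5.unique (hg'.congr_of_eventuallyEq h1)

/-- The inverse norm `(1 + α t²)^{-1/2}` along a tangent line to the sphere. -/
def invNorm (α t : ℝ) : ℝ := (Real.sqrt (1 + α * t ^ 2))⁻¹

theorem invNorm_zero (α : ℝ) : invNorm α 0 = 1 := by simp [invNorm]

theorem hasDerivAt_invNorm {α : ℝ} (hα : 0 ≤ α) (t : ℝ) :
    HasDerivAt (invNorm α) (-(α * t) * invNorm α t ^ 3) t := by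
  have hpos : 0 < 1 + α * t ^ 2 := by positivity
  have h1 : HasDerivAt (fun t : ℝ => 1 + α * t ^ 2) (α * (2 * t)) t := by
    simpa using ((hasDerivAt_pow 2 t).const_mul α).const_add 1
  have h2 := (h1.sqrt hpos.ne').inv (Real.sqrt_ne_zero'.2 hpos)
  have h3 : Real.sqrt (1 + α * t ^ 2) ≠ 0 := Real.sqrt_ne_zero'.2 hpos
  refine h2.congr_deriv ?_
  rw [invNorm]
  field_simp

/-- Tangency removes the term linear in `t` from the squared norm, leaving `1 + |v i|² t²`. -/
theorem retract_line {N : ℕ} {x v : Config N} (hx : ∀ i, x i ⬝ᵥ x i = 1) (hv : IsTangent x v)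
    (t : ℝ) (i : Fin N) :
    retract (x + t • v) i = invNorm (v i ⬝ᵥ v i) t • (x i + t • v i) := by
  have h : (x i + t • v i) ⬝ᵥ (x i + t • v i) = 1 + v i ⬝ᵥ v i * t ^ 2 := by
    simp only [add_dotProduct, dotProduct_add, smul_dotProduct, dotProduct_smul, smul_eq_mul, hx i,
      hv i, dotProduct_comm (v i) (x i)]
    ring
  simp only [retract, Pi.add_apply, Pi.smul_apply, h, invNorm]

/-- The first derivative along `v` of the sum over pairs in the Hamiltonian. -/
def pairGradient {N : ℕ} (x v : Config N) (i j : Fin N) : ℝ :=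
  (v i ⬝ᵥ x j + x i ⬝ᵥ v j) / (1 - x i ⬝ᵥ x j)

/-- The second derivative of `-ln (1 - xᵢ·xⱼ)`. -/
def pairHessian {N : ℕ} (x v w : Config N) (i j : Fin N) : ℝ :=
  (v i ⬝ᵥ x j + x i ⬝ᵥ v j) * (w i ⬝ᵥ x j + x i ⬝ᵥ w j) / (1 - x i ⬝ᵥ x j) ^ 2 +
    (v i ⬝ᵥ w j + w i ⬝ᵥ v j - x i ⬝ᵥ x j * (v i ⬝ᵥ w i + v j ⬝ᵥ w j)) / (1 - x i ⬝ᵥ x j)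

theorem zero_le_dotProduct_self (u : Fin 3 → ℝ) : 0 ≤ u ⬝ᵥ u :=
  Finset.sum_nonneg fun i _ => mul_self_nonneg (u i)

/-- The inner product of two points moving along tangent lines and retracted to the sphere. -/
def lineDot {N : ℕ} (x v : Config N) (i j : Fin N) (t : ℝ) : ℝ :=
  (x i ⬝ᵥ x j + t * (v i ⬝ᵥ x j + x i ⬝ᵥ v j) + t ^ 2 * (v i ⬝ᵥ v j)) *
    (invNorm (v i ⬝ᵥ v i) t * invNorm (v j ⬝ᵥ v j) t)

/-- The derivative of `lineDot`. -/
def lineDotDeriv {N : ℕ} (x v : Config N) (i j : Fin N) (t : ℝ) : ℝ :=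
  (v i ⬝ᵥ x j + x i ⬝ᵥ v j + 2 * t * (v i ⬝ᵥ v j)) *
    (invNorm (v i ⬝ᵥ v i) t * invNorm (v j ⬝ᵥ v j) t) +
  (x i ⬝ᵥ x j + t * (v i ⬝ᵥ x j + x i ⬝ᵥ v j) + t ^ 2 * (v i ⬝ᵥ v j)) *
    (-(v i ⬝ᵥ v i * t) * invNorm (v i ⬝ᵥ v i) t ^ 3 * invNorm (v j ⬝ᵥ v j) t +
      invNorm (v i ⬝ᵥ v i) t * (-(v j ⬝ᵥ v j * t) * invNorm (v j ⬝ᵥ v j) t ^ 3))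

theorem hasDerivAt_lineDot {N : ℕ} (x v : Config N) (i j : Fin N) (t : ℝ) :
    HasDerivAt (lineDot x v i j) (lineDotDeriv x v i j t) t := by
  have h1 : HasDerivAt (fun t : ℝ => x i ⬝ᵥ x j + t * (v i ⬝ᵥ x j + x i ⬝ᵥ v j)
      + t ^ 2 * (v i ⬝ᵥ v j)) (v i ⬝ᵥ x j + x i ⬝ᵥ v j + 2 * t * (v i ⬝ᵥ v j)) t := by
    have := (((hasDerivAt_id t).mul_const (v i ⬝ᵥ x j + x i ⬝ᵥ v j)).const_add (x i ⬝ᵥ x j)).fun_add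
      ((hasDerivAt_pow 2 t).mul_const (v i ⬝ᵥ v j))
    simpa using this
  exact h1.mul ((hasDerivAt_invNorm (zero_le_dotProduct_self _) t).mul
    (hasDerivAt_invNorm (zero_le_dotProduct_self _) t))

/-- The factors `invNorm` are stationary at `0` with second derivative `-|v i|²`; this curvature of
the sphere produces the term in `x i ⬝ᵥ x j`. -/
theorem hasDerivAt_lineDotDeriv_zero {N : ℕ} (x v : Config N) (i j : Fin N) :
    HasDerivAt (lineDotDeriv x v i j)
      (2 * (v i ⬝ᵥ v j) - x i ⬝ᵥ x j * (v i ⬝ᵥ v i + v j ⬝ᵥ v j)) 0 := by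
  have hp : HasDerivAt (fun t : ℝ => x i ⬝ᵥ x j + t * (v i ⬝ᵥ x j + x i ⬝ᵥ v j)
      + t ^ 2 * (v i ⬝ᵥ v j)) (v i ⬝ᵥ x j + x i ⬝ᵥ v j) 0 := by
    have := (((hasDerivAt_id (0 : ℝ)).mul_const
      (v i ⬝ᵥ x j + x i ⬝ᵥ v j)).const_add (x i ⬝ᵥ x j)).fun_add
      ((hasDerivAt_pow 2 (0 : ℝ)).mul_const (v i ⬝ᵥ v j))
    simpa using this
  have hq : HasDerivAt (fun t : ℝ => v i ⬝ᵥ x j + x i ⬝ᵥ v j + 2 * t * (v i ⬝ᵥ v j))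
      (2 * (v i ⬝ᵥ v j)) 0 := by
    simpa using (((hasDerivAt_id (0 : ℝ)).const_mul 2).mul_const (v i ⬝ᵥ v j)).const_add
      (v i ⬝ᵥ x j + x i ⬝ᵥ v j)
  have hr : ∀ α : ℝ, 0 ≤ α → HasDerivAt (invNorm α) 0 0 := fun α hα => by
    simpa using hasDerivAt_invNorm hα 0
  have hl : ∀ α : ℝ, HasDerivAt (fun t : ℝ => -(α * t)) (-α) 0 := fun α => by
    simpa using ((hasDerivAt_id (0 : ℝ)).const_mul α).fun_neg
  have hi := hr _ (zero_le_dotProduct_self (v i))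
  have hj := hr _ (zero_le_dotProduct_self (v j))
  refine ((hq.mul (hi.mul hj)).add (hp.mul ((((hl (v i ⬝ᵥ v i)).mul (hi.pow 3)).mul hj).add
    (hi.mul ((hl (v j ⬝ᵥ v j)).mul (hj.pow 3)))))).congr_deriv ?_
  simp [invNorm_zero]
  ring

theorem augHamiltonian_retract_line {N : ℕ} (k : Fin N → ℝ) (ξ : Fin 3 → ℝ) {x v : Config N}
    (hx : ∀ i, x i ⬝ᵥ x i = 1) (hv : IsTangent x v) (t : ℝ) :
    augHamiltonian k ξ (retract (x + t • v)) =
      -∑ i, ∑ j ∈ Finset.Ioi i, k i * k j * Real.log (1 - lineDot x v i j t) -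
      ∑ i, k i * ((x i ⬝ᵥ ξ + t * (v i ⬝ᵥ ξ)) * invNorm (v i ⬝ᵥ v i) t) := by
  simp only [augHamiltonian, hamiltonian, momentum, retract_line hx hv, sum_dotProduct,
    smul_dotProduct, dotProduct_smul, add_dotProduct, dotProduct_add, smul_eq_mul, lineDot]
  congr 1
  · refine congrArg _ (Finset.sum_congr rfl fun i _ => Finset.sum_congr rfl fun j _ => ?_)
    congr 3
    ring
  · exact Finset.sum_congr rfl fun i _ => by ring

theorem lineDot_zero {N : ℕ} (x v : Config N) (i j : Fin N) : lineDot x v i j 0 = x i ⬝ᵥ x j := by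
  simp [lineDot, invNorm_zero]

theorem lineDotDeriv_zero {N : ℕ} (x v : Config N) (i j : Fin N) :
    lineDotDeriv x v i j 0 = v i ⬝ᵥ x j + x i ⬝ᵥ v j := by
  simp [lineDotDeriv, invNorm_zero]

/-- Holds for small `t` only: the logarithms are differentiable as long as the moving points stay
distinct. -/
theorem hasDerivAt_augHamiltonian_line {N : ℕ} (k : Fin N → ℝ) (ξ : Fin 3 → ℝ) {x v : Config N}
    (hx : x ∈ phaseSpace N) (hv : IsTangent x v) :
    ∀ᶠ t in nhds (0 : ℝ), HasDerivAt (fun t : ℝ => augHamiltonian k ξ (retract (x + t • v)))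
      (∑ i, ∑ j ∈ Finset.Ioi i, k i * k j * (lineDotDeriv x v i j t / (1 - lineDot x v i j t)) -
      ∑ i, k i * (v i ⬝ᵥ ξ * invNorm (v i ⬝ᵥ v i) t + (x i ⬝ᵥ ξ + t * (v i ⬝ᵥ ξ)) *
        (-(v i ⬝ᵥ v i * t) * invNorm (v i ⬝ᵥ v i) t ^ 3))) t := by
  have hne : ∀ i j, i ≠ j → ∀ᶠ t in nhds (0 : ℝ), 1 - lineDot x v i j t ≠ 0 := fun i j hij => by
    refine ContinuousAt.eventually_ne
      ((hasDerivAt_lineDot x v i j 0).continuousAt.const_sub 1) ?_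
    rw [lineDot_zero]
    exact (one_sub_dotProduct_pos (hx.1 i) (hx.1 j) fun h => hij (hx.2 h)).ne'
  have hall : ∀ᶠ t in nhds (0 : ℝ), ∀ i j, i ≠ j → 1 - lineDot x v i j t ≠ 0 := by
    simp only [Filter.eventually_all]
    exact hne
  filter_upwards [hall] with t ht
  simp only [augHamiltonian_retract_line k ξ hx.1 hv]
  refine HasDerivAt.sub ?_ ?_
  · have : ∑ i, ∑ j ∈ Finset.Ioi i,
        k i * k j * (lineDotDeriv x v i j t / (1 - lineDot x v i j t)) =
        -∑ i, ∑ j ∈ Finset.Ioi i,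
          k i * k j * (-lineDotDeriv x v i j t / (1 - lineDot x v i j t)) := by
      simp only [neg_div, mul_neg, Finset.sum_neg_distrib, neg_neg]
    rw [this]
    refine HasDerivAt.neg (HasDerivAt.fun_sum fun i _ => HasDerivAt.fun_sum fun j hj => ?_)
    exact (((hasDerivAt_lineDot x v i j t).const_sub 1).log
      (ht i j (Finset.mem_Ioi.1 hj).ne)).const_mul _
  · refine HasDerivAt.fun_sum fun i _ => HasDerivAt.const_mul _ ?_
    have h1 : HasDerivAt (fun t : ℝ => x i ⬝ᵥ ξ + t * (v i ⬝ᵥ ξ)) (v i ⬝ᵥ ξ) t := by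
      simpa using ((hasDerivAt_id t).mul_const (v i ⬝ᵥ ξ)).const_add (x i ⬝ᵥ ξ)
    exact h1.mul (hasDerivAt_invNorm (zero_le_dotProduct_self _) t)

theorem dAugHamiltonian_eq {N : ℕ} (k : Fin N → ℝ) (ξ : Fin 3 → ℝ) {x v : Config N}
    (hx : x ∈ phaseSpace N) (hv : IsTangent x v) :
    dAugHamiltonian k ξ x v =
      ∑ i, ∑ j ∈ Finset.Ioi i, k i * k j * pairGradient x v i j - ∑ i, k i * (v i ⬝ᵥ ξ) := by
  have h := (hasDerivAt_augHamiltonian_line k ξ hx hv).self_of_nhds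
  rw [dAugHamiltonian, fderiv_apply_of_hasDerivAt_line
    ((contDiffAt_augHamiltonian_retract k ξ hx).differentiableAt (by simp)) h]
  simp [lineDot_zero, lineDotDeriv_zero, invNorm_zero, pairGradient]

/-- The momentum is linear, so `⟨Φ, ξ⟩` contributes only through the bending of the retracted line,
whose second derivative at `0` is `-|v i|² x i`. -/
theorem hessian_self_eq {N : ℕ} (k : Fin N → ℝ) (ξ : Fin 3 → ℝ) {x v : Config N}
    (hx : x ∈ phaseSpace N) (hv : IsTangent x v) :
    hessian k ξ x v v =
      ∑ i, ∑ j ∈ Finset.Ioi i, k i * k j * pairHessian x v v i j +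
        ∑ i, k i * (x i ⬝ᵥ ξ * (v i ⬝ᵥ v i)) := by
  rw [hessian]
  refine fderiv_fderiv_apply_of_hasDerivAt_line (contDiffAt_augHamiltonian_retract k ξ hx)
    (hasDerivAt_augHamiltonian_line k ξ hx hv) ?_
  have hneg : ∑ i, k i * (x i ⬝ᵥ ξ * (v i ⬝ᵥ v i)) = -∑ i, k i * -(x i ⬝ᵥ ξ * (v i ⬝ᵥ v i)) := by
    simp
  rw [hneg, ← sub_eq_add_neg]
  refine HasDerivAt.sub (HasDerivAt.fun_sum fun i _ => HasDerivAt.fun_sum fun j hj =>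
    HasDerivAt.const_mul _ ?_) (HasDerivAt.fun_sum fun i _ => HasDerivAt.const_mul _ ?_)
  · have hij : i ≠ j := (Finset.mem_Ioi.1 hj).ne
    have hpos := (one_sub_dotProduct_pos (hx.1 i) (hx.1 j) fun h => hij (hx.2 h)).ne'
    refine ((hasDerivAt_lineDotDeriv_zero x v i j).div
      ((hasDerivAt_lineDot x v i j 0).const_sub 1) (by rwa [lineDot_zero])).congr_deriv ?_
    rw [lineDot_zero, lineDotDeriv_zero, pairHessian]
    field_simp
    ring
  · have h1 : HasDerivAt (fun t : ℝ => x i ⬝ᵥ ξ + t * (v i ⬝ᵥ ξ)) (v i ⬝ᵥ ξ) 0 := by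
      simpa using ((hasDerivAt_id (0 : ℝ)).mul_const (v i ⬝ᵥ ξ)).const_add (x i ⬝ᵥ ξ)
    have hr : HasDerivAt (invNorm (v i ⬝ᵥ v i)) 0 0 := by
      simpa using hasDerivAt_invNorm (zero_le_dotProduct_self (v i)) 0
    have hl : HasDerivAt (fun t : ℝ => -(v i ⬝ᵥ v i * t)) (-(v i ⬝ᵥ v i)) 0 := by
      simpa using ((hasDerivAt_id (0 : ℝ)).const_mul (v i ⬝ᵥ v i)).fun_neg
    refine ((hr.const_mul (v i ⬝ᵥ ξ)).add (h1.mul (hl.mul (hr.pow 3)))).congr_deriv ?_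
    simp [invNorm_zero]

theorem hessian_comm {N : ℕ} (k : Fin N → ℝ) (ξ : Fin 3 → ℝ) {x : Config N}
    (hx : x ∈ phaseSpace N) (v w : Config N) : hessian k ξ x v w = hessian k ξ x w v :=
  (contDiffAt_augHamiltonian_retract k ξ hx).isSymmSndFDerivAt (by simp) v w

theorem pairHessian_add_self {N : ℕ} (x v w : Config N) (i j : Fin N) :
    pairHessian x (v + w) (v + w) i j =
      pairHessian x v v i j + 2 * pairHessian x v w i j + pairHessian x w w i j := by
  simp only [pairHessian, Pi.add_apply, add_dotProduct, dotProduct_add, dotProduct_comm (w i) (v i),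
    dotProduct_comm (w j) (v j)]
  ring

/-- Polarization of `hessian_self_eq`. -/
theorem hessian_eq {N : ℕ} (k : Fin N → ℝ) (ξ : Fin 3 → ℝ) {x v w : Config N}
    (hx : x ∈ phaseSpace N) (hv : IsTangent x v) (hw : IsTangent x w) :
    hessian k ξ x v w =
      ∑ i, ∑ j ∈ Finset.Ioi i, k i * k j * pairHessian x v w i j +
        ∑ i, k i * (x i ⬝ᵥ ξ * (v i ⬝ᵥ w i)) := by
  have hvw : IsTangent x (v + w) := fun i => by
    rw [Pi.add_apply, dotProduct_add, hv i, hw i, add_zero]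
  have h1 := hessian_self_eq k ξ hx hv
  have h2 := hessian_self_eq k ξ hx hw
  have h3 := hessian_self_eq k ξ hx hvw
  have h4 : hessian k ξ x (v + w) (v + w) =
      hessian k ξ x v v + 2 * hessian k ξ x v w + hessian k ξ x w w := by
    have := hessian_comm k ξ hx v w
    simp only [hessian, map_add, add_apply] at this ⊢
    linarith
  have h5 : ∀ i, k i * (x i ⬝ᵥ ξ * ((v + w) i ⬝ᵥ (v + w) i)) =
      k i * (x i ⬝ᵥ ξ * (v i ⬝ᵥ v i)) + 2 * (k i * (x i ⬝ᵥ ξ * (v i ⬝ᵥ w i))) +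
        k i * (x i ⬝ᵥ ξ * (w i ⬝ᵥ w i)) := fun i => by
    simp only [Pi.add_apply, add_dotProduct, dotProduct_add, dotProduct_comm (w i) (v i)]
    ring
  have h6 : ∀ i j, k i * k j * pairHessian x (v + w) (v + w) i j =
      k i * k j * pairHessian x v v i j + 2 * (k i * k j * pairHessian x v w i j) +
        k i * k j * pairHessian x w w i j := fun i j => by
    rw [pairHessian_add_self]
    ring
  simp only [h5, h6, Finset.sum_add_distrib, ← Finset.mul_sum] at h3
  linarith


/-! ### The ring with a pole -/

/-- The unit vector in the direction of increasing co-latitude at the `s`-th ring vortex. -/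
def thetaVec (n : ℕ) (θ : ℝ) (s : Fin n) : Fin 3 → ℝ :=
  ![Real.cos θ * Real.cos (ringAngle n s), Real.cos θ * Real.sin (ringAngle n s), -Real.sin θ]

/-- The unit vector in the direction of increasing longitude at the `s`-th ring vortex. -/
def phiVec (n : ℕ) (s : Fin n) : Fin 3 → ℝ :=
  ![-Real.sin (ringAngle n s), Real.cos (ringAngle n s), 0]

/-- The tangent vector with coordinates `a`, `b` along `thetaVec`, `phiVec` on the ring and
`(p, q)` at the pole. -/
def tangentVec (n : ℕ) (θ : ℝ) (a b : Fin n → ℝ) (p q : ℝ) : Config (n + 1) :=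
  Fin.snoc (α := fun _ => Fin 3 → ℝ) (fun s => a s • thetaVec n θ s + b s • phiVec n s) ![p, q, 0]

theorem ringPole_castSucc (n : ℕ) (θ : ℝ) (s : Fin n) :
    ringPole n θ s.castSucc = ![Real.sin θ * Real.cos (ringAngle n s),
      Real.sin θ * Real.sin (ringAngle n s), Real.cos θ] :=
  Fin.snoc_castSucc (α := fun _ => Fin 3 → ℝ) _ _ _

theorem ringPole_last (n : ℕ) (θ : ℝ) : ringPole n θ (Fin.last n) = ![0, 0, 1] :=
  Fin.snoc_last (α := fun _ => Fin 3 → ℝ) _ _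

theorem ringPoleVorticity_castSucc (n : ℕ) (κ : ℝ) (s : Fin n) :
    ringPoleVorticity n κ s.castSucc = 1 :=
  Fin.snoc_castSucc (α := fun _ => ℝ) _ _ _

theorem ringPoleVorticity_last (n : ℕ) (κ : ℝ) : ringPoleVorticity n κ (Fin.last n) = κ :=
  Fin.snoc_last (α := fun _ => ℝ) _ _

theorem tangentVec_castSucc (n : ℕ) (θ : ℝ) (a b : Fin n → ℝ) (p q : ℝ) (s : Fin n) :
    tangentVec n θ a b p q s.castSucc = a s • thetaVec n θ s + b s • phiVec n s :=
  Fin.snoc_castSucc (α := fun _ => Fin 3 → ℝ) _ _ _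

theorem tangentVec_last (n : ℕ) (θ : ℝ) (a b : Fin n → ℝ) (p q : ℝ) :
    tangentVec n θ a b p q (Fin.last n) = ![p, q, 0] :=
  Fin.snoc_last (α := fun _ => Fin 3 → ℝ) _ _

theorem ringPole_dotProduct_ringPole (n : ℕ) (θ : ℝ) (s t : Fin n) :
    ringPole n θ s.castSucc ⬝ᵥ ringPole n θ t.castSucc
      = 1 - Real.sin θ ^ 2 * (1 - Real.cos (ringAngle n s - ringAngle n t)) := by
  simp only [ringPole_castSucc, Matrix.vec3_dotProduct', Real.cos_sub]
  linear_combination Real.sin_sq_add_cos_sq θ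

theorem ringPole_dotProduct_last (n : ℕ) (θ : ℝ) (s : Fin n) :
    ringPole n θ s.castSucc ⬝ᵥ ringPole n θ (Fin.last n) = Real.cos θ := by
  simp [ringPole_castSucc, ringPole_last]

theorem ringPole_mem_phaseSpace (n : ℕ) {θ : ℝ} (h0 : 0 < θ) (h1 : θ < Real.pi) :
    ringPole n θ ∈ phaseSpace (n + 1) := by
  have hs : Real.sin θ ≠ 0 := (Real.sin_pos_of_pos_of_lt_pi h0 h1).ne'
  have hunit : ∀ i, ringPole n θ i ⬝ᵥ ringPole n θ i = 1 := fun i => by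
    refine Fin.lastCases ?_ (fun s => ?_) i
    · simp [ringPole_last]
    · simp [ringPole_dotProduct_ringPole]
  have hpole : ∀ s : Fin n, ringPole n θ s.castSucc ≠ ringPole n θ (Fin.last n) := fun s h => by
    have h2 := ringPole_dotProduct_last n θ s
    rw [h, hunit] at h2
    have := Real.sin_sq_add_cos_sq θ
    rw [← h2] at this
    exact hs (pow_eq_zero_iff two_ne_zero |>.1 (by linarith))
  refine ⟨hunit, fun i j => ?_⟩
  refine Fin.lastCases ?_ (fun s => ?_) i <;> refine Fin.lastCases ?_ (fun t => ?_) j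
  · exact fun _ => rfl
  · exact fun h => (hpole t h.symm).elim
  · exact fun h => (hpole s h).elim
  · intro h
    by_contra hst
    have hst' : s ≠ t := fun h => hst (by rw [h])
    have h2 := ringPole_dotProduct_ringPole n θ s t
    rw [h, hunit] at h2
    have h3 := mul_ne_zero (pow_ne_zero 2 hs) (one_sub_cos_ne_zero hst')
    exact h3 (by linarith)

theorem isTangent_tangentVec (n : ℕ) (θ : ℝ) (a b : Fin n → ℝ) (p q : ℝ) :
    IsTangent (ringPole n θ) (tangentVec n θ a b p q) := fun i => by
  refine Fin.lastCases ?_ (fun s => ?_) i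
  · simp [ringPole_last, tangentVec_last]
  · simp only [ringPole_castSucc, tangentVec_castSucc, thetaVec, phiVec, dotProduct_add,
      dotProduct_smul, Matrix.vec3_dotProduct', smul_eq_mul]
    linear_combination Real.sin θ * Real.cos θ * a s * Real.sin_sq_add_cos_sq (ringAngle n s)

/-- On the ring, `thetaVec`, `phiVec` and the radial vector form an orthonormal frame, so the
coordinates are inner products; at the pole tangency kills the third component. -/
theorem exists_eq_tangentVec {n : ℕ} {θ : ℝ} {v : Config (n + 1)}
    (hv : IsTangent (ringPole n θ) v) : ∃ a b p q, v = tangentVec n θ a b p q := by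
  refine ⟨fun s => v s.castSucc ⬝ᵥ thetaVec n θ s, fun s => v s.castSucc ⬝ᵥ phiVec n s,
    v (Fin.last n) 0, v (Fin.last n) 1, ?_⟩
  funext i
  refine Fin.lastCases ?_ (fun s => ?_) i
  · have h := hv (Fin.last n)
    rw [ringPole_last, Matrix.vec3_dotProduct] at h
    simp at h
    ext m
    rw [tangentVec_last]
    fin_cases m <;> simp [h]
  · have h := hv s.castSucc
    rw [ringPole_castSucc, Matrix.vec3_dotProduct] at h
    simp only [Matrix.cons_val_zero, Matrix.cons_val_one, Matrix.cons_val] at h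
    have h1 := Real.sin_sq_add_cos_sq (ringAngle n s)
    have h2 := Real.sin_sq_add_cos_sq θ
    ext m
    rw [tangentVec_castSucc]
    generalize v s.castSucc = u at h ⊢
    simp only [thetaVec, phiVec, Matrix.vec3_dotProduct, Pi.add_apply, Pi.smul_apply, smul_eq_mul,
      Matrix.cons_val_zero, Matrix.cons_val_one, Matrix.cons_val]
    generalize Real.sin (ringAngle n s) = S at *
    generalize Real.cos (ringAngle n s) = C at *
    generalize Real.sin θ = σ at *
    generalize Real.cos θ = c at *
    fin_cases m
    · simp
      linear_combination (-u 0) * h1 - C * (C * u 0 + S * u 1) * h2 + σ * C * h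
    · simp
      linear_combination (-u 1) * h1 - S * (C * u 0 + S * u 1) * h2 + σ * S * h
    · simp
      linear_combination (-u 2) * h2 + c * h

/-! ### Trigonometric sums over the ring, the momentum and the slice. -/

theorem sum_mode_one {n : ℕ} (hn : 3 ≤ n) : ∑ s, mode n 1 s = 0 := by
  rw [sum_mode (by omega), if_neg]
  intro h
  have := Int.le_of_dvd one_pos h
  omega

/-- Here `3 ≤ n` is essential: it keeps `n` from dividing `2`, and so makes the second moments of
the ring isotropic. -/
theorem sum_mode_two {n : ℕ} (hn : 3 ≤ n) : ∑ s, mode n 2 s = 0 := by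
  rw [sum_mode (by omega), if_neg]
  intro h
  have := Int.le_of_dvd two_pos h
  omega

theorem mode_eq_cos_add_sin (n : ℕ) (l : ℤ) (s : Fin n) :
    mode n l s = (Real.cos (l * ringAngle n s) : ℝ) + (Real.sin (l * ringAngle n s) : ℝ) *
      Complex.I := by
  rw [mode_eq_exp, Complex.exp_mul_I]
  push_cast
  rfl

theorem sum_cos_ringAngle {n : ℕ} (hn : 3 ≤ n) : ∑ s, Real.cos (ringAngle n s) = 0 := by
  have h := congrArg Complex.re (sum_mode_one hn)
  simpa [mode_eq_cos_add_sin, -Complex.ofReal_cos, -Complex.ofReal_sin] using h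

theorem sum_sin_ringAngle {n : ℕ} (hn : 3 ≤ n) : ∑ s, Real.sin (ringAngle n s) = 0 := by
  have h := congrArg Complex.im (sum_mode_one hn)
  simpa [mode_eq_cos_add_sin, -Complex.ofReal_cos, -Complex.ofReal_sin] using h

theorem sum_cos_sq_ringAngle {n : ℕ} (hn : 3 ≤ n) :
    ∑ s, Real.cos (ringAngle n s) ^ 2 = n / 2 := by
  have h := congrArg Complex.re (sum_mode_two hn)
  simp [mode_eq_cos_add_sin, -Complex.ofReal_cos, -Complex.ofReal_sin] at h
  simp only [Real.cos_two_mul, Finset.sum_sub_distrib, ← Finset.mul_sum] at h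
  simp at h
  linarith

theorem sum_sin_sq_ringAngle {n : ℕ} (hn : 3 ≤ n) :
    ∑ s, Real.sin (ringAngle n s) ^ 2 = n / 2 := by
  simp only [Real.sin_sq, Finset.sum_sub_distrib, sum_cos_sq_ringAngle hn]
  simp
  ring

theorem sum_sin_mul_cos_ringAngle {n : ℕ} (hn : 3 ≤ n) :
    ∑ s, Real.sin (ringAngle n s) * Real.cos (ringAngle n s) = 0 := by
  have h := congrArg Complex.im (sum_mode_two hn)
  simp [mode_eq_cos_add_sin, -Complex.ofReal_cos, -Complex.ofReal_sin, Real.sin_two_mul,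
    ← Finset.mul_sum, mul_assoc] at h
  exact h

theorem momentum_ringPole {n : ℕ} (hn : 3 ≤ n) (θ κ : ℝ) :
    momentum (ringPoleVorticity n κ) (ringPole n θ) = ![0, 0, κ + n * Real.cos θ] := by
  have h1 := sum_cos_ringAngle hn
  have h2 := sum_sin_ringAngle hn
  ext m
  simp only [momentum, Fin.sum_univ_castSucc, ringPoleVorticity_castSucc, ringPoleVorticity_last,
    ringPole_castSucc, ringPole_last, Finset.sum_apply, Pi.smul_apply]
  fin_cases m
  · simp [← Finset.mul_sum, h1]
  · simp [← Finset.mul_sum, h2]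
  · simp
    ring

/-- The vertical part of `Ker DΦ` gives `∑ a = 0`, and its horizontal part determines `κ p` and `κ
q`. Since `μ` is vertical and nonzero, its stabilizer is the group of rotations about the axis, and
orthogonality to that orbit is `∑ b = 0`. -/
theorem tangentVec_mem_symplecticSlice_iff {n : ℕ} (hn : 3 ≤ n) {θ κ : ℝ}
    (hs : Real.sin θ ≠ 0) (hμ : κ + n * Real.cos θ ≠ 0) (a b : Fin n → ℝ) (p q : ℝ) :
    tangentVec n θ a b p q ∈ symplecticSlice (ringPoleVorticity n κ) (ringPole n θ) ↔
      ∑ s, a s = 0 ∧ ∑ s, b s = 0 ∧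
      κ * p = -∑ s, (Real.cos θ * a s * Real.cos (ringAngle n s)
        - b s * Real.sin (ringAngle n s)) ∧
      κ * q = -∑ s, (Real.cos θ * a s * Real.sin (ringAngle n s)
        + b s * Real.cos (ringAngle n s)) := by
  have hk : ∑ i, ringPoleVorticity n κ i • tangentVec n θ a b p q i = 0 ↔ ∑ s, a s = 0 ∧
      κ * p = -∑ s, (Real.cos θ * a s * Real.cos (ringAngle n s)
        - b s * Real.sin (ringAngle n s)) ∧
      κ * q = -∑ s, (Real.cos θ * a s * Real.sin (ringAngle n s)
        + b s * Real.cos (ringAngle n s)) := by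
    have e : ∑ i, ringPoleVorticity n κ i • tangentVec n θ a b p q i =
        ![∑ s, (Real.cos θ * a s * Real.cos (ringAngle n s)
        - b s * Real.sin (ringAngle n s)) + κ * p, ∑ s, (Real.cos θ * a s * Real.sin (ringAngle n s)
        + b s * Real.cos (ringAngle n s)) + κ * q, -(Real.sin θ * ∑ s, a s)] := by
      ext m
      simp only [Fin.sum_univ_castSucc, ringPoleVorticity_castSucc, ringPoleVorticity_last,
        tangentVec_castSucc, tangentVec_last, Pi.add_apply, Finset.sum_apply, Pi.smul_apply,
        thetaVec, phiVec]
      fin_cases m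
      · simp [-Finset.sum_sub_distrib]
        exact Finset.sum_congr rfl fun s _ => by ring
      · simp
        exact Finset.sum_congr rfl fun s _ => by ring
      · simp [← Finset.sum_mul, mul_comm]
    rw [e]
    constructor
    · intro h
      have h0 := congrFun h 0
      have h1 := congrFun h 1
      have h2 := congrFun h 2
      simp [hs, -Finset.sum_sub_distrib] at h0 h1 h2
      exact ⟨h2, by linarith, by linarith⟩
    · rintro ⟨h0, h1, h2⟩
      rw [h0, h1, h2]
      ext m
      fin_cases m <;> simp
  have hb : (∀ η : Fin 3 → ℝ,
      η ⨯₃ momentum (ringPoleVorticity n κ) (ringPole n θ) = 0 →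
        ∑ i, tangentVec n θ a b p q i ⬝ᵥ (η ⨯₃ ringPole n θ i) = 0) ↔ ∑ s, b s = 0 := by
    have e : ∀ z : ℝ, ∑ i, tangentVec n θ a b p q i ⬝ᵥ (![0, 0, z] ⨯₃ ringPole n θ i)
        = z * (Real.sin θ * ∑ s, b s) := fun z => by
      simp only [Fin.sum_univ_castSucc, tangentVec_castSucc, tangentVec_last, ringPole_castSucc,
        ringPole_last, cross_apply, add_dotProduct, smul_dotProduct, thetaVec, phiVec,
        smul_eq_mul, Finset.mul_sum]
      simp
      refine Finset.sum_congr rfl fun s _ => ?_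
      linear_combination z * Real.sin θ * b s * Real.sin_sq_add_cos_sq (ringAngle n s)
    rw [momentum_ringPole hn]
    constructor
    · intro h
      have := h ![0, 0, 1] (by simp [cross_apply])
      rw [e] at this
      simpa [hs] using this
    · intro h η hη
      have h0 := congrFun hη 0
      have h1 := congrFun hη 1
      simp [cross_apply, hμ] at h0 h1
      have : η = ![0, 0, η 2] := by
        ext m
        fin_cases m <;> simp [h0, h1]
      rw [this, e, h, mul_zero, mul_zero]
  change (IsTangent _ _ ∧ _ ∧ _) ↔ _
  rw [hk, hb]
  have := isTangent_tangentVec n θ a b p q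
  tauto


/-! ### The Hessian in frame coordinates. -/

/-- The angular velocity of the ring with a pole. -/
def angularVelocity (n : ℕ) (θ κ : ℝ) : ℝ :=
  ((n - 1) * Real.cos θ + κ * (1 + Real.cos θ)) / Real.sin θ ^ 2

/-- The weight of the Dirichlet form. -/
def ringWeight (n : ℕ) (s t : Fin n) : ℝ := 1 / (1 - Real.cos (ringAngle n s - ringAngle n t))

/-- The cotangent of half the longitude difference. -/
def ringCot (n : ℕ) (s t : Fin n) : ℝ :=
  Real.sin (ringAngle n s - ringAngle n t) / (1 - Real.cos (ringAngle n s - ringAngle n t))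

theorem ringCot_swap (n : ℕ) (s t : Fin n) : ringCot n s t = -ringCot n t s := by
  rw [ringCot, ringCot, ← neg_sub (ringAngle n t), Real.sin_neg, Real.cos_neg, neg_div]

/-- Rows of the odd kernel `ringCot` sum to zero, hence so do its columns. This removes the coupling
of `a` and `b` inside the ring. -/
theorem sum_ringCot_mul_sub {n : ℕ} (f : Fin n → ℝ) :
    ∑ s, ∑ t, ringCot n s t * (f s - f t) = 0 := by
  have h1 : ∑ s, ∑ t, ringCot n s t * f s = 0 := by
    refine Finset.sum_eq_zero fun s _ => ?_
    rw [← Finset.sum_mul]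
    simp only [ringCot, sum_sin_div_one_sub_cos, zero_mul]
  have h2 : ∑ s, ∑ t, ringCot n s t * f t = 0 := by
    rw [Finset.sum_comm]
    refine Finset.sum_eq_zero fun t _ => ?_
    rw [← Finset.sum_mul]
    simp only [ringCot_swap n _ t, Finset.sum_neg_distrib]
    simp only [ringCot, sum_sin_div_one_sub_cos, neg_zero, zero_mul]
  simp only [mul_sub, Finset.sum_sub_distrib, h1, h2, sub_zero]

theorem ringWeight_mul {n : ℕ} {s t : Fin n} (h : s ≠ t) :
    ringWeight n s t * (1 - Real.cos (ringAngle n s - ringAngle n t)) = 1 :=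
  one_div_mul_cancel (one_sub_cos_ne_zero h)

theorem ringCot_mul {n : ℕ} {s t : Fin n} (h : s ≠ t) :
    ringCot n s t * (1 - Real.cos (ringAngle n s - ringAngle n t))
      = Real.sin (ringAngle n s - ringAngle n t) :=
  div_mul_cancel₀ _ (one_sub_cos_ne_zero h)

theorem ringCot_sq {n : ℕ} {s t : Fin n} (h : s ≠ t) :
    ringCot n s t ^ 2 = 2 * ringWeight n s t - 1 := by
  have h1 := one_sub_cos_ne_zero h
  rw [ringCot, ringWeight, div_pow, Real.sin_sq]
  field_simp
  ring

theorem tangentVec_dotProduct_ringPole (n : ℕ) (θ : ℝ) (a b : Fin n → ℝ) (p q : ℝ) (s t : Fin n) :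
    tangentVec n θ a b p q s.castSucc ⬝ᵥ ringPole n θ t.castSucc
      = -Real.sin θ * (Real.cos θ * (1 - Real.cos (ringAngle n s - ringAngle n t)) * a s +
        Real.sin (ringAngle n s - ringAngle n t) * b s) := by
  simp only [ringPole_castSucc, tangentVec_castSucc, thetaVec, phiVec, add_dotProduct,
      smul_dotProduct, Matrix.vec3_dotProduct', smul_eq_mul, Real.cos_sub, Real.sin_sub]
  ring

theorem tangentVec_dotProduct_tangentVec (n : ℕ) (θ : ℝ) (a b a' b' : Fin n → ℝ) (p q p' q' : ℝ)
    (s t : Fin n) :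
    tangentVec n θ a b p q s.castSucc ⬝ᵥ tangentVec n θ a' b' p' q' t.castSucc
      = a s * a' t * (1 - Real.cos θ ^ 2 * (1 - Real.cos (ringAngle n s - ringAngle n t)))
        + b s * b' t * Real.cos (ringAngle n s - ringAngle n t)
        + Real.cos θ * Real.sin (ringAngle n s - ringAngle n t) * (a s * b' t - b s * a' t) := by
  simp only [tangentVec_castSucc, thetaVec, phiVec, add_dotProduct, dotProduct_add,
      smul_dotProduct, dotProduct_smul, Matrix.vec3_dotProduct', smul_eq_mul, Real.cos_sub,
      Real.sin_sub]
  linear_combination a s * a' t * Real.sin_sq_add_cos_sq θ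

/-- The chord factor `1 - x_s·x_t` is `sin² θ (1 - cos (φ_s - φ_t))`. After clearing `sin² θ`, only
`ringWeight`, `ringCot` and constants remain, with `ringCot_sq` turning squared cotangents into
weights. -/
theorem sin_sq_mul_pairHessian_ring {n : ℕ} {θ : ℝ} (hs : Real.sin θ ≠ 0) (a b a' b' : Fin n → ℝ)
    (p q p' q' : ℝ) {s t : Fin n} (h : s ≠ t) :
    Real.sin θ ^ 2 * pairHessian (ringPole n θ) (tangentVec n θ a b p q)
        (tangentVec n θ a' b' p' q') s.castSucc t.castSucc
      = (a s * a' s + a t * a' t) - Real.cos θ ^ 2 * (b s * b' s + b t * b' t)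
        - ringWeight n s t * ((a s - a t) * (a' s - a' t))
        + ringWeight n s t * ((b s - b t) * (b' s - b' t))
        + Real.cos θ * (ringCot n s t *
          ((a s * b' s + a' s * b s) - (a t * b' t + a' t * b t))) := by
  have h1 := one_sub_cos_ne_zero h
  have h2 := ringWeight_mul h
  have h3 := ringCot_mul h
  have h4 := ringCot_sq h
  have h5 := Real.sin_sq_add_cos_sq θ
  have e1 : Real.cos (ringAngle n t - ringAngle n s) = Real.cos (ringAngle n s - ringAngle n t) := by
    rw [← neg_sub, Real.cos_neg]
  have e2 : Real.sin (ringAngle n t - ringAngle n s)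
      = -Real.sin (ringAngle n s - ringAngle n t) := by
    rw [← neg_sub, Real.sin_neg]
  rw [pairHessian]
  simp only [dotProduct_comm (ringPole n θ s.castSucc) (tangentVec _ _ _ _ _ _ _),
    tangentVec_dotProduct_ringPole, tangentVec_dotProduct_tangentVec, ringPole_dotProduct_ringPole,
    e1, e2, sub_self, Real.cos_zero, Real.sin_zero]
  rw [← h3]
  generalize ringCot n s t = ρ at *
  generalize ringWeight n s t = m at *
  generalize Real.cos (ringAngle n s - ringAngle n t) = K at *
  generalize Real.sin θ = σ at *
  generalize Real.cos θ = c at *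
  have hm : m ≠ 0 := left_ne_zero_of_mul_eq_one h2
  -- Eliminating `K` in favour of the weight `m` makes `m` and `σ` the only denominators.
  have hK : K = 1 - 1 / m := by
    field_simp
    linear_combination -h2
  subst hK
  have e3 : 1 - (1 - 1 / m) = 1 / m := by ring
  have e4 : 1 - (1 - σ ^ 2 * (1 - (1 - 1 / m))) = σ ^ 2 / m := by ring
  rw [e4]
  simp only [e3]
  field_simp
  linear_combination ((b s - b t) * (b' s - b' t)) * h4 +
    (a s * a' s + a t * a' t + b s * b' s + b t * b' t) * h5

/-- Here the chord factor is `1 - cos θ`, and `sin² θ / (1 - cos θ) = 1 + cos θ` explains the powers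
of `1 + cos θ`. -/
theorem sin_sq_mul_pairHessian_pole {n : ℕ} {θ : ℝ} (hs : Real.sin θ ≠ 0) (a b a' b' : Fin n → ℝ)
    (p q p' q' : ℝ) (s : Fin n) :
    Real.sin θ ^ 2 * pairHessian (ringPole n θ) (tangentVec n θ a b p q)
        (tangentVec n θ a' b' p' q') s.castSucc (Fin.last n)
      = (1 + Real.cos θ) ^ 2 *
        ((p * Real.cos (ringAngle n s) + q * Real.sin (ringAngle n s) - a s) *
        (p' * Real.cos (ringAngle n s) + q' * Real.sin (ringAngle n s) - a' s)) +
        (1 + Real.cos θ) * ((Real.cos θ * a s * Real.cos (ringAngle n s)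
        - b s * Real.sin (ringAngle n s)) * p' + (Real.cos θ * a s * Real.sin (ringAngle n s)
        + b s * Real.cos (ringAngle n s)) * q' + (Real.cos θ * a' s * Real.cos (ringAngle n s)
        - b' s * Real.sin (ringAngle n s)) * p + (Real.cos θ * a' s * Real.sin (ringAngle n s)
        + b' s * Real.cos (ringAngle n s)) * q
        - Real.cos θ * (a s * a' s + b s * b' s + p * p' + q * q')) := by
  have h5 := Real.sin_sq_add_cos_sq θ
  have h6 : 1 - Real.cos θ ≠ 0 := fun h => hs (by
    have : Real.sin θ ^ 2 = 0 := by
      rw [← sub_eq_zero.1 h] at h5; linarith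
    exact pow_eq_zero_iff two_ne_zero |>.1 this)
  have h7 : Real.sin θ ^ 2 = (1 - Real.cos θ) * (1 + Real.cos θ) := by linear_combination h5
  rw [pairHessian]
  simp only [tangentVec_dotProduct_tangentVec, ringPole_dotProduct_last, sub_self, Real.cos_zero,
    Real.sin_zero]
  simp only [tangentVec_castSucc, tangentVec_last, ringPole_last, ringPole_castSucc, thetaVec,
    phiVec, add_dotProduct, smul_dotProduct, Matrix.vec3_dotProduct', smul_eq_mul]
  field_simp
  linear_combination ((p * Real.cos (ringAngle n s) + q * Real.sin (ringAngle n s) - a s) *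
        (p' * Real.cos (ringAngle n s) + q' * Real.sin (ringAngle n s) - a' s) *
        (Real.sin θ ^ 2 + (1 - Real.cos θ) * (1 + Real.cos θ)) +
        (1 - Real.cos θ) * ((Real.cos θ * a s * Real.cos (ringAngle n s)
        - b s * Real.sin (ringAngle n s)) * p' + (Real.cos θ * a s * Real.sin (ringAngle n s)
        + b s * Real.cos (ringAngle n s)) * q' + (Real.cos θ * a' s * Real.cos (ringAngle n s)
        - b' s * Real.sin (ringAngle n s)) * p + (Real.cos θ * a' s * Real.sin (ringAngle n s)
        + b' s * Real.cos (ringAngle n s)) * q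
        - Real.cos θ * (a s * a' s + b s * b' s + p * p' + q * q'))) * h7

theorem pairHessian_swap {N : ℕ} (x v w : Config N) (i j : Fin N) :
    pairHessian x v w i j = pairHessian x v w j i := by
  rw [pairHessian, pairHessian, dotProduct_comm (x j) (x i), dotProduct_comm (v i) (x j),
    dotProduct_comm (w i) (x j), dotProduct_comm (x i) (v j), dotProduct_comm (x i) (w j),
    dotProduct_comm (w j) (v i), dotProduct_comm (v j) (w i)]
  ring

theorem pairHessian_self {N : ℕ} {x : Config N} (hx : ∀ i, x i ⬝ᵥ x i = 1) (v w : Config N)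
    (i : Fin N) : pairHessian x v w i i = 0 := by
  simp [pairHessian, hx]

/-- A sum over the pairs of vortices, split into pairs of ring vortices and pairs with the pole. -/
theorem sum_pairs_ringPole {n : ℕ} (κ : ℝ) (P : Fin (n + 1) → Fin (n + 1) → ℝ)
    (hs : ∀ i j, P i j = P j i) (hd : ∀ i, P i i = 0) :
    ∑ i, ∑ j ∈ Finset.Ioi i, ringPoleVorticity n κ i * ringPoleVorticity n κ j * P i j =
      1 / 2 * ∑ s : Fin n, ∑ t : Fin n, P s.castSucc t.castSucc +
        κ * ∑ s : Fin n, P s.castSucc (Fin.last n) := by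
  rw [sum_sum_Ioi_eq _ (fun i j => by rw [hs i j]; ring) (fun i => by rw [hd, mul_zero])]
  simp only [Fin.sum_univ_castSucc, ringPoleVorticity_castSucc, ringPoleVorticity_last,
    Finset.sum_add_distrib, hs (Fin.last n) (Fin.castSucc _), hd, one_mul, mul_one,
    ← Finset.mul_sum]
  ring

/-- The real Dirichlet form. -/
def realDirichletForm {n : ℕ} (f g : Fin n → ℝ) : ℝ :=
  1 / 2 * ∑ s, ∑ t, ringWeight n s t * ((f s - f t) * (g s - g t))

/-- The cotangent terms cancel in the sum, which leaves Dirichlet forms of opposite signs in `a` and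
in `b`. -/
theorem sin_sq_mul_sum_pairHessian_ring {n : ℕ} {θ : ℝ} (h0 : 0 < θ) (h1 : θ < Real.pi)
    (a b a' b' : Fin n → ℝ) (p q p' q' : ℝ) :
    Real.sin θ ^ 2 * (1 / 2 * ∑ s : Fin n, ∑ t : Fin n, pairHessian (ringPole n θ)
        (tangentVec n θ a b p q) (tangentVec n θ a' b' p' q') s.castSucc t.castSucc)
      = (n - 1) * ∑ s, a s * a' s - (n - 1) * Real.cos θ ^ 2 * ∑ s, b s * b' s
        - realDirichletForm a a' + realDirichletForm b b' := by
  have hs : Real.sin θ ≠ 0 := (Real.sin_pos_of_pos_of_lt_pi h0 h1).ne'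
  -- `pairHessian` vanishes on the diagonal but the off-diagonal formula does not. The correction at
  -- `s = t` is what turns the factor `n` into `n - 1`.
  have hp : ∀ s t : Fin n, Real.sin θ ^ 2 * pairHessian (ringPole n θ)
      (tangentVec n θ a b p q) (tangentVec n θ a' b' p' q') s.castSucc t.castSucc
      = a s * a' s + a t * a' t - Real.cos θ ^ 2 * (b s * b' s) - Real.cos θ ^ 2 * (b t * b' t)
        - ringWeight n s t * ((a s - a t) * (a' s - a' t))
        + ringWeight n s t * ((b s - b t) * (b' s - b' t))
        + Real.cos θ * (ringCot n s t *
          ((a s * b' s + a' s * b s) - (a t * b' t + a' t * b t)))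
        - if s = t then 2 * (a s * a' s) - 2 * Real.cos θ ^ 2 * (b s * b' s) else 0 := by
    intro s t
    split_ifs with h
    · subst h
      rw [pairHessian_self (ringPole_mem_phaseSpace n h0 h1).1]
      ring
    · rw [sin_sq_mul_pairHessian_ring hs a b a' b' p q p' q' h]
      ring
  have hc := sum_ringCot_mul_sub fun s => a s * b' s + a' s * b s
  rw [mul_left_comm]
  simp only [Finset.mul_sum, hp]
  simp only [Finset.sum_sub_distrib, Finset.sum_add_distrib, ← Finset.mul_sum, hc,
    Finset.sum_ite_eq, Finset.mem_univ, if_true, Finset.sum_const, Finset.card_univ,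
    Fintype.card_fin, nsmul_eq_mul, realDirichletForm]
  simp only [mul_left_comm _ (n : ℝ), ← Finset.mul_sum]
  ring

/-- No term in `∑ b b'` survives: the ring, pole and rotation contributions `-(n-1) cos² θ`, `-κ cos
θ (1 + cos θ)` and `cos θ sin² θ ω` cancel. This agrees with the invariance under rotation about the
axis, along which `b` is constant. -/
theorem sin_sq_mul_hessian_tangentVec {n : ℕ} (hn : 3 ≤ n) {θ κ : ℝ} (h0 : 0 < θ)
    (h1 : θ < Real.pi) (a b a' b' : Fin n → ℝ) (p q p' q' : ℝ) :
    Real.sin θ ^ 2 * hessian (ringPoleVorticity n κ) ![0, 0, angularVelocity n θ κ]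
        (ringPole n θ) (tangentVec n θ a b p q) (tangentVec n θ a' b' p' q')
      = ((n - 1) * (1 + Real.cos θ ^ 2) + κ * (1 + Real.cos θ) ^ 2) * ∑ s, a s * a' s
        - realDirichletForm a a' + realDirichletForm b b'
        - κ * (1 + Real.cos θ) ^ 2 *
          ((∑ s, a s * Real.cos (ringAngle n s)) * p' + (∑ s, a s * Real.sin (ringAngle n s)) * q'
          + (∑ s, a' s * Real.cos (ringAngle n s)) * p
          + (∑ s, a' s * Real.sin (ringAngle n s)) * q)
        + κ * (1 + Real.cos θ) *
          ((∑ s, (Real.cos θ * a s * Real.cos (ringAngle n s)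
            - b s * Real.sin (ringAngle n s))) * p'
          + (∑ s, (Real.cos θ * a s * Real.sin (ringAngle n s)
            + b s * Real.cos (ringAngle n s))) * q'
          + (∑ s, (Real.cos θ * a' s * Real.cos (ringAngle n s)
            - b' s * Real.sin (ringAngle n s))) * p
          + (∑ s, (Real.cos θ * a' s * Real.sin (ringAngle n s)
            + b' s * Real.cos (ringAngle n s))) * q)
        + κ * (n / 2 * (1 + Real.cos θ) ^ 2 - n * Real.cos θ * (1 + Real.cos θ)
          + (n - 1) * Real.cos θ + κ * (1 + Real.cos θ)) * (p * p' + q * q') := by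
  have hs : Real.sin θ ≠ 0 := (Real.sin_pos_of_pos_of_lt_pi h0 h1).ne'
  have hx := ringPole_mem_phaseSpace n h0 h1
  rw [hessian_eq _ _ hx (isTangent_tangentVec n θ a b p q) (isTangent_tangentVec n θ a' b' p' q'),
    sum_pairs_ringPole _ _ (pairHessian_swap _ _ _) (pairHessian_self hx.1 _ _), mul_add, mul_add,
    sin_sq_mul_sum_pairHessian_ring h0 h1, mul_left_comm _ κ, Finset.mul_sum Finset.univ _ (_ ^ 2)]
  simp only [sin_sq_mul_pairHessian_pole hs]
  have hω : Real.sin θ ^ 2 * angularVelocity n θ κ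
      = (n - 1) * Real.cos θ + κ * (1 + Real.cos θ) := by
    rw [angularVelocity]
    field_simp
  have hxi : ∑ i, ringPoleVorticity n κ i * (ringPole n θ i ⬝ᵥ ![0, 0, angularVelocity n θ κ] *
      (tangentVec n θ a b p q i ⬝ᵥ tangentVec n θ a' b' p' q' i))
      = angularVelocity n θ κ * (Real.cos θ * (∑ s, a s * a' s + ∑ s, b s * b' s)
        + κ * (p * p' + q * q')) := by
    simp only [Fin.sum_univ_castSucc, ringPoleVorticity_castSucc, ringPoleVorticity_last,
      tangentVec_dotProduct_tangentVec, ringPole_castSucc, ringPole_last, tangentVec_last,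
      Matrix.vec3_dotProduct', sub_self, Real.cos_zero, Real.sin_zero]
    have e : angularVelocity n θ κ * (Real.cos θ * (∑ s, a s * a' s + ∑ s, b s * b' s)
        + κ * (p * p' + q * q')) = ∑ s, angularVelocity n θ κ * (Real.cos θ *
          (a s * a' s + b s * b' s)) + angularVelocity n θ κ * (κ * (p * p' + q * q')) := by
      rw [mul_add, ← Finset.sum_add_distrib, Finset.mul_sum, Finset.mul_sum]
    rw [e]
    congr 1
    · exact Finset.sum_congr rfl fun s _ => by ring
    · ring
  rw [hxi, ← mul_assoc, hω]
  have hq : ∑ s, (p * Real.cos (ringAngle n s) + q * Real.sin (ringAngle n s) - a s) *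
        (p' * Real.cos (ringAngle n s) + q' * Real.sin (ringAngle n s) - a' s)
      = n / 2 * (p * p' + q * q') + ∑ s, a s * a' s
        - ((∑ s, a s * Real.cos (ringAngle n s)) * p' + (∑ s, a s * Real.sin (ringAngle n s)) * q'
          + (∑ s, a' s * Real.cos (ringAngle n s)) * p
          + (∑ s, a' s * Real.sin (ringAngle n s)) * q) := by
    have e : ∀ s, (p * Real.cos (ringAngle n s) + q * Real.sin (ringAngle n s) - a s) *
        (p' * Real.cos (ringAngle n s) + q' * Real.sin (ringAngle n s) - a' s)
        = p * p' * Real.cos (ringAngle n s) ^ 2 + q * q' * Real.sin (ringAngle n s) ^ 2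
        + (p * q' + q * p') * (Real.sin (ringAngle n s) * Real.cos (ringAngle n s))
        + a s * a' s - p' * (a s * Real.cos (ringAngle n s)) - q' * (a s * Real.sin (ringAngle n s))
        - p * (a' s * Real.cos (ringAngle n s)) - q * (a' s * Real.sin (ringAngle n s)) :=
      fun s => by ring
    simp only [e, Finset.sum_sub_distrib, Finset.sum_add_distrib, ← Finset.mul_sum,
      sum_cos_sq_ringAngle hn, sum_sin_sq_ringAngle hn, sum_sin_mul_cos_ringAngle hn]
    ring
  rw [Finset.sum_add_distrib, ← Finset.mul_sum, hq, ← Finset.mul_sum]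
  have hl : ∑ s, ((Real.cos θ * a s * Real.cos (ringAngle n s)
        - b s * Real.sin (ringAngle n s)) * p' + (Real.cos θ * a s * Real.sin (ringAngle n s)
        + b s * Real.cos (ringAngle n s)) * q' + (Real.cos θ * a' s * Real.cos (ringAngle n s)
        - b' s * Real.sin (ringAngle n s)) * p + (Real.cos θ * a' s * Real.sin (ringAngle n s)
        + b' s * Real.cos (ringAngle n s)) * q
        - Real.cos θ * (a s * a' s + b s * b' s + p * p' + q * q'))
      = (∑ s, (Real.cos θ * a s * Real.cos (ringAngle n s)
            - b s * Real.sin (ringAngle n s))) * p'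
          + (∑ s, (Real.cos θ * a s * Real.sin (ringAngle n s)
            + b s * Real.cos (ringAngle n s))) * q'
          + (∑ s, (Real.cos θ * a' s * Real.cos (ringAngle n s)
            - b' s * Real.sin (ringAngle n s))) * p
          + (∑ s, (Real.cos θ * a' s * Real.sin (ringAngle n s)
            + b' s * Real.cos (ringAngle n s))) * q
          - Real.cos θ * (∑ s, a s * a' s + ∑ s, b s * b' s + n * (p * p' + q * q')) := by
    rw [Finset.sum_sub_distrib, Finset.sum_add_distrib, Finset.sum_add_distrib,
      Finset.sum_add_distrib, ← Finset.sum_mul, ← Finset.sum_mul, ← Finset.sum_mul,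
      ← Finset.sum_mul, ← Finset.mul_sum]
    simp only [Finset.sum_add_distrib, Finset.sum_const, Finset.card_univ, Fintype.card_fin, nsmul_eq_mul]
    ring
  rw [hl]
  ring

/-! ### The relative equilibrium -/

theorem pairGradient_swap {N : ℕ} (x v : Config N) (i j : Fin N) :
    pairGradient x v i j = pairGradient x v j i := by
  rw [pairGradient, pairGradient, dotProduct_comm (x j) (x i), dotProduct_comm (v i) (x j),
    dotProduct_comm (x i) (v j), add_comm]

theorem pairGradient_self {N : ℕ} {x : Config N} (hx : ∀ i, x i ⬝ᵥ x i = 1) (v : Config N)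
    (i : Fin N) : pairGradient x v i i = 0 := by
  simp [pairGradient, hx]

theorem sin_mul_sum_pairGradient_ring {n : ℕ} {θ : ℝ} (h0 : 0 < θ) (h1 : θ < Real.pi)
    (a b : Fin n → ℝ) (p q : ℝ) :
    Real.sin θ * (1 / 2 * ∑ s : Fin n, ∑ t : Fin n, pairGradient (ringPole n θ)
        (tangentVec n θ a b p q) s.castSucc t.castSucc)
      = -(n - 1) * Real.cos θ * ∑ s, a s := by
  have hs : Real.sin θ ≠ 0 := (Real.sin_pos_of_pos_of_lt_pi h0 h1).ne'
  have hp : ∀ s t : Fin n, Real.sin θ * pairGradient (ringPole n θ)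
      (tangentVec n θ a b p q) s.castSucc t.castSucc
      = - Real.cos θ * a s - Real.cos θ * a t - ringCot n s t * (b s - b t)
        + if s = t then 2 * Real.cos θ * a s else 0 := by
    intro s t
    split_ifs with h
    · subst h
      rw [pairGradient_self (ringPole_mem_phaseSpace n h0 h1).1]
      ring
    · have e1 : Real.cos (ringAngle n t - ringAngle n s)
          = Real.cos (ringAngle n s - ringAngle n t) := by
        rw [← neg_sub, Real.cos_neg]
      have e2 : Real.sin (ringAngle n t - ringAngle n s)
          = -Real.sin (ringAngle n s - ringAngle n t) := by
        rw [← neg_sub, Real.sin_neg]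
      have h2 := one_sub_cos_ne_zero h
      rw [pairGradient, dotProduct_comm (ringPole n θ s.castSucc) (tangentVec _ _ _ _ _ _ _),
        tangentVec_dotProduct_ringPole, tangentVec_dotProduct_ringPole,
        ringPole_dotProduct_ringPole, e1, e2, ringCot, sub_sub_cancel]
      field_simp
      ring
  have hc := sum_ringCot_mul_sub b
  rw [mul_left_comm]
  simp only [Finset.mul_sum, hp]
  simp only [Finset.sum_sub_distrib, Finset.sum_add_distrib, ← Finset.mul_sum, hc,
    Finset.sum_ite_eq, Finset.mem_univ, if_true, Finset.sum_const, Finset.card_univ,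
    Fintype.card_fin, nsmul_eq_mul]
  ring

/-- By symmetry every first-order term is a multiple of `∑ a`; `angularVelocity` is the value for
which the ring, the pole and the rotation balance. -/
theorem isRelativeEquilibrium_ringPole {n : ℕ} (hn : 3 ≤ n) {θ : ℝ} (κ : ℝ) (h0 : 0 < θ)
    (h1 : θ < Real.pi) :
    IsRelativeEquilibrium (ringPoleVorticity n κ) (ringPole n θ)
      ![0, 0, angularVelocity n θ κ] := by
  have hx := ringPole_mem_phaseSpace n h0 h1
  have hs : Real.sin θ ≠ 0 := (Real.sin_pos_of_pos_of_lt_pi h0 h1).ne'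
  refine ⟨hx, fun v hv => ?_⟩
  obtain ⟨a, b, p, q, rfl⟩ := exists_eq_tangentVec hv
  rw [dAugHamiltonian_eq _ _ hx hv, sum_pairs_ringPole _ _ (pairGradient_swap _ _)
    (pairGradient_self hx.1 _)]
  have h5 := Real.sin_sq_add_cos_sq θ
  have h6 : 1 - Real.cos θ ≠ 0 := fun h => hs (by
    have : Real.sin θ ^ 2 = 0 := by
      rw [← sub_eq_zero.1 h] at h5; linarith
    exact pow_eq_zero_iff two_ne_zero |>.1 this)
  have h7 : Real.sin θ ^ 2 = (1 - Real.cos θ) * (1 + Real.cos θ) := by linear_combination h5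
  have hpole : Real.sin θ * ∑ s : Fin n, pairGradient (ringPole n θ) (tangentVec n θ a b p q)
      s.castSucc (Fin.last n) = -(1 + Real.cos θ) * ∑ s, a s := by
    have e : ∀ s : Fin n, Real.sin θ * pairGradient (ringPole n θ) (tangentVec n θ a b p q)
      s.castSucc (Fin.last n) = (1 + Real.cos θ) * (p * Real.cos (ringAngle n s)
        + q * Real.sin (ringAngle n s) - a s) := fun s => by
      rw [pairGradient, ringPole_dotProduct_last]
      simp only [tangentVec_castSucc, tangentVec_last, ringPole_last, ringPole_castSucc, thetaVec,
        phiVec, add_dotProduct, smul_dotProduct, Matrix.vec3_dotProduct', smul_eq_mul]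
      field_simp
      linear_combination (p * Real.cos (ringAngle n s)
        + q * Real.sin (ringAngle n s) - a s) * h7
    rw [Finset.mul_sum, Finset.sum_congr rfl fun s _ => e s]
    simp only [← Finset.mul_sum, Finset.sum_sub_distrib, Finset.sum_add_distrib,
      sum_cos_ringAngle hn, sum_sin_ringAngle hn]
    ring
  have hω : Real.sin θ ^ 2 * angularVelocity n θ κ
      = (n - 1) * Real.cos θ + κ * (1 + Real.cos θ) := by
    rw [angularVelocity]
    field_simp
  have hxi : ∑ i, ringPoleVorticity n κ i *
      (tangentVec n θ a b p q i ⬝ᵥ ![0, 0, angularVelocity n θ κ])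
      = -(Real.sin θ * angularVelocity n θ κ) * ∑ s, a s := by
    simp only [Fin.sum_univ_castSucc, ringPoleVorticity_castSucc, ringPoleVorticity_last,
      tangentVec_castSucc, tangentVec_last, thetaVec, phiVec, add_dotProduct, smul_dotProduct,
      Matrix.vec3_dotProduct', smul_eq_mul, Finset.mul_sum]
    simp only [mul_zero, add_zero, zero_add, zero_mul]
    exact Finset.sum_congr rfl fun s _ => by ring
  have hring := sin_mul_sum_pairGradient_ring h0 h1 a b p q
  rw [hxi]
  apply mul_left_cancel₀ hs
  linear_combination hring + κ * hpole + (∑ s, a s) * hω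

/-- Needed because `IsElliptic` quantifies existentially over `ξ`. Two angular velocities give the
same derivative of `⟨Φ, ξ⟩`, and tangent vectors detect every component of `ξ`. -/
theorem eq_angularVelocity_of_isRelativeEquilibrium {n : ℕ} (hn : 3 ≤ n) {θ κ : ℝ} (hκ : κ ≠ 0)
    (h0 : 0 < θ) (h1 : θ < Real.pi) {ξ : Fin 3 → ℝ}
    (hξ : IsRelativeEquilibrium (ringPoleVorticity n κ) (ringPole n θ) ξ) :
    ξ = ![0, 0, angularVelocity n θ κ] := by
  have hx := ringPole_mem_phaseSpace n h0 h1
  have hs : Real.sin θ ≠ 0 := (Real.sin_pos_of_pos_of_lt_pi h0 h1).ne'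
  have hη := isRelativeEquilibrium_ringPole hn κ h0 h1
  have h : ∀ a b p q, ∑ i, ringPoleVorticity n κ i * (tangentVec n θ a b p q i ⬝ᵥ ξ)
      = ∑ i, ringPoleVorticity n κ i *
        (tangentVec n θ a b p q i ⬝ᵥ ![0, 0, angularVelocity n θ κ]) := fun a b p q => by
    have hv := isTangent_tangentVec n θ a b p q
    have e1 := hξ.2 _ hv
    have e2 := hη.2 _ hv
    rw [dAugHamiltonian_eq _ _ hx hv] at e1 e2
    linarith
  simp only [Fin.sum_univ_castSucc, ringPoleVorticity_castSucc, ringPoleVorticity_last,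
    tangentVec_castSucc, tangentVec_last, thetaVec, phiVec, Matrix.vec3_dotProduct,
    Matrix.cons_val] at h
  -- Displacements of the pole detect the horizontal components, since `κ ≠ 0`; a uniform change of
  -- co-latitude detects the vertical one.
  have hp := h 0 0 1 0
  have hq := h 0 0 0 1
  have hr := h 1 0 0 0
  simp [hκ] at hp hq
  simp [hp, hq, show n ≠ 0 by omega, hs] at hr
  ext m
  fin_cases m <;> simp [hp, hq, hr]

/-- The frame is oriented and orthonormal, so `a s` and `b s` are conjugate coordinates. -/
theorem symplecticForm_tangentVec {n : ℕ} {θ : ℝ} (κ : ℝ) (a b a' b' : Fin n → ℝ)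
    (p q p' q' : ℝ) :
    symplecticForm (ringPoleVorticity n κ) (ringPole n θ) (tangentVec n θ a b p q)
      (tangentVec n θ a' b' p' q') = ∑ s, a s * b' s - ∑ s, b s * a' s + κ * (p * q' - q * p') := by
  simp only [symplecticForm, Fin.sum_univ_castSucc, ringPoleVorticity_castSucc,
    ringPoleVorticity_last, tangentVec_castSucc, tangentVec_last, ringPole_castSucc, ringPole_last,
    thetaVec, phiVec, cross_apply, Matrix.vec3_dotProduct, Pi.add_apply, Pi.smul_apply,
    smul_eq_mul, Matrix.cons_val, ← Finset.sum_sub_distrib]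
  congr 1
  · refine Finset.sum_congr rfl fun s _ => ?_
    have h1 := Real.sin_sq_add_cos_sq θ
    have h2 := Real.sin_sq_add_cos_sq (ringAngle n s)
    linear_combination (a s * b' s - b s * a' s) *
      (h1 + (Real.sin θ ^ 2 + Real.cos θ ^ 2) * h2)
  · ring


/-! ### The complexified slice -/

/-- Complex coordinates on the ring. -/
abbrev RingVec (n : ℕ) : Type := (Fin n → ℂ) × (Fin n → ℂ)

/-- The complexified slice in ring coordinates. -/
def ringSlice (n : ℕ) : Submodule ℂ (RingVec n) where
  carrier := {U | ∑ s, U.1 s = 0 ∧ ∑ s, U.2 s = 0}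
  zero_mem' := by simp
  add_mem' := by
    rintro U V ⟨h1, h2⟩ ⟨h3, h4⟩
    simp [Finset.sum_add_distrib, h1, h2, h3, h4]
  smul_mem' := by
    rintro c U ⟨h1, h2⟩
    simp [← Finset.mul_sum, h1, h2]

/-- The horizontal momentum of the ring, in the complex coordinate `x + iεy`. -/
def ringMoment {n : ℕ} (θ : ℝ) (ε : ℤ) (U : RingVec n) : ℂ :=
  Real.cos θ * fourierCoeff U.1 ε + ε * Complex.I * fourierCoeff U.2 ε

/-- The coefficient of `|a|²` in the Hessian. -/
def ringCoeff (n : ℕ) (θ κ : ℝ) : ℝ :=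
  (n - 1) * (1 + Real.cos θ ^ 2) + κ * (1 + Real.cos θ) ^ 2

/-- The quantity `n sin² θ / 2 + (n - 1) cos θ`. -/
def momentCoeff (n : ℕ) (θ : ℝ) : ℝ := n * Real.sin θ ^ 2 / 2 + (n - 1) * Real.cos θ

/-- The Hessian on the slice times `sin² θ`, complexified and in ring coordinates. -/
def ringHessian {n : ℕ} (θ κ : ℝ) (U V : RingVec n) : ℂ :=
  ringCoeff n θ κ * ∑ s, U.1 s * V.1 s - dirichletForm U.1 V.1 + dirichletForm U.2 V.2 +
    (1 + Real.cos θ) ^ 2 / 2 *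
      (fourierCoeff U.1 1 * ringMoment θ (-1) V + fourierCoeff U.1 (-1) * ringMoment θ 1 V +
        ringMoment θ 1 U * fourierCoeff V.1 (-1) + ringMoment θ (-1) U * fourierCoeff V.1 1) +
    (momentCoeff n θ / κ - (1 + Real.cos θ)) / 2 *
      (ringMoment θ 1 U * ringMoment θ (-1) V + ringMoment θ (-1) U * ringMoment θ 1 V)

/-- The symplectic form on the slice, complexified and in ring coordinates. -/
def ringSymplectic {n : ℕ} (θ κ : ℝ) (U V : RingVec n) : ℂ :=
  ∑ s, U.1 s * V.2 s - ∑ s, U.2 s * V.1 s +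
    Complex.I / (2 * κ) *
      (ringMoment θ 1 U * ringMoment θ (-1) V - ringMoment θ (-1) U * ringMoment θ 1 V)

theorem dirichletForm_add_left {n : ℕ} (f g h : Fin n → ℂ) :
    dirichletForm (f + g) h = dirichletForm f h + dirichletForm g h := by
  simp only [dirichletForm, ← mul_add, ← Finset.sum_add_distrib, Pi.add_apply]
  congr 1
  exact Finset.sum_congr rfl fun s _ => Finset.sum_congr rfl fun t _ => by ring

theorem dirichletForm_smul_left {n : ℕ} (c : ℂ) (f h : Fin n → ℂ) :
    dirichletForm (c • f) h = c * dirichletForm f h := by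
  simp only [dirichletForm, mul_left_comm c, Finset.mul_sum (Finset.univ) _ c, Pi.smul_apply,
    smul_eq_mul]
  congr 1
  exact Finset.sum_congr rfl fun s _ => Finset.sum_congr rfl fun t _ => by ring

theorem ringMoment_add {n : ℕ} (θ : ℝ) (ε : ℤ) (U V : RingVec n) :
    ringMoment θ ε (U + V) = ringMoment θ ε U + ringMoment θ ε V := by
  simp only [ringMoment, Prod.fst_add, Prod.snd_add, fourierCoeff_add]
  ring

theorem ringMoment_smul {n : ℕ} (θ : ℝ) (ε : ℤ) (c : ℂ) (U : RingVec n) :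
    ringMoment θ ε (c • U) = c * ringMoment θ ε U := by
  simp only [ringMoment, Prod.smul_fst, Prod.smul_snd, fourierCoeff_smul]
  ring

theorem ringHessian_comm {n : ℕ} (θ κ : ℝ) (U V : RingVec n) :
    ringHessian θ κ U V = ringHessian θ κ V U := by
  simp only [ringHessian, dirichletForm_comm U.1, dirichletForm_comm U.2, mul_comm (U.1 _)]
  ring

theorem ringSymplectic_swap {n : ℕ} (θ κ : ℝ) (U V : RingVec n) :
    ringSymplectic θ κ U V = -ringSymplectic θ κ V U := by
  simp only [ringSymplectic, mul_comm (U.1 _), mul_comm (U.2 _)]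
  ring

theorem ringHessian_add_left {n : ℕ} (θ κ : ℝ) (U V W : RingVec n) :
    ringHessian θ κ (U + V) W = ringHessian θ κ U W + ringHessian θ κ V W := by
  simp only [ringHessian, ringMoment_add, Prod.fst_add, Prod.snd_add, fourierCoeff_add,
    dirichletForm_add_left, Pi.add_apply, add_mul, Finset.sum_add_distrib]
  ring

theorem ringHessian_smul_left {n : ℕ} (θ κ : ℝ) (c : ℂ) (U W : RingVec n) :
    ringHessian θ κ (c • U) W = c * ringHessian θ κ U W := by
  simp only [ringHessian, ringMoment_smul, Prod.smul_fst, Prod.smul_snd, fourierCoeff_smul,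
    dirichletForm_smul_left, Pi.smul_apply, smul_eq_mul, mul_assoc, ← Finset.mul_sum]
  ring

theorem ringSymplectic_add_left {n : ℕ} (θ κ : ℝ) (U V W : RingVec n) :
    ringSymplectic θ κ (U + V) W = ringSymplectic θ κ U W + ringSymplectic θ κ V W := by
  simp only [ringSymplectic, ringMoment_add, Prod.fst_add, Prod.snd_add,
    Pi.add_apply, add_mul, Finset.sum_add_distrib]
  ring

theorem ringSymplectic_smul_left {n : ℕ} (θ κ : ℝ) (c : ℂ) (U W : RingVec n) :
    ringSymplectic θ κ (c • U) W = c * ringSymplectic θ κ U W := by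
  simp only [ringSymplectic, ringMoment_smul, Prod.smul_fst, Prod.smul_snd,
    Pi.smul_apply, smul_eq_mul, mul_assoc, ← Finset.mul_sum]
  ring

/-! ### Action of the forms on Fourier modes -/

/-- The coefficient of `|α|²` in the restriction of the Hessian to the first Fourier mode. -/
def modeOneP (n : ℕ) (θ κ : ℝ) : ℝ :=
  2 * (n - 1) * Real.cos θ ^ 2 + κ * (1 + Real.cos θ) ^ 2

/-- The coefficient of twice the product of `α` and `γ` on the first Fourier mode. -/
def modeOneQ (n : ℕ) (θ : ℝ) : ℝ := n * (1 + Real.cos θ) ^ 2 / 2 - (n - 1) * Real.cos θ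

/-- The coefficient of `|γ|²` on the first Fourier mode. -/
def modeOneT (n : ℕ) (θ κ : ℝ) : ℝ :=
  n - 1 + n / 2 * (momentCoeff n θ / κ - (1 + Real.cos θ))

/-- The vector of frequency `ε = ±1` with `a`-coefficient `α` and horizontal momentum `γ`. -/
def modeOneVec (n : ℕ) (θ : ℝ) (ε : ℤ) (α γ : ℂ) : RingVec n :=
  (α • mode n ε, (ε * Complex.I * (γ - Real.cos θ * α)) • mode n ε)

theorem sum_mode_mul {n : ℕ} (l : ℤ) (f : Fin n → ℂ) : ∑ s, mode n l s * f s = fourierCoeff f l :=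
  Finset.sum_congr rfl fun _ _ => mul_comm _ _

theorem fourierCoeff_mode_eq_zero {n : ℕ} (hn : n ≠ 0) {l m : ℤ} (h : ¬ (n : ℤ) ∣ l + m) :
    fourierCoeff (mode n l) m = 0 := by rw [fourierCoeff_mode hn, if_neg h]

theorem not_dvd_of_pos_of_lt {n : ℕ} {m : ℤ} (h0 : 0 < m) (h1 : m < n) : ¬ (n : ℤ) ∣ m :=
  fun h => absurd (Int.le_of_dvd h0 h) (by omega)

theorem fourierCoeff_mode_self {n : ℕ} (hn : 3 ≤ n) {ε : ℤ} (hε : ε = 1 ∨ ε = -1) :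
    fourierCoeff (mode n ε) ε = 0 := by
  refine fourierCoeff_mode_eq_zero (by omega) ?_
  rcases hε with rfl | rfl
  · exact not_dvd_of_pos_of_lt (by omega) (by omega)
  · intro h
    exact not_dvd_of_pos_of_lt (n := n) (m := 2) (by omega) (by omega) (by simpa using h.neg_right)

theorem fourierCoeff_mode_neg {n : ℕ} (hn : n ≠ 0) (l : ℤ) :
    fourierCoeff (mode n l) (-l) = n := by
  rw [fourierCoeff_mode hn, if_pos (by simp)]

theorem dirichletForm_mode_of_eq_one_or {n : ℕ} (hn : 3 ≤ n) {ε : ℤ} (hε : ε = 1 ∨ ε = -1)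
    (g : Fin n → ℂ) : dirichletForm (mode n ε) g = ((n : ℂ) - 1) * fourierCoeff g ε := by
  rcases hε with rfl | rfl
  · simpa using dirichletForm_mode 1 (by omega) g
  · exact dirichletForm_mode_neg_one (by omega) g

theorem int_mul_I_sq {ε : ℤ} (hε : ε = 1 ∨ ε = -1) :
    ((ε : ℂ) * Complex.I) ^ 2 = -1 := by
  rcases hε with rfl | rfl <;> simp

/-- At frequency `±1` the coefficient of `b` can be traded for the horizontal momentum, because `(ε
i)² = -1`. -/
theorem fourierCoeff_snd_eq {n : ℕ} (θ : ℝ) {ε : ℤ} (hε : ε = 1 ∨ ε = -1) (V : RingVec n) :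
    fourierCoeff V.2 ε
      = -(ε * Complex.I) * (ringMoment θ ε V - Real.cos θ * fourierCoeff V.1 ε) := by
  rw [ringMoment]
  linear_combination fourierCoeff V.2 ε * int_mul_I_sq hε

theorem ringMoment_modeOneVec {n : ℕ} (hn : 3 ≤ n) (θ : ℝ) {ε : ℤ} (hε : ε = 1 ∨ ε = -1)
    (α γ : ℂ) : ringMoment θ ε (modeOneVec n θ ε α γ) = 0 ∧
      ringMoment θ (-ε) (modeOneVec n θ ε α γ) = n * γ ∧
      fourierCoeff (modeOneVec n θ ε α γ).1 ε = 0 ∧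
      fourierCoeff (modeOneVec n θ ε α γ).1 (-ε) = n * α := by
  have h1 := fourierCoeff_mode_self hn hε
  have h2 := fourierCoeff_mode_neg (n := n) (by omega) ε
  simp only [ringMoment, modeOneVec, fourierCoeff_smul, h1, h2]
  refine ⟨by ring, ?_, by ring, by ring⟩
  rw [Int.cast_neg]
  linear_combination -(n * (γ - Real.cos θ * α)) * int_mul_I_sq hε

/-- Using the momentum as second coordinate makes the displacement of the pole proportional to it,
and the block becomes the real symmetric matrix with entries `P, Q, Q, T`. -/
theorem ringHessian_modeOneVec {n : ℕ} (hn : 3 ≤ n) (θ κ : ℝ) {ε : ℤ} (hε : ε = 1 ∨ ε = -1)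
    (α γ : ℂ) (V : RingVec n) :
    ringHessian θ κ (modeOneVec n θ ε α γ) V
      = α * (modeOneP n θ κ * fourierCoeff V.1 ε + modeOneQ n θ * ringMoment θ ε V) +
        γ * (modeOneQ n θ * fourierCoeff V.1 ε + modeOneT n θ κ * ringMoment θ ε V) := by
  obtain ⟨h1, h2, h3, h4⟩ := ringMoment_modeOneVec hn θ hε α γ
  have h5 : ∑ s, (modeOneVec n θ ε α γ).1 s * V.1 s = α * fourierCoeff V.1 ε := by
    simp only [modeOneVec, Pi.smul_apply, smul_eq_mul, mul_assoc, ← Finset.mul_sum, sum_mode_mul]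
  have h6 : dirichletForm (modeOneVec n θ ε α γ).1 V.1
      = α * (((n : ℂ) - 1) * fourierCoeff V.1 ε) := by
    rw [modeOneVec, dirichletForm_smul_left, dirichletForm_mode_of_eq_one_or hn hε]
  have h7 : dirichletForm (modeOneVec n θ ε α γ).2 V.2
      = (n - 1) * ((γ - Real.cos θ * α) *
        (ringMoment θ ε V - Real.cos θ * fourierCoeff V.1 ε)) := by
    rw [modeOneVec, dirichletForm_smul_left, dirichletForm_mode_of_eq_one_or hn hε,
      fourierCoeff_snd_eq θ hε]
    linear_combination (-(n - 1) * ((γ - Real.cos θ * α) *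
        (ringMoment θ ε V - Real.cos θ * fourierCoeff V.1 ε))) * int_mul_I_sq hε
  rw [ringHessian, h5, h6, h7]
  rcases hε with rfl | rfl
  · rw [h1, h2, h3, h4]
    simp only [modeOneP, modeOneQ, modeOneT, ringCoeff]
    push_cast
    ring
  · rw [neg_neg] at h2 h4
    rw [h1, h2, h3, h4]
    simp only [modeOneP, modeOneQ, modeOneT, ringCoeff]
    push_cast
    ring

/-- The block is `-ε i` times a real symmetric matrix, so that `σ = -ε i η` turns the eigenvalue
problem into a real symmetric pencil. -/
theorem ringSymplectic_modeOneVec {n : ℕ} (hn : 3 ≤ n) (θ κ : ℝ) {ε : ℤ} (hε : ε = 1 ∨ ε = -1)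
    (α γ : ℂ) (V : RingVec n) :
    ringSymplectic θ κ (modeOneVec n θ ε α γ) V
      = -(ε * Complex.I) *
        (α * (-2 * Real.cos θ * fourierCoeff V.1 ε + ringMoment θ ε V) +
        γ * (fourierCoeff V.1 ε + n / (2 * κ) * ringMoment θ ε V)) := by
  obtain ⟨h1, h2, h3, h4⟩ := ringMoment_modeOneVec hn θ hε α γ
  have h5 : ∑ s, (modeOneVec n θ ε α γ).1 s * V.2 s = α * fourierCoeff V.2 ε := by
    simp only [modeOneVec, Pi.smul_apply, smul_eq_mul, mul_assoc, ← Finset.mul_sum, sum_mode_mul]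
  have h6 : ∑ s, (modeOneVec n θ ε α γ).2 s * V.1 s
      = ε * Complex.I * (γ - Real.cos θ * α) * fourierCoeff V.1 ε := by
    simp only [modeOneVec, Pi.smul_apply, smul_eq_mul, mul_assoc, ← Finset.mul_sum, sum_mode_mul]
  rw [ringSymplectic, h5, h6, fourierCoeff_snd_eq θ hε]
  rcases hε with rfl | rfl
  · rw [h1, h2]
    push_cast
    ring
  · rw [neg_neg] at h2
    rw [h1, h2]
    push_cast
    ring

/-- Frequencies away from `0, ±1` carry no horizontal momentum. They leave the pole fixed and
decouple from it. -/
theorem ringMoment_mode {n l : ℕ} (hl : 2 ≤ l) (hl' : l + 2 ≤ n) (θ : ℝ) (α β : ℂ) :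
    fourierCoeff (α • mode n l) 1 = 0 ∧ fourierCoeff (α • mode n l) (-1) = 0 ∧
      ringMoment θ 1 (α • mode n l, β • mode n l) = 0 ∧
      ringMoment θ (-1) (α • mode n l, β • mode n l) = 0 := by
  have h1 : fourierCoeff (mode n l) 1 = 0 :=
    fourierCoeff_mode_eq_zero (by omega) (not_dvd_of_pos_of_lt (by omega) (by omega))
  have h2 : fourierCoeff (mode n l) (-1) = 0 :=
    fourierCoeff_mode_eq_zero (by omega) (not_dvd_of_pos_of_lt (by omega) (by omega))
  simp [ringMoment, fourierCoeff_smul, h1, h2]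

theorem ringHessian_mode {n l : ℕ} (hl : 2 ≤ l) (hl' : l + 2 ≤ n) (θ κ : ℝ) (α β : ℂ)
    (V : RingVec n) :
    ringHessian θ κ (α • mode n l, β • mode n l) V
      = α * ((ringCoeff n θ κ - l * (n - l)) * fourierCoeff V.1 l) +
        β * (l * (n - l) * fourierCoeff V.2 l) := by
  obtain ⟨h1, h2, h3, h4⟩ := ringMoment_mode hl hl' θ α β
  rw [ringHessian, h3, h4]
  simp only [h1, h2, dirichletForm_smul_left, dirichletForm_mode l (show l < n by omega),
    Pi.smul_apply, smul_eq_mul, mul_assoc, ← Finset.mul_sum, sum_mode_mul]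
  ring

theorem ringSymplectic_mode {n l : ℕ} (hl : 2 ≤ l) (hl' : l + 2 ≤ n) (θ κ : ℝ) (α β : ℂ)
    (V : RingVec n) :
    ringSymplectic θ κ (α • mode n l, β • mode n l) V
      = α * fourierCoeff V.2 l - β * fourierCoeff V.1 l := by
  obtain ⟨h1, h2, h3, h4⟩ := ringMoment_mode hl hl' θ α β
  rw [ringSymplectic, h3, h4]
  simp only [Pi.smul_apply, smul_eq_mul, mul_assoc, ← Finset.mul_sum, sum_mode_mul]
  ring

theorem modeOneVec_mem {n : ℕ} (hn : 3 ≤ n) (θ : ℝ) {ε : ℤ} (hε : ε = 1 ∨ ε = -1) (α γ : ℂ) :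
    modeOneVec n θ ε α γ ∈ ringSlice n := by
  have h : ∑ s, mode n ε s = 0 := by
    rw [sum_mode (by omega), if_neg]
    rcases hε with rfl | rfl
    · exact not_dvd_of_pos_of_lt (by omega) (by omega)
    · intro h
      exact not_dvd_of_pos_of_lt (n := n) (m := 1) (by omega) (by omega)
        (by simpa using h.neg_right)
  refine ⟨?_, ?_⟩ <;>
  simp only [modeOneVec, Pi.smul_apply, smul_eq_mul, ← Finset.mul_sum, h, mul_zero]

theorem mode_mem {n l : ℕ} (hl : 2 ≤ l) (hl' : l + 2 ≤ n) (α β : ℂ) :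
    ((α • mode n l, β • mode n l) : RingVec n) ∈ ringSlice n := by
  have h : ∑ s, mode n l s = 0 := by
    rw [sum_mode (by omega), if_neg]
    exact not_dvd_of_pos_of_lt (by omega) (by omega)
  refine ⟨?_, ?_⟩ <;>
  simp only [Pi.smul_apply, smul_eq_mul, ← Finset.mul_sum, h, mul_zero]

/-- The frequencies `0` (killed by the zero means), `±1` and `2, …, n - 2` exhaust the residues
modulo `n`, with `n - 1` standing for `-1`. -/
theorem eq_zero_of_coeffs_eq_zero {n : ℕ} (θ : ℝ) {U : RingVec n}
    (hU : U ∈ ringSlice n)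
    (h1 : ∀ l : ℕ, 2 ≤ l → l + 2 ≤ n → fourierCoeff U.1 l = 0 ∧ fourierCoeff U.2 l = 0)
    (h2 : ∀ ε : ℤ, ε = 1 ∨ ε = -1 → fourierCoeff U.1 ε = 0 ∧ ringMoment θ ε U = 0) : U = 0 := by
  have h3 : ∀ ε : ℤ, ε = 1 ∨ ε = -1 → fourierCoeff U.2 ε = 0 := fun ε hε => by
    rw [fourierCoeff_snd_eq θ hε, (h2 ε hε).1, (h2 ε hε).2]
    ring
  have hcases : ∀ l : ℕ, l < n → fourierCoeff U.1 l = 0 ∧ fourierCoeff U.2 l = 0 := fun l hl => by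
    rcases Nat.eq_zero_or_pos l with rfl | hl0
    · rw [Nat.cast_zero, fourierCoeff_zero, fourierCoeff_zero]
      exact hU
    rcases eq_or_ne l 1 with rfl | hl1
    · exact ⟨(h2 1 (Or.inl rfl)).1, h3 1 (Or.inl rfl)⟩
    rcases eq_or_ne (l + 1) n with hl2 | hl2
    · have e : (l : ℤ) = n - 1 := by omega
      rw [e, fourierCoeff_sub_period, fourierCoeff_sub_period]
      exact ⟨(h2 (-1) (Or.inr rfl)).1, h3 (-1) (Or.inr rfl)⟩
    · exact h1 l (by omega) (by omega)
  exact Prod.ext (eq_zero_of_fourierCoeff_eq_zero _ fun l hl => (hcases l hl).1)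
    (eq_zero_of_fourierCoeff_eq_zero _ fun l hl => (hcases l hl).2)

/-! ### The determinants of the first mode -/

/-- The first symplectic block is nondegenerate exactly because `μ ≠ 0`. -/
theorem modeOneVec_symplectic_det {n : ℕ} {θ κ : ℝ} (hκ : κ ≠ 0) :
    -2 * Real.cos θ * (n / (2 * κ)) - 1 = -(κ + n * Real.cos θ) / κ := by
  field_simp
  ring

theorem modeOne_hessian_det {n : ℕ} {θ κ : ℝ} (hκ : κ ≠ 0) :
    modeOneP n θ κ * modeOneT n θ κ - modeOneQ n θ ^ 2 = -modeOne n θ κ / (2 * κ ^ 2) := by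
  have h := Real.sin_sq_add_cos_sq θ
  have h' : Real.sin θ ^ 2 = 1 - Real.cos θ ^ 2 := by linarith
  rw [modeOneP, modeOneT, modeOneQ, modeOne, aConst, bConst, momentCoeff, h']
  field_simp
  ring

theorem modeOne_trace {n : ℕ} {θ κ : ℝ} (hκ : κ ≠ 0) :
    modeOneP n θ κ * (n / (2 * κ)) + modeOneT n θ κ * (-2 * Real.cos θ) - 2 * modeOneQ n θ
      = -(n * Real.sin θ ^ 2 / 2) * (κ + n * Real.cos θ) / κ := by
  have h := Real.sin_sq_add_cos_sq θ
  have h' : Real.sin θ ^ 2 = 1 - Real.cos θ ^ 2 := by linarith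
  rw [modeOneP, modeOneT, modeOneQ, momentCoeff, h']
  field_simp
  ring

/-- The square appears because `(n sin² θ)² + 8b` is the square of `n sin² θ + 4 (n - 1) cos θ`, and
both the trace and the product of determinants carry powers of `κ + n cos θ`. -/
theorem modeOne_discriminant {n : ℕ} {θ κ : ℝ} (hκ : κ ≠ 0) :
    (modeOneP n θ κ * (n / (2 * κ)) + modeOneT n θ κ * (-2 * Real.cos θ) - 2 * modeOneQ n θ) ^ 2
      - 4 * (-2 * Real.cos θ * (n / (2 * κ)) - 1) *
        (modeOneP n θ κ * modeOneT n θ κ - modeOneQ n θ ^ 2)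
      = ((κ + n * Real.cos θ) / (2 * κ)) ^ 2 *
        ((n * Real.sin θ ^ 2 + 4 * ((n : ℝ) - 1) * Real.cos θ) ^ 2 - 8 * aConst n θ * κ) := by
  rw [modeOne_trace hκ, modeOneVec_symplectic_det hκ, modeOne_hessian_det hκ, modeOne, bConst]
  field_simp
  ring


/-! ### Spectrum of the linearization in ring coordinates -/

/-- `U` solves the generalized eigenvalue problem `τ d²H U = η ω U` on the slice. -/
def IsPencilSolution {n : ℕ} (θ κ : ℝ) (τ η : ℂ) (U : RingVec n) : Prop :=
  ∀ W ∈ ringSlice n, τ * ringHessian θ κ W U = η * ringSymplectic θ κ W U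

theorem IsPencilSolution.mode {n l : ℕ} {θ κ : ℝ} {τ η : ℂ} {U : RingVec n}
    (h : IsPencilSolution θ κ τ η U) (hl : 2 ≤ l) (hl' : l + 2 ≤ n) :
    τ * ((ringCoeff n θ κ - l * (n - l)) * fourierCoeff U.1 l) = η * fourierCoeff U.2 l ∧
      τ * (l * (n - l) * fourierCoeff U.2 l) = -η * fourierCoeff U.1 l := by
  have h1 := h _ (mode_mem hl hl' 1 0)
  have h2 := h _ (mode_mem hl hl' 0 1)
  rw [ringHessian_mode hl hl', ringSymplectic_mode hl hl'] at h1 h2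
  constructor
  · linear_combination h1
  · linear_combination h2

theorem IsPencilSolution.modeOne {n : ℕ} (hn : 3 ≤ n) {θ κ : ℝ} {τ η : ℂ} {U : RingVec n}
    (h : IsPencilSolution θ κ τ η U) {ε : ℤ} (hε : ε = 1 ∨ ε = -1) :
    τ * (modeOneP n θ κ * fourierCoeff U.1 ε + modeOneQ n θ * ringMoment θ ε U) =
        (η * -(ε * Complex.I)) * (-2 * Real.cos θ * fourierCoeff U.1 ε + ringMoment θ ε U) ∧
      τ * (modeOneQ n θ * fourierCoeff U.1 ε + modeOneT n θ κ * ringMoment θ ε U) =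
        (η * -(ε * Complex.I)) * (fourierCoeff U.1 ε + n / (2 * κ) * ringMoment θ ε U) := by
  have h1 := h _ (modeOneVec_mem hn θ hε 1 0)
  have h2 := h _ (modeOneVec_mem hn θ hε 0 1)
  rw [ringHessian_modeOneVec hn θ κ hε, ringSymplectic_modeOneVec hn θ κ hε] at h1 h2
  constructor
  · linear_combination h1
  · linear_combination h2

theorem eq_zero_of_ringSymplectic_eq_zero {n : ℕ} (hn : 3 ≤ n) {θ κ : ℝ} (hκ : κ ≠ 0)
    (hμ : κ + n * Real.cos θ ≠ 0) {U : RingVec n} (hU : U ∈ ringSlice n)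
    (h : ∀ W ∈ ringSlice n, ringSymplectic θ κ W U = 0) : U = 0 := by
  -- With `τ = 0` and `η = 1` the pencil equation says that `U` lies in the radical of the form, so
  -- the block equations apply.
  have h' : IsPencilSolution θ κ 0 1 U := fun W hW => by rw [h W hW]; ring
  refine eq_zero_of_coeffs_eq_zero θ hU (fun l hl hl' => ?_) fun ε hε => ?_
  · obtain ⟨h1, h2⟩ := h'.mode hl hl'
    exact ⟨by linear_combination h2, by linear_combination -h1⟩
  · obtain ⟨h1, h2⟩ := h'.modeOne hn hε
    have hε' : (1 : ℂ) * -(ε * Complex.I) ≠ 0 := by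
      rcases hε with rfl | rfl <;> simp
    rw [zero_mul, eq_comm, mul_eq_zero] at h1 h2
    have h3 := h1.resolve_left hε'
    have h4 := h2.resolve_left hε'
    have hdet : (-2 * Real.cos θ * (n / (2 * κ)) - 1 : ℂ) ≠ 0 := by
      have e : -2 * Real.cos θ * (n / (2 * κ)) - 1 ≠ 0 := by
        rw [modeOneVec_symplectic_det hκ]
        exact div_ne_zero (neg_ne_zero.2 hμ) hκ
      exact_mod_cast e
    have hE : fourierCoeff U.1 ε = 0 := by
      apply (mul_eq_zero.1 (_ : (-2 * Real.cos θ * (n / (2 * κ)) - 1 : ℂ) * _ = 0)).resolve_left hdet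
      linear_combination (n / (2 * κ) : ℂ) * h3 - h4
    refine ⟨hE, ?_⟩
    rw [hE] at h3
    linear_combination h3

theorem re_eq_zero_of_sq_eq_neg {η : ℂ} {r : ℝ} (hr : 0 ≤ r) (h : η ^ 2 = -r) : η.re = 0 := by
  have h1 := congrArg Complex.re h
  have h2 := congrArg Complex.im h
  simp [pow_two] at h1 h2
  by_contra h0
  have h3 : η.im = 0 := by
    have : η.re * η.im = 0 := by linarith
    exact (mul_eq_zero.1 this).resolve_left h0
  rw [h3] at h1
  have := mul_self_pos.2 h0
  linarith

theorem im_eq_zero_of_quadratic {σ : ℂ} {a b c : ℝ} (ha : a ≠ 0) (hd : 0 ≤ b ^ 2 - 4 * a * c)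
    (h : a * σ ^ 2 - b * σ + c = 0) : σ.im = 0 := by
  have h1 := congrArg Complex.re h
  have h2 := congrArg Complex.im h
  simp [pow_two] at h1 h2
  by_contra h0
  have h3 : 2 * a * σ.re = b := by
    apply mul_right_cancel₀ h0
    linarith
  have h4 : 0 < (2 * a * σ.im) ^ 2 := by positivity
  have h5 : b ^ 2 - 4 * a * c = -(2 * a * σ.im) ^ 2 := by
    rw [← h3]
    linear_combination (-4 * a) * h1 + 4 * a * σ.re * h3
  linarith

/-- If `re η ≠ 0`, every Fourier block of `U` vanishes. For `2 ≤ l ≤ n - 2` a nonzero block gives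
`η² = -(A - l (n - l)) l (n - l) ≤ 0`; for `l = ±1` it makes `σ = -ε i η` a root of a real quadratic
with nonnegative discriminant. -/
theorem re_eq_zero_of_isPencilSolution {n : ℕ} (hn : 3 ≤ n) {θ κ : ℝ} (hκ : κ ≠ 0)
    (hμ : κ + n * Real.cos θ ≠ 0)
    (hA : ∀ l : ℕ, 2 ≤ l → l + 2 ≤ n → (l : ℝ) * (n - l) ≤ ringCoeff n θ κ)
    (hd : 8 * aConst n θ * κ ≤
      (n * Real.sin θ ^ 2 + 4 * ((n : ℝ) - 1) * Real.cos θ) ^ 2)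
    {η : ℂ} {U : RingVec n} (hU : U ∈ ringSlice n) (hU0 : U ≠ 0)
    (h : IsPencilSolution θ κ 1 η U) : η.re = 0 := by
  by_contra hη
  have hη0 : η ≠ 0 := fun h0 => hη (by rw [h0]; rfl)
  refine hU0 (eq_zero_of_coeffs_eq_zero θ hU (fun l hl hl' => ?_) fun ε hε => ?_)
  · obtain ⟨h1, h2⟩ := h.mode hl hl'
    rw [one_mul] at h1 h2
    have hl2 : (0 : ℝ) ≤ (l : ℝ) * (n - l) := by
      have : (l : ℝ) ≤ n := by exact_mod_cast (by omega : l ≤ n)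
      exact mul_nonneg (Nat.cast_nonneg _) (by linarith)
    have h3 : fourierCoeff U.1 l = 0 := by
      by_contra ha
      refine hη (re_eq_zero_of_sq_eq_neg
        (mul_nonneg (sub_nonneg.2 (hA l hl hl')) hl2) ?_)
      apply mul_right_cancel₀ ha
      push_cast
      linear_combination η * h2 + ((l : ℂ) * (n - l)) * h1
    rw [h3, mul_zero, eq_comm, mul_eq_zero] at h1
    exact ⟨h3, h1.resolve_left hη0⟩
  · obtain ⟨h1, h2⟩ := h.modeOne hn hε
    set σ : ℂ := η * -(ε * Complex.I) with hσ
    set k : ℝ := n / (2 * κ) with hk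
    have hk' : (n / (2 * κ) : ℂ) = (k : ℂ) := by rw [hk]; push_cast; rfl
    rw [hk'] at h2
    set P := modeOneP n θ κ
    set Q := modeOneQ n θ
    set T := modeOneT n θ κ
    set c := Real.cos θ with hc
    have hdet : -2 * c * k - 1 ≠ 0 := by
      rw [hk, hc, modeOneVec_symplectic_det hκ]
      exact div_ne_zero (neg_ne_zero.2 hμ) hκ
    have hdisc : 0 ≤ (P * k + T * (-2 * c) - 2 * Q) ^ 2
        - 4 * (-2 * c * k - 1) * (P * T - Q ^ 2) := by
      rw [modeOne_discriminant hκ]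
      exact mul_nonneg (sq_nonneg _) (by linarith)
    -- This is `det (M - σ S)`. Its roots are real, and a real `σ` means an imaginary `η`.
    have hχ : (((-2 * c * k - 1 : ℝ) : ℂ) * σ ^ 2 - ((P * k + T * (-2 * c) - 2 * Q : ℝ) : ℂ) * σ +
        ((P * T - Q ^ 2 : ℝ) : ℂ)) ≠ 0 := fun h0 => by
      have h3 := im_eq_zero_of_quadratic hdet hdisc h0
      apply hη
      rcases hε with rfl | rfl <;> simpa [hσ] using h3
    push_cast at hχ
    -- Cramer's rule: the combinations are the rows of the adjugate of `M - σ S`.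
    constructor
    · apply (mul_eq_zero.1 (_ : _ * _ = (0 : ℂ))).resolve_left hχ
      linear_combination (T - σ * k) * h1 - (Q - σ) * h2
    · apply (mul_eq_zero.1 (_ : _ * _ = (0 : ℂ))).resolve_left hχ
      linear_combination (P + 2 * c * σ) * h2 - (Q - σ) * h1

/-- If `A < λ = l (n - l)`, then `r = √((λ - A) λ)` is a real nonzero eigenvalue, with eigenvector
`(λ, -r)` in the block of frequency `l`. -/
theorem exists_isPencilSolution_of_lt {n l : ℕ} (hl : 2 ≤ l) (hl' : l + 2 ≤ n) {θ κ : ℝ}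
    (h : ringCoeff n θ κ < l * (n - l)) :
    ∃ η : ℂ, ∃ U : RingVec n, U ∈ ringSlice n ∧ U ≠ 0 ∧ IsPencilSolution θ κ 1 η U ∧
      η.re ≠ 0 := by
  have hlpos : (0 : ℝ) < l * (n - l) := by
    have h1 : (l : ℝ) + 2 ≤ n := by exact_mod_cast hl'
    have h2 : (2 : ℝ) ≤ l := by exact_mod_cast hl
    exact mul_pos (by linarith) (by linarith)
  set lam : ℝ := l * (n - l) with hlam
  have hpos : 0 < (lam - ringCoeff n θ κ) * lam := mul_pos (by linarith) hlpos
  set r := Real.sqrt ((lam - ringCoeff n θ κ) * lam)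
  have hr : r ^ 2 = (lam - ringCoeff n θ κ) * lam := Real.sq_sqrt hpos.le
  have hr0 : 0 < r := Real.sqrt_pos.2 hpos
  have hr' : (r : ℂ) ^ 2 = (lam - ringCoeff n θ κ) * lam := by exact_mod_cast hr
  have hlam' : (l * (n - l) : ℂ) = lam := by rw [hlam]; push_cast; rfl
  refine ⟨r, (((lam : ℂ) • mode n l, (-r : ℂ) • mode n l) : RingVec n), mode_mem hl hl' _ _, ?_, ?_,
    by simpa using hr0.ne'⟩
  · intro h0
    have h1 := congrFun (congrArg Prod.fst h0) (⟨0, by omega⟩ : Fin n)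
    simp [mode_ne_zero, hlpos.ne'] at h1
  · intro W hW
    rw [ringHessian_comm, ringSymplectic_swap, ringHessian_mode hl hl', ringSymplectic_mode hl hl',
      hlam']
    linear_combination fourierCoeff W.1 l * hr'

theorem exists_quadratic_root_of_discrim_neg {a b c : ℝ} (hd : b ^ 2 - 4 * a * c < 0) :
    ∃ σ : ℂ, a * σ ^ 2 - b * σ + c = 0 ∧ σ.im ≠ 0 := by
  have ha : a ≠ 0 := by
    rintro rfl
    have := sq_nonneg b
    linarith
  set r := Real.sqrt (4 * a * c - b ^ 2)
  have hr : (r : ℂ) ^ 2 = 4 * a * c - b ^ 2 := by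
    exact_mod_cast Real.sq_sqrt (by linarith : 0 ≤ 4 * a * c - b ^ 2)
  have hr0 : r ≠ 0 := (Real.sqrt_pos.2 (by linarith)).ne'
  have ha' : (a : ℂ) ≠ 0 := Complex.ofReal_ne_zero.2 ha
  refine ⟨((b / (2 * a) : ℝ) : ℂ) + ((r / (2 * a) : ℝ) : ℂ) * Complex.I, ?_, ?_⟩
  · push_cast
    field_simp
    linear_combination r ^ 2 * Complex.I_sq - hr
  · rw [Complex.add_im, Complex.ofReal_im, Complex.mul_I_im, Complex.ofReal_re, zero_add]
    exact div_ne_zero hr0 (mul_ne_zero two_ne_zero ha)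

theorem exists_ker_of_det_eq_zero {A B D : ℂ} (h : A * D - B ^ 2 = 0) :
    ∃ α γ : ℂ, (α ≠ 0 ∨ γ ≠ 0) ∧ A * α + B * γ = 0 ∧ B * α + D * γ = 0 := by
  by_cases h0 : A = 0 ∧ B = 0
  · exact ⟨1, 0, Or.inl one_ne_zero, by simp [h0.1], by simp [h0.2]⟩
  · refine ⟨B, -A, ?_, by ring, by linear_combination -h⟩
    rw [neg_ne_zero]
    tauto

theorem modeOneVec_ne_zero {n : ℕ} (hn : 3 ≤ n) (θ : ℝ) {α γ : ℂ} (h : α ≠ 0 ∨ γ ≠ 0) :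
    modeOneVec n θ 1 α γ ≠ 0 := by
  intro h0
  obtain ⟨-, h2, -, h4⟩ := ringMoment_modeOneVec hn θ (Or.inl rfl) α γ
  have hn' : (n : ℂ) ≠ 0 := Nat.cast_ne_zero.2 (by omega)
  rw [h0] at h2 h4
  simp [ringMoment] at h2 h4
  have h2' := h2.resolve_left (by omega)
  have h4' := h4.resolve_left (by omega)
  tauto

/-- A negative discriminant gives a nonreal root `σ` of `det (M - σ S)`, and a kernel vector of `M -
σ S` is an eigenvector. -/
theorem exists_isPencilSolution_of_discrim {n : ℕ} (hn : 3 ≤ n) {θ κ : ℝ} (hκ : κ ≠ 0)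
    (hμ : κ + n * Real.cos θ ≠ 0)
    (hd : (n * Real.sin θ ^ 2 + 4 * ((n : ℝ) - 1) * Real.cos θ) ^ 2 < 8 * aConst n θ * κ) :
    ∃ η : ℂ, ∃ U : RingVec n, U ∈ ringSlice n ∧ U ≠ 0 ∧ IsPencilSolution θ κ 1 η U ∧
      η.re ≠ 0 := by
  have hdisc := modeOne_discriminant (n := n) (θ := θ) hκ
  have hneg : ((κ + n * Real.cos θ) / (2 * κ)) ^ 2 *
        ((n * Real.sin θ ^ 2 + 4 * ((n : ℝ) - 1) * Real.cos θ) ^ 2 - 8 * aConst n θ * κ) < 0 :=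
    mul_neg_of_pos_of_neg (by positivity) (by linarith)
  rw [← hdisc] at hneg
  obtain ⟨σ, hσ, hσ'⟩ := exists_quadratic_root_of_discrim_neg hneg
  push_cast at hσ
  obtain ⟨α, γ, h0, h1, h2⟩ := exists_ker_of_det_eq_zero
    (A := modeOneP n θ κ + 2 * Real.cos θ * σ) (B := modeOneQ n θ - σ)
    (D := modeOneT n θ κ - n / (2 * κ) * σ) (by push_cast; linear_combination hσ)
  -- The factor `-i` undoes the `i` in the symplectic block, so `re η = im σ`.
  refine ⟨-Complex.I * σ, modeOneVec n θ 1 α γ, modeOneVec_mem hn θ (Or.inl rfl) α γ,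
    modeOneVec_ne_zero hn θ h0, fun W hW => ?_, by simpa using hσ'⟩
  rw [ringHessian_comm, ringSymplectic_swap, ringHessian_modeOneVec hn θ κ (Or.inl rfl),
    ringSymplectic_modeOneVec hn θ κ (Or.inl rfl)]
  push_cast at h1 h2 ⊢
  linear_combination fourierCoeff W.1 1 * h1 + ringMoment θ 1 W * h2 +
    σ * (α * (-2 * Complex.cos θ * fourierCoeff W.1 1 + ringMoment θ 1 W) +
        γ * (fourierCoeff W.1 1 + n / (2 * κ) * ringMoment θ 1 W)) * Complex.I_sq

/-! ### The largest eigenvalue of the ring -/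

theorem half_mul_sub_eq_cConst (n : ℕ) : ((n / 2 : ℕ) : ℝ) * (n - (n / 2 : ℕ)) = cConst n := by
  rw [cConst]
  split_ifs with h
  · obtain ⟨m, rfl⟩ := h
    rw [show (m + m) / 2 = m by omega]
    push_cast
    ring
  · obtain ⟨m, rfl⟩ := Nat.not_even_iff_odd.1 h
    rw [show (2 * m + 1) / 2 = m by omega]
    push_cast
    ring

/-- With `m = ⌊n/2⌋`, the difference `m (n - m) - l (n - l)` factors as `(m - l) (n - m - l)`, whose
factors never have opposite signs for integers `l`. -/
theorem mul_sub_le_cConst {n : ℕ} (l : ℕ) : (l : ℝ) * (n - l) ≤ cConst n := by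
  rw [← half_mul_sub_eq_cConst]
  obtain ⟨m, hm⟩ : ∃ m, m = n / 2 := ⟨_, rfl⟩
  rw [← hm]
  have h1 : (0 : ℤ) ≤ ((m : ℤ) - l) * (n - m - l) := by
    rcases le_or_gt l m with h | h
    · exact mul_nonneg (by omega) (by omega)
    · exact mul_nonneg_of_nonpos_of_nonpos (by omega) (by omega)
  have h2 : (0 : ℝ) ≤ ((m : ℝ) - l) * (n - m - l) := by exact_mod_cast h1
  linarith

theorem ringCoeff_sub_cConst {n : ℕ} {θ κ : ℝ} (hc : 1 + Real.cos θ ≠ 0) :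
    ringCoeff n θ κ - cConst n = (1 + Real.cos θ) ^ 2 * (κ - kappaZero n θ) := by
  rw [ringCoeff, kappaZero]
  field_simp
  ring


/-! ### Definiteness of the Hessian in ring coordinates -/

/-- The vector with real coordinates `a`, `b`. -/
def ofRealVec {n : ℕ} (a b : Fin n → ℝ) : RingVec n := (fun s => (a s : ℂ), fun s => (b s : ℂ))

theorem fourierCoeff_ofReal_neg {n : ℕ} (a : Fin n → ℝ) (l : ℤ) :
    fourierCoeff (fun s => (a s : ℂ)) (-l)
      = (starRingEnd ℂ) (fourierCoeff (fun s => (a s : ℂ)) l) := by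
  simp [conj_fourierCoeff]

theorem ringMoment_ofRealVec_neg_one {n : ℕ} (θ : ℝ) (a b : Fin n → ℝ) :
    ringMoment θ (-1) (ofRealVec a b) = (starRingEnd ℂ) (ringMoment θ 1 (ofRealVec a b)) := by
  simp only [ringMoment, ofRealVec, fourierCoeff_ofReal_neg]
  simp [← Complex.cos_conj]

/-- Both Parseval identities applied to the diagonal terms; only the terms of the pole stay outside
the sum over frequencies. -/
theorem natCast_mul_ringHessian_self {n : ℕ} (θ κ : ℝ) (V : RingVec n) :
    n * ringHessian θ κ V V = ∑ l ∈ Finset.range n,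
      ((ringCoeff n θ κ - l * (n - l)) * (fourierCoeff V.1 (-l) * fourierCoeff V.1 l) +
        l * (n - l) * (fourierCoeff V.2 (-l) * fourierCoeff V.2 l)) +
      n * ((1 + Real.cos θ) ^ 2 *
        (fourierCoeff V.1 1 * ringMoment θ (-1) V + fourierCoeff V.1 (-1) * ringMoment θ 1 V) +
      (momentCoeff n θ / κ - (1 + Real.cos θ)) * (ringMoment θ 1 V * ringMoment θ (-1) V)) := by
  simp only [sub_mul, Finset.sum_add_distrib, Finset.sum_sub_distrib, ← Finset.mul_sum]
  rw [parseval]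
  have h1 := parseval_dirichletForm V.1 V.1
  have h2 := parseval_dirichletForm V.2 V.2
  rw [h1, h2, ringHessian]
  ring

theorem quadratic_pos {p q t x y : ℝ} (hp : 0 < p) (hdet : 0 < p * t - q ^ 2)
    (h : x ≠ 0 ∨ y ≠ 0) : 0 < p * x ^ 2 + 2 * q * x * y + t * y ^ 2 := by
  have e : p * (p * x ^ 2 + 2 * q * x * y + t * y ^ 2)
      = (p * x + q * y) ^ 2 + (p * t - q ^ 2) * y ^ 2 := by ring
  refine pos_of_mul_pos_right (a := p) ?_ hp.le
  rw [e]
  by_cases hy : y = 0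
  · have hx : x ≠ 0 := h.resolve_right (not_not.2 hy)
    rw [hy, mul_zero, add_zero, zero_pow two_ne_zero, mul_zero, add_zero]
    positivity
  · exact add_pos_of_nonneg_of_pos (sq_nonneg _) (mul_pos hdet (by positivity))

theorem quadratic_nonneg {p q t x y : ℝ} (hp : 0 < p) (hdet : 0 < p * t - q ^ 2) :
    0 ≤ p * x ^ 2 + 2 * q * x * y + t * y ^ 2 := by
  by_cases h : x ≠ 0 ∨ y ≠ 0
  · exact (quadratic_pos hp hdet h).le
  · push Not at h
    simp [h.1, h.2]

/-- For a real vector each middle frequency contributes a nonnegative combination of squared moduli.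
The frequencies `1` and `n - 1` join the terms of the pole into two copies of the form `(P, Q, T)`,
one in the real and one in the imaginary parts. If the total is not positive, all blocks vanish, and
so does the vector. -/
theorem ringHessian_ofRealVec_pos {n : ℕ} (hn : 3 ≤ n) {θ κ : ℝ}
    (hA : ∀ l : ℕ, 2 ≤ l → l + 2 ≤ n → (l : ℝ) * (n - l) < ringCoeff n θ κ)
    (hp : 0 < modeOneP n θ κ)
    (hdet : 0 < modeOneP n θ κ * modeOneT n θ κ - modeOneQ n θ ^ 2)
    {a b : Fin n → ℝ} (hV : ofRealVec a b ∈ ringSlice n) (hV0 : ofRealVec a b ≠ 0) :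
    0 < (ringHessian θ κ (ofRealVec a b) (ofRealVec a b)).re := by
  -- With `n = m + 3`, the frequencies `0`, `1` and `m + 2 = n - 1` can be split off, which leaves
  -- `i + 2` for `i < m`.
  obtain ⟨m, rfl⟩ : ∃ m, n = m + 3 := ⟨n - 3, by omega⟩
  set V := ofRealVec a b with hVdef
  have hpar := natCast_mul_ringHessian_self θ κ V
  set f : ℕ → ℝ := fun l =>
    (ringCoeff (m + 3) θ κ - l * ((m + 3 : ℕ) - l)) * Complex.normSq (fourierCoeff V.1 l) +
      l * ((m + 3 : ℕ) - l) * Complex.normSq (fourierCoeff V.2 l) with hf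
  have hfc : ∀ l : ℕ, ((ringCoeff (m + 3) θ κ - l * ((m + 3 : ℕ) - l)) *
      (fourierCoeff V.1 (-l) * fourierCoeff V.1 l) +
        l * ((m + 3 : ℕ) - l) * (fourierCoeff V.2 (-l) * fourierCoeff V.2 l) : ℂ) = (f l : ℂ) := by
    intro l
    have h1 : fourierCoeff V.1 (-l) * fourierCoeff V.1 l
        = (Complex.normSq (fourierCoeff V.1 l) : ℂ) := by
      rw [← Complex.mul_conj, mul_comm]
      congr 1
      exact fourierCoeff_ofReal_neg a l
    have h2 : fourierCoeff V.2 (-l) * fourierCoeff V.2 l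
        = (Complex.normSq (fourierCoeff V.2 l) : ℂ) := by
      rw [← Complex.mul_conj, mul_comm]
      congr 1
      exact fourierCoeff_ofReal_neg b l
    rw [h1, h2, hf]
    push_cast
    ring
  rw [Finset.sum_congr rfl fun l _ => hfc l] at hpar
  have hEm : fourierCoeff V.1 (-1) = (starRingEnd ℂ) (fourierCoeff V.1 1) :=
    fourierCoeff_ofReal_neg a 1
  have hFm : fourierCoeff V.2 (-1) = (starRingEnd ℂ) (fourierCoeff V.2 1) :=
    fourierCoeff_ofReal_neg b 1
  have hGm : ringMoment θ (-1) V = (starRingEnd ℂ) (ringMoment θ 1 V) :=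
    ringMoment_ofRealVec_neg_one θ a b
  have hF := fourierCoeff_snd_eq θ (Or.inl rfl) V
  have hf0 : f 0 = 0 := by
    have h1 : fourierCoeff V.1 0 = 0 := by rw [fourierCoeff_zero]; exact hV.1
    simp [hf, h1]
  -- Frequency `n - 1` is `-1`; for a real vector its coefficients are conjugate to those of
  -- frequency `1`, and the weight `l (n - l)` is symmetric.
  have hlast : f (m + 2) = f 1 := by
    have e : ∀ g : Fin (m + 3) → ℂ, fourierCoeff g ((m + 2 : ℕ) : ℤ) = fourierCoeff g (-1) :=
      fun g => by
        rw [← fourierCoeff_sub_period]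
        congr 1
        push_cast
        ring
    simp only [hf, e, hEm, hFm, Complex.normSq_conj, Nat.cast_one]
    push_cast
    ring
  rw [← Complex.ofReal_sum, Finset.sum_range_succ, Finset.sum_range_succ',
    Finset.sum_range_succ', zero_add, hlast, hf0, hEm, hGm] at hpar
  have hinner : ∀ i ∈ Finset.range m, 0 ≤ f (i + 1 + 1) := fun i hi => by
    have hi' := Finset.mem_range.1 hi
    have h1 := hA (i + 1 + 1) (by omega) (by omega)
    have h2 : (0 : ℝ) ≤ ((i + 1 + 1 : ℕ) : ℝ) * ((m + 3 : ℕ) - (i + 1 + 1 : ℕ)) := by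
      have : ((i + 1 + 1 : ℕ) : ℝ) ≤ (m + 3 : ℕ) := by exact_mod_cast (by omega)
      exact mul_nonneg (Nat.cast_nonneg _) (by linarith)
    exact add_nonneg (mul_nonneg (by linarith) (Complex.normSq_nonneg _))
      (mul_nonneg h2 (Complex.normSq_nonneg _))
  set E := fourierCoeff V.1 1 with hE
  set G := ringMoment θ 1 V with hG
  have hre := congrArg Complex.re hpar
  have hF1 : f 1 = (ringCoeff (m + 3) θ κ - (m + 2)) * Complex.normSq E +
      (m + 2) * ((G.re - Real.cos θ * E.re) ^ 2 + (G.im - Real.cos θ * E.im) ^ 2) := by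
    simp only [hf, Nat.cast_one]
    rw [← hE, hF]
    simp only [Complex.normSq_apply]
    simp [-Complex.ofReal_cos]
    ring
  have hsum : ((m + 3 : ℕ) : ℝ) * (ringHessian θ κ V V).re = ∑ i ∈ Finset.range m, f (i + 1 + 1) +
      2 * (modeOneP (m + 3) θ κ * E.re ^ 2 + 2 * modeOneQ (m + 3) θ * E.re * G.re +
        modeOneT (m + 3) θ κ * G.re ^ 2) +
      2 * (modeOneP (m + 3) θ κ * E.im ^ 2 + 2 * modeOneQ (m + 3) θ * E.im * G.im +
        modeOneT (m + 3) θ κ * G.im ^ 2) := by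
    have e1 : (((m + 3 : ℕ) : ℂ) * ringHessian θ κ V V).re
        = ((m + 3 : ℕ) : ℝ) * (ringHessian θ κ V V).re := by
      rw [← Complex.ofReal_natCast, Complex.re_ofReal_mul]
    have e2 : (((m + 3 : ℕ) : ℂ) * ((1 + Real.cos θ) ^ 2 *
        (E * (starRingEnd ℂ) G + (starRingEnd ℂ) E * G) +
        (momentCoeff (m + 3) θ / κ - (1 + Real.cos θ)) * (G * (starRingEnd ℂ) G))) =
        ((((m + 3 : ℕ) : ℝ) * ((1 + Real.cos θ) ^ 2 * (2 * (E.re * G.re + E.im * G.im)) +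
        (momentCoeff (m + 3) θ / κ - (1 + Real.cos θ)) * (G.re ^ 2 + G.im ^ 2)) : ℝ) : ℂ) := by
      have h1 : E * (starRingEnd ℂ) G + (starRingEnd ℂ) E * G
          = ((2 * (E.re * G.re + E.im * G.im) : ℝ) : ℂ) := by
        apply Complex.ext <;> simp <;> ring
      have h2 : G * (starRingEnd ℂ) G = ((G.re ^ 2 + G.im ^ 2 : ℝ) : ℂ) := by
        rw [Complex.mul_conj, Complex.normSq_apply]
        push_cast
        ring
      rw [h1, h2]
      push_cast
      ring
    rw [e1, e2, Complex.add_re, Complex.ofReal_re, Complex.ofReal_re, hF1, Complex.normSq_apply]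
      at hre
    rw [hre]
    simp only [modeOneP, modeOneQ, modeOneT, ringCoeff]
    push_cast
    ring
  have hm : (0 : ℝ) < ((m + 3 : ℕ) : ℝ) := by positivity
  refine pos_of_mul_pos_right (a := ((m + 3 : ℕ) : ℝ)) ?_ hm.le
  rw [hsum]
  have q1 := quadratic_nonneg (x := E.re) (y := G.re) hp hdet
  have q2 := quadratic_nonneg (x := E.im) (y := G.im) hp hdet
  have q0 := Finset.sum_nonneg hinner
  by_contra hle
  have hS : ∑ i ∈ Finset.range m, f (i + 1 + 1) = 0 := by linarith
  have hEG : E = 0 ∧ G = 0 := by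
    have h1 : ¬ (E.re ≠ 0 ∨ G.re ≠ 0) := fun h => by
      have := quadratic_pos hp hdet h
      linarith
    have h2 : ¬ (E.im ≠ 0 ∨ G.im ≠ 0) := fun h => by
      have := quadratic_pos hp hdet h
      linarith
    push Not at h1 h2
    exact ⟨Complex.ext h1.1 h2.1, Complex.ext h1.2 h2.2⟩
  refine hV0 (eq_zero_of_coeffs_eq_zero θ hV (fun l hl hl' => ?_) fun ε hε => ?_)
  · obtain ⟨i, rfl⟩ : ∃ i, l = i + 1 + 1 := ⟨l - 2, by omega⟩
    have h0 := (Finset.sum_eq_zero_iff_of_nonneg hinner).1 hS i (Finset.mem_range.2 (by omega))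
    have h1 := hA (i + 1 + 1) hl hl'
    have h2 : (0 : ℝ) < ((i + 1 + 1 : ℕ) : ℝ) * ((m + 3 : ℕ) - (i + 1 + 1 : ℕ)) := by
      have : ((i + 1 + 1 : ℕ) : ℝ) + 2 ≤ (m + 3 : ℕ) := by exact_mod_cast hl'
      exact mul_pos (by positivity) (by linarith)
    have h3 := mul_nonneg (sub_nonneg.2 h1.le) (Complex.normSq_nonneg (fourierCoeff V.1 (i + 1 + 1 : ℕ)))
    have h4 := mul_nonneg h2.le (Complex.normSq_nonneg (fourierCoeff V.2 (i + 1 + 1 : ℕ)))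
    simp only [hf] at h0
    have h5 := (add_eq_zero_iff_of_nonneg h3 h4).1 h0
    exact ⟨Complex.normSq_eq_zero.1 ((mul_eq_zero.1 h5.1).resolve_left (by linarith)),
      Complex.normSq_eq_zero.1 ((mul_eq_zero.1 h5.2).resolve_left h2.ne')⟩
  · rcases hε with rfl | rfl
    · exact hEG
    · rw [hEm, hGm, hEG.1, hEG.2]
      simp

/-- The coordinatewise complex conjugate. -/
def conjVec {n : ℕ} (U : RingVec n) : RingVec n :=
  (fun s => (starRingEnd ℂ) (U.1 s), fun s => (starRingEnd ℂ) (U.2 s))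

theorem conjVec_mode (n : ℕ) (l : ℤ) (α β : ℂ) : conjVec (α • mode n l, β • mode n l)
    = ((starRingEnd ℂ) α • mode n (-l), (starRingEnd ℂ) β • mode n (-l)) := by
  refine Prod.ext (funext fun s => ?_) (funext fun s => ?_) <;> simp [conjVec, conj_mode]

/-- Evaluates the Hermitian form of a mode. This lets complex modes test the definiteness of the
real Hessian through `ringHessian_conjVec_re`. -/
theorem ringHessian_mode_conjVec {n l : ℕ} (hl : 2 ≤ l) (hl' : l + 2 ≤ n) (θ κ α β : ℝ) :
    ringHessian θ κ ((α : ℂ) • mode n l, (β : ℂ) • mode n l)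
        (conjVec ((α : ℂ) • mode n l, (β : ℂ) • mode n l))
      = ((n * ((ringCoeff n θ κ - l * (n - l)) * α ^ 2 + l * (n - l) * β ^ 2) : ℝ) : ℂ) := by
  have h : fourierCoeff (mode n (-l)) l = n := by
    simpa using fourierCoeff_mode_neg (n := n) (by omega) (-l)
  rw [ringHessian_mode hl hl', conjVec_mode]
  simp only [fourierCoeff_smul, h, Complex.conj_ofReal]
  push_cast
  ring

theorem ringHessian_modeOneVec_conjVec {n : ℕ} (hn : 3 ≤ n) (θ κ α γ : ℝ) :
    ringHessian θ κ (modeOneVec n θ 1 α γ) (conjVec (modeOneVec n θ 1 α γ))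
      = ((n * (modeOneP n θ κ * α ^ 2 + 2 * modeOneQ n θ * α * γ + modeOneT n θ κ * γ ^ 2) : ℝ) :
        ℂ) := by
  have hc : conjVec (modeOneVec n θ 1 α γ) = modeOneVec n θ (-1) α γ := by
    rw [modeOneVec, conjVec_mode, modeOneVec]
    simp [-Complex.ofReal_cos]
  obtain ⟨-, h2, -, h4⟩ := ringMoment_modeOneVec hn θ (Or.inr rfl) (α : ℂ) (γ : ℂ)
  rw [neg_neg] at h2 h4
  rw [ringHessian_modeOneVec hn θ κ (Or.inl rfl), hc, h2, h4]
  push_cast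
  ring


/-! ### Complex eigenvalues of a real endomorphism -/

/-- A complex eigenvector is written `u + iv` with real `u`, `v`, so that the slice itself need not
be complexified. -/
theorem aeval_charpoly_eq_zero_iff {V : Type*} [AddCommGroup V] [Module ℝ V]
    [FiniteDimensional ℝ V] (f : V →ₗ[ℝ] V) (z : ℂ) :
    Polynomial.aeval z f.charpoly = 0 ↔ ∃ u v : V, (u ≠ 0 ∨ v ≠ 0) ∧
      f u = z.re • u - z.im • v ∧ f v = z.im • u + z.re • v := by
  classical
  let b := Module.finBasis ℝ V
  set M := LinearMap.toMatrix b b f with hM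
  have h1 : Polynomial.aeval z f.charpoly
      = (Matrix.scalar _ z - M.map (algebraMap ℝ ℂ)).det := by
    rw [← LinearMap.charpoly_toMatrix f b, Polynomial.aeval_def, Polynomial.eval₂_eq_eval_map,
      ← Matrix.charpoly_map, Matrix.eval_charpoly]
  have hrepr : ∀ (w : V) (i), b.repr (f w) i = ∑ j, M i j * b.repr w j := fun w i => by
    rw [← LinearMap.toMatrix_mulVec_repr b b f w]
    rfl
  have hmul : ∀ (c : Fin (Module.finrank ℝ V) → ℂ),
      (Matrix.scalar _ z - M.map (algebraMap ℝ ℂ)) *ᵥ c = 0 ↔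
        ∀ i, ∑ j, (M i j : ℂ) * c j = z * c i := fun c => by
    rw [Matrix.sub_mulVec, sub_eq_zero, eq_comm, funext_iff]
    refine forall_congr' fun i => ?_
    simp [Matrix.mulVec, dotProduct, Matrix.diagonal_apply]
  rw [h1, ← Matrix.exists_mulVec_eq_zero_iff]
  constructor
  · rintro ⟨c, hc0, hc⟩
    rw [hmul] at hc
    have hu : ∀ i, b.repr (b.equivFun.symm fun i => (c i).re) i = (c i).re := fun i => by
      rw [← Module.Basis.equivFun_apply, LinearEquiv.apply_symm_apply]
    have hv : ∀ i, b.repr (b.equivFun.symm fun i => (c i).im) i = (c i).im := fun i => by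
      rw [← Module.Basis.equivFun_apply, LinearEquiv.apply_symm_apply]
    refine ⟨b.equivFun.symm fun i => (c i).re, b.equivFun.symm fun i => (c i).im, ?_, ?_, ?_⟩
    · by_contra h
      push Not at h
      apply hc0
      ext i
      apply Complex.ext
      · rw [← hu, h.1]; simp
      · rw [← hv, h.2]; simp
    · apply b.repr.injective
      ext i
      rw [hrepr, map_sub, map_smul, map_smul]
      simp only [Finsupp.sub_apply, Finsupp.smul_apply, hu, hv, smul_eq_mul]
      simpa using congrArg Complex.re (hc i)
    · apply b.repr.injective
      ext i
      rw [hrepr, map_add, map_smul, map_smul]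
      simp only [Finsupp.add_apply, Finsupp.smul_apply, hu, hv, smul_eq_mul]
      have := congrArg Complex.im (hc i)
      simp at this
      linarith
  · rintro ⟨u, v, h0, hu, hv⟩
    refine ⟨fun i => (b.repr u i : ℂ) + (b.repr v i : ℂ) * Complex.I, ?_, ?_⟩
    · intro hc
      have hr : ∀ i, b.repr u i = 0 ∧ b.repr v i = 0 := fun i => by
        have := congrFun hc i
        constructor
        · simpa using congrArg Complex.re this
        · simpa using congrArg Complex.im this
      have hu0 : u = 0 := b.repr.injective (by ext i; simpa using (hr i).1)
      have hv0 : v = 0 := b.repr.injective (by ext i; simpa using (hr i).2)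
      tauto
    · rw [hmul]
      intro i
      have e1 := hrepr u i
      have e2 := hrepr v i
      rw [hu, map_sub, map_smul, map_smul] at e1
      rw [hv, map_add, map_smul, map_smul] at e2
      simp only [Finsupp.sub_apply, Finsupp.add_apply, Finsupp.smul_apply, smul_eq_mul] at e1 e2
      apply Complex.ext
      · simp
        linarith
      · simp
        linarith

/-! ### The slice in ring coordinates -/

/-- The vector of the symplectic slice with ring coordinates `a`, `b`. -/
def sliceVec (n : ℕ) (θ κ : ℝ) (a b : Fin n → ℝ) : Config (n + 1) :=
  tangentVec n θ a b
    (-(∑ s, (Real.cos θ * a s * Real.cos (ringAngle n s) - b s * Real.sin (ringAngle n s))) / κ)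
    (-(∑ s, (Real.cos θ * a s * Real.sin (ringAngle n s) + b s * Real.cos (ringAngle n s))) / κ)

theorem ofRealVec_mem_iff {n : ℕ} (a b : Fin n → ℝ) :
    ofRealVec a b ∈ ringSlice n ↔ ∑ s, a s = 0 ∧ ∑ s, b s = 0 := by
  change (∑ s, (a s : ℂ) = 0 ∧ ∑ s, (b s : ℂ) = 0) ↔ _
  norm_cast

theorem sliceVec_mem {n : ℕ} (hn : 3 ≤ n) {θ κ : ℝ} (hκ : κ ≠ 0)
    (hs : Real.sin θ ≠ 0) (hμ : κ + n * Real.cos θ ≠ 0) {a b : Fin n → ℝ}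
    (h : ofRealVec a b ∈ ringSlice n) :
    sliceVec n θ κ a b ∈ symplecticSlice (ringPoleVorticity n κ) (ringPole n θ) := by
  rw [ofRealVec_mem_iff] at h
  exact (tangentVec_mem_symplecticSlice_iff hn hs hμ a b _ _).2
    ⟨h.1, h.2, mul_div_cancel₀ _ hκ, mul_div_cancel₀ _ hκ⟩

theorem exists_eq_sliceVec {n : ℕ} (hn : 3 ≤ n) {θ κ : ℝ} (hκ : κ ≠ 0)
    (hs : Real.sin θ ≠ 0) (hμ : κ + n * Real.cos θ ≠ 0) {v : Config (n + 1)}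
    (hv : v ∈ symplecticSlice (ringPoleVorticity n κ) (ringPole n θ)) :
    ∃ a b, ofRealVec a b ∈ ringSlice n ∧ v = sliceVec n θ κ a b := by
  obtain ⟨a, b, p, q, rfl⟩ := exists_eq_tangentVec hv.1
  obtain ⟨h1, h2, h3, h4⟩ := (tangentVec_mem_symplecticSlice_iff hn hs hμ a b p q).1 hv
  refine ⟨a, b, (ofRealVec_mem_iff a b).2 ⟨h1, h2⟩, ?_⟩
  rw [sliceVec, ← h3, ← h4, mul_div_cancel_left₀ _ hκ, mul_div_cancel_left₀ _ hκ]

/-- Serves below at `c = 0`, where it gives `sliceVec n θ κ 0 0 = 0`. -/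
theorem sliceVec_smul (n : ℕ) (θ κ c : ℝ) (a b : Fin n → ℝ) :
    sliceVec n θ κ (c • a) (c • b) = c • sliceVec n θ κ a b := by
  funext i
  refine Fin.lastCases ?_ (fun s => ?_) i
  · have h : ∀ x y : ℝ, -(∑ s, (x * (c * a s) * Real.cos (ringAngle n s) -
        c * b s * Real.sin (ringAngle n s))) / y = c * (-(∑ s, (x * a s * Real.cos (ringAngle n s) -
        b s * Real.sin (ringAngle n s))) / y) := fun x y => by
      rw [← mul_div_assoc, mul_neg, Finset.mul_sum]
      congr 2
      exact Finset.sum_congr rfl fun s _ => by ring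
    have h' : ∀ x y : ℝ, -(∑ s, (x * (c * a s) * Real.sin (ringAngle n s) +
        c * b s * Real.cos (ringAngle n s))) / y = c * (-(∑ s, (x * a s * Real.sin (ringAngle n s) +
        b s * Real.cos (ringAngle n s))) / y) := fun x y => by
      rw [← mul_div_assoc, mul_neg, Finset.mul_sum]
      congr 2
      exact Finset.sum_congr rfl fun s _ => by ring
    simp only [sliceVec, tangentVec_last, Pi.smul_apply, smul_eq_mul, h, h']
    ext m
    fin_cases m <;> simp
  · simp only [sliceVec, tangentVec_castSucc, Pi.smul_apply]
    module

theorem sliceVec_ne_zero {n : ℕ} (θ κ : ℝ) {a b : Fin n → ℝ} (h : ofRealVec a b ≠ 0) :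
    sliceVec n θ κ a b ≠ 0 := by
  intro h0
  apply h
  have h1 : ∀ s : Fin n, a s • thetaVec n θ s + b s • phiVec n s = 0 := fun s => by
    rw [← tangentVec_castSucc n θ a b _ _ s]
    exact congrFun h0 s.castSucc
  have h2 : ∀ s, a s = 0 ∧ b s = 0 := fun s => by
    have e0 := congrFun (h1 s) 0
    have e1 := congrFun (h1 s) 1
    have e2 := congrFun (h1 s) 2
    simp [thetaVec, phiVec] at e0 e1 e2
    have t1 := Real.sin_sq_add_cos_sq (ringAngle n s)
    have t2 := Real.sin_sq_add_cos_sq θ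
    constructor
    · rcases e2 with e2 | e2
      · exact e2
      · have hc : Real.cos θ ≠ 0 := by
          intro h'
          rw [e2, h'] at t2
          norm_num at t2
        apply (mul_eq_zero.1 (_ : Real.cos θ * a s = 0)).resolve_left hc
        linear_combination Real.cos (ringAngle n s) * e0 + Real.sin (ringAngle n s) * e1
          - Real.cos θ * a s * t1
    · linear_combination -Real.sin (ringAngle n s) * e0 + Real.cos (ringAngle n s) * e1
          - b s * t1
  refine Prod.ext (funext fun s => ?_) (funext fun s => ?_)
  · simp [ofRealVec, (h2 s).1]
  · simp [ofRealVec, (h2 s).2]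

theorem fourierCoeff_ofReal_one {n : ℕ} (a : Fin n → ℝ) :
    fourierCoeff (fun s => (a s : ℂ)) 1 = ((∑ s, a s * Real.cos (ringAngle n s) : ℝ) : ℂ) +
      ((∑ s, a s * Real.sin (ringAngle n s) : ℝ) : ℂ) * Complex.I := by
  rw [Complex.ofReal_sum, Complex.ofReal_sum, Finset.sum_mul, ← Finset.sum_add_distrib]
  refine Finset.sum_congr rfl fun s _ => ?_
  rw [mode_eq_cos_add_sin, Int.cast_one, one_mul, Complex.ofReal_mul, Complex.ofReal_mul]
  ring

theorem ringMoment_ofRealVec_one {n : ℕ} (θ : ℝ) (a b : Fin n → ℝ) :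
    ringMoment θ 1 (ofRealVec a b) =
      ((∑ s, (Real.cos θ * a s * Real.cos (ringAngle n s)
        - b s * Real.sin (ringAngle n s)) : ℝ) : ℂ) +
      ((∑ s, (Real.cos θ * a s * Real.sin (ringAngle n s)
        + b s * Real.cos (ringAngle n s)) : ℝ) : ℂ) * Complex.I := by
  rw [ringMoment, ofRealVec, fourierCoeff_ofReal_one, fourierCoeff_ofReal_one,
    Finset.sum_sub_distrib, Finset.sum_add_distrib]
  simp only [mul_assoc (Real.cos θ), ← Finset.mul_sum]
  push_cast
  linear_combination (∑ s, (b s : ℂ) * Complex.sin (ringAngle n s)) * Complex.I_sq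

theorem dirichletForm_ofReal {n : ℕ} (a b : Fin n → ℝ) :
    dirichletForm (fun s => (a s : ℂ)) (fun s => (b s : ℂ)) = (realDirichletForm a b : ℂ) := by
  rw [dirichletForm, realDirichletForm]
  simp only [ringWeight]
  push_cast
  rfl

/-- Substitutes `p + iq = -G / κ` into the Hessian; products of real sums regroup into products of
coefficients at `1` and `-1`, which are conjugate for real vectors. -/
theorem ofReal_hessian_sliceVec {n : ℕ} (hn : 3 ≤ n) {θ κ : ℝ} (hκ : κ ≠ 0) (h0 : 0 < θ)
    (h1 : θ < Real.pi) (a b a' b' : Fin n → ℝ) :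
    ((Real.sin θ ^ 2 * hessian (ringPoleVorticity n κ) ![0, 0, angularVelocity n θ κ]
        (ringPole n θ) (sliceVec n θ κ a b) (sliceVec n θ κ a' b') : ℝ) : ℂ)
      = ringHessian θ κ (ofRealVec a b) (ofRealVec a' b') := by
  rw [sliceVec, sliceVec, sin_sq_mul_hessian_tangentVec hn h0 h1, ringHessian,
    ringMoment_ofRealVec_neg_one, ringMoment_ofRealVec_neg_one, ringMoment_ofRealVec_one,
    ringMoment_ofRealVec_one]
  have e : ∀ a b : Fin n → ℝ, fourierCoeff (ofRealVec a b).1 (-1)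
      = (starRingEnd ℂ) (fourierCoeff (ofRealVec a b).1 1) := fun a b => fourierCoeff_ofReal_neg a 1
  rw [e, e]
  simp only [ofRealVec, fourierCoeff_ofReal_one, dirichletForm_ofReal, map_add, map_mul,
    Complex.conj_ofReal, Complex.conj_I, ringCoeff, momentCoeff]
  have hS : ∑ s, (a s : ℂ) * (a' s : ℂ) = ((∑ s, a s * a' s : ℝ) : ℂ) := by push_cast; rfl
  rw [hS]
  generalize ∑ s, (Real.cos θ * a s * Real.cos (ringAngle n s)
        - b s * Real.sin (ringAngle n s)) = G1
  generalize ∑ s, (Real.cos θ * a s * Real.sin (ringAngle n s)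
        + b s * Real.cos (ringAngle n s)) = G2
  generalize ∑ s, (Real.cos θ * a' s * Real.cos (ringAngle n s)
        - b' s * Real.sin (ringAngle n s)) = G1'
  generalize ∑ s, (Real.cos θ * a' s * Real.sin (ringAngle n s)
        + b' s * Real.cos (ringAngle n s)) = G2'
  generalize ∑ s, a s * Real.cos (ringAngle n s) = E1
  generalize ∑ s, a s * Real.sin (ringAngle n s) = E2
  generalize ∑ s, a' s * Real.cos (ringAngle n s) = E1'
  generalize ∑ s, a' s * Real.sin (ringAngle n s) = E2'
  have hsin : Real.sin θ ^ 2 = 1 - Real.cos θ ^ 2 := by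
    linarith [Real.sin_sq_add_cos_sq θ]
  rw [hsin]
  generalize Real.cos θ = c
  have hκ' : (κ : ℂ) ≠ 0 := Complex.ofReal_ne_zero.2 hκ
  push_cast
  field_simp
  linear_combination (4 * κ * (1 + c) ^ 2 * (E2 * G2' + G2 * E2') + 2 * G2 * G2' *
    (n * (1 - c ^ 2) + (n - 1) * c * 2 - κ * (1 + c) * 2) : ℂ) * Complex.I_sq

theorem ofReal_symplecticForm_sliceVec {n : ℕ} {θ κ : ℝ} (hκ : κ ≠ 0) (a b a' b' : Fin n → ℝ) :
    ((symplecticForm (ringPoleVorticity n κ) (ringPole n θ) (sliceVec n θ κ a b)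
        (sliceVec n θ κ a' b') : ℝ) : ℂ)
      = ringSymplectic θ κ (ofRealVec a b) (ofRealVec a' b') := by
  rw [sliceVec, sliceVec, symplecticForm_tangentVec, ringSymplectic,
    ringMoment_ofRealVec_neg_one, ringMoment_ofRealVec_neg_one, ringMoment_ofRealVec_one,
    ringMoment_ofRealVec_one]
  simp only [ofRealVec, map_add, map_mul, Complex.conj_ofReal, Complex.conj_I]
  generalize ∑ s, (Real.cos θ * a s * Real.cos (ringAngle n s)
        - b s * Real.sin (ringAngle n s)) = G1
  generalize ∑ s, (Real.cos θ * a s * Real.sin (ringAngle n s)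
        + b s * Real.cos (ringAngle n s)) = G2
  generalize ∑ s, (Real.cos θ * a' s * Real.cos (ringAngle n s)
        - b' s * Real.sin (ringAngle n s)) = G1'
  generalize ∑ s, (Real.cos θ * a' s * Real.sin (ringAngle n s)
        + b' s * Real.cos (ringAngle n s)) = G2'
  have hκ' : (κ : ℂ) ≠ 0 := Complex.ofReal_ne_zero.2 hκ
  push_cast
  field_simp
  linear_combination (2 * (G1 * G2' - G2 * G1' : ℂ)) * Complex.I_sq


/-! ### Spectral stability in ring coordinates -/

theorem exists_eq_ofRealVec_add {n : ℕ} {W : RingVec n} (hW : W ∈ ringSlice n) :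
    ∃ a b a' b', ofRealVec a b ∈ ringSlice n ∧ ofRealVec a' b' ∈ ringSlice n ∧
      W = ofRealVec a b + Complex.I • ofRealVec a' b' := by
  refine ⟨fun s => (W.1 s).re, fun s => (W.2 s).re, fun s => (W.1 s).im, fun s => (W.2 s).im,
    ?_, ?_, ?_⟩
  · rw [ofRealVec_mem_iff, ← Complex.re_sum, ← Complex.re_sum, hW.1, hW.2]
    simp
  · rw [ofRealVec_mem_iff, ← Complex.im_sum, ← Complex.im_sum, hW.1, hW.2]
    simp
  · refine Prod.ext (funext fun s => ?_) (funext fun s => ?_) <;>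
    simp [ofRealVec, mul_comm Complex.I]

theorem ofRealVec_eq_zero_iff {n : ℕ} {a b : Fin n → ℝ} :
    ofRealVec a b = 0 ↔ a = 0 ∧ b = 0 := by
  simp [ofRealVec, Prod.ext_iff, funext_iff]

theorem ofRealVec_add_eq_zero {n : ℕ} {a b a' b' : Fin n → ℝ}
    (h : ofRealVec a b + Complex.I • ofRealVec a' b' = 0) :
    ofRealVec a b = 0 ∧ ofRealVec a' b' = 0 := by
  rw [ofRealVec_eq_zero_iff, ofRealVec_eq_zero_iff]
  have h1 : ∀ s, (a s : ℂ) + Complex.I * a' s = 0 := fun s => congrFun (congrArg Prod.fst h) s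
  have h2 : ∀ s, (b s : ℂ) + Complex.I * b' s = 0 := fun s => congrFun (congrArg Prod.snd h) s
  refine ⟨⟨funext fun s => ?_, funext fun s => ?_⟩, funext fun s => ?_, funext fun s => ?_⟩
  · simpa using congrArg Complex.re (h1 s)
  · simpa using congrArg Complex.re (h2 s)
  · simpa using congrArg Complex.im (h1 s)
  · simpa using congrArg Complex.im (h2 s)

/-- The complex slice is spanned by real vectors, so real test vectors suffice by bilinearity. -/
theorem isPencilSolution_of_real {n : ℕ} {θ κ : ℝ} {τ η : ℂ} {U : RingVec n}
    (h : ∀ a b, ofRealVec a b ∈ ringSlice n →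
      τ * ringHessian θ κ (ofRealVec a b) U = η * ringSymplectic θ κ (ofRealVec a b) U) :
    IsPencilSolution θ κ τ η U := by
  intro W hW
  obtain ⟨a, b, a', b', h1, h2, rfl⟩ := exists_eq_ofRealVec_add hW
  rw [ringHessian_add_left, ringHessian_smul_left, ringSymplectic_add_left,
    ringSymplectic_smul_left]
  linear_combination h a b h1 + Complex.I * h a' b' h2

theorem ringHessian_add_right {n : ℕ} (θ κ : ℝ) (U V W : RingVec n) :
    ringHessian θ κ U (V + W) = ringHessian θ κ U V + ringHessian θ κ U W := by
  rw [ringHessian_comm, ringHessian_add_left, ringHessian_comm θ κ V, ringHessian_comm θ κ W]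

theorem ringHessian_smul_right {n : ℕ} (θ κ : ℝ) (c : ℂ) (U W : RingVec n) :
    ringHessian θ κ U (c • W) = c * ringHessian θ κ U W := by
  rw [ringHessian_comm, ringHessian_smul_left, ringHessian_comm]

theorem ringSymplectic_add_right {n : ℕ} (θ κ : ℝ) (U V W : RingVec n) :
    ringSymplectic θ κ U (V + W) = ringSymplectic θ κ U V + ringSymplectic θ κ U W := by
  rw [ringSymplectic_swap, ringSymplectic_add_left, ringSymplectic_swap θ κ V,
    ringSymplectic_swap θ κ W]
  ring

theorem ringSymplectic_smul_right {n : ℕ} (θ κ : ℝ) (c : ℂ) (U W : RingVec n) :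
    ringSymplectic θ κ U (c • W) = c * ringSymplectic θ κ U W := by
  rw [ringSymplectic_swap, ringSymplectic_smul_left, ringSymplectic_swap θ κ W]
  ring

/-- The symplectic form on the slice as a bilinear form. -/
def sliceForm {N : ℕ} (k : Fin N → ℝ) (x : Config N) :
    symplecticSlice k x →ₗ[ℝ] symplecticSlice k x →ₗ[ℝ] ℝ :=
  LinearMap.mk₂ ℝ (fun u v => symplecticForm k x (u : Config N) (v : Config N))
    (fun u v w => by simp [symplecticForm, mul_add, Finset.sum_add_distrib])
    (fun c u v => by
      simp only [symplecticForm, Submodule.coe_smul, Pi.smul_apply, map_smul, LinearMap.smul_apply,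
        dotProduct_smul, smul_eq_mul, Finset.mul_sum]
      exact Finset.sum_congr rfl fun i _ => by ring)
    (fun u v w => by simp [symplecticForm, mul_add, Finset.sum_add_distrib])
    (fun c u v => by
      simp only [symplecticForm, Submodule.coe_smul, Pi.smul_apply, map_smul,
        dotProduct_smul, smul_eq_mul, Finset.mul_sum]
      exact Finset.sum_congr rfl fun i _ => by ring)

/-- The Hessian on the slice as a bilinear form. -/
def sliceHessian {N : ℕ} (k : Fin N → ℝ) (ξ : Fin 3 → ℝ) (x : Config N) :
    symplecticSlice k x →ₗ[ℝ] symplecticSlice k x →ₗ[ℝ] ℝ :=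
  LinearMap.mk₂ ℝ (fun u v => hessian k ξ x (u : Config N) (v : Config N))
    (fun u v w => by simp [hessian])
    (fun c u v => by simp [hessian])
    (fun u v w => by simp [hessian])
    (fun c u v => by simp [hessian])

/-- A nondegenerate form on a finite-dimensional space identifies it with its dual, and `L` is the
inverse of this map applied to the Hessian. The flips are there because `L` acts on the second
argument. -/
theorem exists_isLinearization {N : ℕ} {k : Fin N → ℝ} {x : Config N} (ξ : Fin 3 → ℝ)
    (h : ∀ v : symplecticSlice k x, (∀ u, sliceForm k x u v = 0) → v = 0) :
    ∃ L, IsLinearization k x ξ L := by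
  have hinj : Function.Injective (sliceForm k x).flip := by
    rw [injective_iff_map_eq_zero]
    intro v hv
    exact h v fun u => by simpa using LinearMap.congr_fun hv u
  let e := LinearMap.linearEquivOfInjective _ hinj
    (Subspace.dual_finrank_eq (K := ℝ) (V := symplecticSlice k x)).symm
  refine ⟨e.symm.toLinearMap ∘ₗ (sliceHessian k ξ x).flip, fun u v => ?_⟩
  have h1 : (sliceForm k x).flip (e.symm ((sliceHessian k ξ x).flip v))
      = (sliceHessian k ξ x).flip v := e.apply_symm_apply _
  exact LinearMap.congr_fun h1 u

theorem sliceForm_nondegenerate {n : ℕ} (hn : 3 ≤ n) {θ κ : ℝ} (hκ : κ ≠ 0)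
    (hs : Real.sin θ ≠ 0) (hμ : κ + n * Real.cos θ ≠ 0)
    (v : symplecticSlice (ringPoleVorticity n κ) (ringPole n θ))
    (h : ∀ u, sliceForm (ringPoleVorticity n κ) (ringPole n θ) u v = 0) : v = 0 := by
  obtain ⟨v, hv⟩ := v
  obtain ⟨a, b, hab, rfl⟩ := exists_eq_sliceVec hn hκ hs hμ hv
  have h0 : ofRealVec a b = 0 := by
    refine eq_zero_of_ringSymplectic_eq_zero hn hκ hμ hab ?_
    have hp : IsPencilSolution θ κ 0 1 (ofRealVec a b) :=
      isPencilSolution_of_real fun a' b' h' => by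
        have := h ⟨_, sliceVec_mem hn hκ hs hμ h'⟩
        rw [zero_mul, one_mul, ← ofReal_symplecticForm_sliceVec hκ, eq_comm]
        exact_mod_cast this
    intro W hW
    simpa using (hp W hW).symm
  obtain ⟨ha, hb⟩ := ofRealVec_eq_zero_iff.1 h0
  apply Subtype.ext
  have := sliceVec_smul n θ κ 0 a b
  rw [zero_smul, zero_smul, zero_smul] at this
  simpa [ha, hb] using this

/-- Tested against real vectors, the complex eigenvalue equation splits into real and imaginary
parts, and nondegeneracy removes the test vector. The factor `sin² θ` comes from the scaling of
`ringHessian`; being positive, it does not affect whether the real part vanishes. -/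
theorem isPencilSolution_iff_isLinearization {n : ℕ} (hn : 3 ≤ n) {θ κ : ℝ} (hκ : κ ≠ 0)
    (h0 : 0 < θ) (h1 : θ < Real.pi) (hμ : κ + n * Real.cos θ ≠ 0)
    {L : symplecticSlice (ringPoleVorticity n κ) (ringPole n θ) →ₗ[ℝ]
      symplecticSlice (ringPoleVorticity n κ) (ringPole n θ)}
    (hL : IsLinearization _ _ ![0, 0, angularVelocity n θ κ] L) (z : ℂ) {a b a' b' : Fin n → ℝ}
    {u v : symplecticSlice (ringPoleVorticity n κ) (ringPole n θ)}
    (hu : (u : Config (n + 1)) = sliceVec n θ κ a b)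
    (hv : (v : Config (n + 1)) = sliceVec n θ κ a' b') :
    IsPencilSolution θ κ 1 (Real.sin θ ^ 2 * z) (ofRealVec a b + Complex.I • ofRealVec a' b') ↔
      L u = z.re • u - z.im • v ∧ L v = z.im • u + z.re • v := by
  have hs : Real.sin θ ≠ 0 := (Real.sin_pos_of_pos_of_lt_pi h0 h1).ne'
  have hs' : (Real.sin θ : ℂ) ^ 2 ≠ 0 := pow_ne_zero 2 (Complex.ofReal_ne_zero.2 hs)
  set B := sliceForm (ringPoleVorticity n κ) (ringPole n θ) with hB
  have key : ∀ (w : symplecticSlice (ringPoleVorticity n κ) (ringPole n θ)) (c d : Fin n → ℝ),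
      (w : Config (n + 1)) = sliceVec n θ κ c d →
      ((1 : ℂ) * ringHessian θ κ (ofRealVec c d) (ofRealVec a b + Complex.I • ofRealVec a' b') =
        Real.sin θ ^ 2 * z *
          ringSymplectic θ κ (ofRealVec c d) (ofRealVec a b + Complex.I • ofRealVec a' b') ↔
      B w (L u) = B w (z.re • u - z.im • v) ∧ B w (L v) = B w (z.im • u + z.re • v)) := by
    intro w c d hw
    have e1 : ringHessian θ κ (ofRealVec c d) (ofRealVec a b)
        = Real.sin θ ^ 2 * (B w (L u) : ℂ) := by
      rw [← ofReal_hessian_sliceVec hn hκ h0 h1, ← hw, ← hu, ← hL w u]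
      push_cast
      rfl
    have e2 : ringHessian θ κ (ofRealVec c d) (ofRealVec a' b')
        = Real.sin θ ^ 2 * (B w (L v) : ℂ) := by
      rw [← ofReal_hessian_sliceVec hn hκ h0 h1, ← hw, ← hv, ← hL w v]
      push_cast
      rfl
    have e3 : ringSymplectic θ κ (ofRealVec c d) (ofRealVec a b) = (B w u : ℂ) := by
      rw [← ofReal_symplecticForm_sliceVec hκ, ← hw, ← hu]
      rfl
    have e4 : ringSymplectic θ κ (ofRealVec c d) (ofRealVec a' b') = (B w v : ℂ) := by
      rw [← ofReal_symplecticForm_sliceVec hκ, ← hw, ← hv]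
      rfl
    rw [ringHessian_add_right, ringHessian_smul_right, ringSymplectic_add_right,
      ringSymplectic_smul_right, e1, e2, e3, e4, map_sub, map_add, map_smul, map_smul, map_smul,
      map_smul]
    simp only [smul_eq_mul]
    have e5 : (1 : ℂ) * (Real.sin θ ^ 2 * (B w (L u) : ℂ) +
        Complex.I * (Real.sin θ ^ 2 * (B w (L v) : ℂ))) =
        Real.sin θ ^ 2 * z * ((B w u : ℂ) + Complex.I * (B w v : ℂ)) ↔
        (B w (L u) : ℂ) + Complex.I * (B w (L v) : ℂ)
          = z * ((B w u : ℂ) + Complex.I * (B w v : ℂ)) := by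
      constructor
      · intro h
        apply mul_left_cancel₀ hs'
        linear_combination h
      · intro h
        linear_combination (Real.sin θ : ℂ) ^ 2 * h
    rw [e5, Complex.ext_iff, add_comm (z.im * _)]
    simp
  have hext : ∀ w w' : symplecticSlice (ringPoleVorticity n κ) (ringPole n θ),
      (∀ y, B y w = B y w') → w = w' := fun w w' h => by
    rw [← sub_eq_zero]
    exact sliceForm_nondegenerate hn hκ hs hμ _ fun y => by rw [map_sub, sub_eq_zero]; exact h y
  constructor
  · intro h
    have h' : ∀ y, B y (L u) = B y (z.re • u - z.im • v) ∧
        B y (L v) = B y (z.im • u + z.re • v) := fun y => by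
      obtain ⟨c, d, hcd, hy⟩ := exists_eq_sliceVec hn hκ hs hμ y.2
      exact (key y c d hy).1 (h _ hcd)
    exact ⟨hext _ _ fun y => (h' y).1, hext _ _ fun y => (h' y).2⟩
  · rintro ⟨hu', hv'⟩
    refine isPencilSolution_of_real fun c d hcd => ?_
    refine (key ⟨_, sliceVec_mem hn hκ hs hμ hcd⟩ c d rfl).2 ?_
    rw [hu', hv']
    exact ⟨rfl, rfl⟩

theorem spectrallyStable_iff {n : ℕ} (hn : 3 ≤ n) {θ κ : ℝ} (hκ : κ ≠ 0)
    (h0 : 0 < θ) (h1 : θ < Real.pi) (hμ : κ + n * Real.cos θ ≠ 0) :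
    SpectrallyStable (ringPoleVorticity n κ) (ringPole n θ) ![0, 0, angularVelocity n θ κ] ↔
      ∀ (η : ℂ) (U : RingVec n), U ∈ ringSlice n → U ≠ 0 → IsPencilSolution θ κ 1 η U →
        η.re = 0 := by
  have hs : Real.sin θ ≠ 0 := (Real.sin_pos_of_pos_of_lt_pi h0 h1).ne'
  have hs' : (Real.sin θ : ℂ) ^ 2 ≠ 0 := pow_ne_zero 2 (Complex.ofReal_ne_zero.2 hs)
  have hre : ∀ z : ℂ, (Real.sin θ ^ 2 * z : ℂ).re = Real.sin θ ^ 2 * z.re := fun z => by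
    rw [← Complex.ofReal_pow, Complex.re_ofReal_mul]
  constructor
  · rintro ⟨L, hL, hstab⟩ η U hU hU0 hp
    obtain ⟨a, b, a', b', hab, hab', rfl⟩ := exists_eq_ofRealVec_add hU
    obtain ⟨z, rfl⟩ : ∃ z : ℂ, η = Real.sin θ ^ 2 * z := ⟨η / Real.sin θ ^ 2,
      (mul_div_cancel₀ η hs').symm⟩
    have hz := (isPencilSolution_iff_isLinearization hn hκ h0 h1 hμ hL z
      (u := ⟨_, sliceVec_mem hn hκ hs hμ hab⟩) (v := ⟨_, sliceVec_mem hn hκ hs hμ hab'⟩)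
      rfl rfl).1 hp
    rw [hre, hstab z ((aeval_charpoly_eq_zero_iff L z).2 ⟨_, _, ?_, hz⟩), mul_zero]
    by_contra hcon
    push Not at hcon
    have h3 : ofRealVec a b = 0 := by
      by_contra h
      exact sliceVec_ne_zero θ κ h (congrArg Subtype.val hcon.1)
    have h4 : ofRealVec a' b' = 0 := by
      by_contra h
      exact sliceVec_ne_zero θ κ h (congrArg Subtype.val hcon.2)
    exact hU0 (by rw [h3, h4, smul_zero, add_zero])
  · intro h
    obtain ⟨L, hL⟩ := exists_isLinearization ![0, 0, angularVelocity n θ κ]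
      (sliceForm_nondegenerate hn hκ hs hμ)
    refine ⟨L, hL, fun z hz => ?_⟩
    obtain ⟨u, v, huv, hLuv⟩ := (aeval_charpoly_eq_zero_iff L z).1 hz
    obtain ⟨a, b, hab, hu⟩ := exists_eq_sliceVec hn hκ hs hμ u.2
    obtain ⟨a', b', hab', hv⟩ := exists_eq_sliceVec hn hκ hs hμ v.2
    have hp := (isPencilSolution_iff_isLinearization hn hκ h0 h1 hμ hL z hu hv).2 hLuv
    have h2 := h _ _ ((ringSlice n).add_mem hab ((ringSlice n).smul_mem _ hab')) ?_ hp
    · rw [hre] at h2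
      exact (mul_eq_zero.1 h2).resolve_left (pow_ne_zero 2 hs)
    · intro hU
      obtain ⟨e1, e2⟩ := ofRealVec_add_eq_zero hU
      have hz : sliceVec n θ κ 0 0 = 0 := by
        have := sliceVec_smul n θ κ 0 0 0
        rwa [zero_smul, zero_smul] at this
      rcases huv with h | h
      · apply h
        apply Subtype.ext
        rw [hu, (ofRealVec_eq_zero_iff.1 e1).1, (ofRealVec_eq_zero_iff.1 e1).2, hz]
        rfl
      · apply h
        apply Subtype.ext
        rw [hv, (ofRealVec_eq_zero_iff.1 e2).1, (ofRealVec_eq_zero_iff.1 e2).2, hz]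
        rfl

/-! ### The stability criterion in terms of `κ₀` and the discriminant. -/

theorem one_add_cos_pos {θ : ℝ} (hs : Real.sin θ ≠ 0) : 0 < 1 + Real.cos θ := by
  refine lt_of_le_of_ne (by linarith [Real.neg_one_le_cos θ]) fun h => hs ?_
  have h1 := Real.sin_sq_add_cos_sq θ
  rw [show Real.cos θ = -1 by linarith] at h1
  exact pow_eq_zero_iff two_ne_zero |>.1 (by linarith)

theorem cConst_lt_ringCoeff_iff {n : ℕ} {θ κ : ℝ} (hs : Real.sin θ ≠ 0) :
    cConst n < ringCoeff n θ κ ↔ kappaZero n θ < κ := by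
  have hc := one_add_cos_pos hs
  rw [← sub_pos, ringCoeff_sub_cConst hc.ne', mul_pos_iff_of_pos_left (by positivity), sub_pos]

theorem cConst_le_ringCoeff_iff {n : ℕ} {θ κ : ℝ} (hs : Real.sin θ ≠ 0) :
    cConst n ≤ ringCoeff n θ κ ↔ kappaZero n θ ≤ κ := by
  have hc := one_add_cos_pos hs
  rw [← sub_nonneg, ringCoeff_sub_cConst hc.ne', mul_nonneg_iff_of_pos_left (by positivity),
    sub_nonneg]

theorem spectrallyStable_ringPole_iff {n : ℕ} (hn : 4 ≤ n) {θ κ : ℝ} (hκ : κ ≠ 0)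
    (h0 : 0 < θ) (h1 : θ < Real.pi) (hμ : κ + n * Real.cos θ ≠ 0) :
    SpectrallyStable (ringPoleVorticity n κ) (ringPole n θ) ![0, 0, angularVelocity n θ κ] ↔
      kappaZero n θ ≤ κ ∧
      8 * aConst n θ * κ ≤ (n * Real.sin θ ^ 2 + 4 * ((n : ℝ) - 1) * Real.cos θ) ^ 2 := by
  have hs : Real.sin θ ≠ 0 := (Real.sin_pos_of_pos_of_lt_pi h0 h1).ne'
  rw [spectrallyStable_iff (by omega) hκ h0 h1 hμ, ← cConst_le_ringCoeff_iff hs]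
  constructor
  · intro h
    constructor
    · by_contra! hlt
      -- The maximum `c_n` is attained at `l = ⌊n/2⌋`, and `4 ≤ n` puts this frequency between `2`
      -- and `n - 2`.
      rw [← half_mul_sub_eq_cConst] at hlt
      obtain ⟨η, U, hU, hU0, hp, hη⟩ := exists_isPencilSolution_of_lt (by omega) (by omega) hlt
      exact hη (h η U hU hU0 hp)
    · by_contra! hlt
      obtain ⟨η, U, hU, hU0, hp, hη⟩ :=
        exists_isPencilSolution_of_discrim (by omega) hκ hμ hlt
      exact hη (h η U hU hU0 hp)
  · rintro ⟨hA, hd⟩ η U hU hU0 hp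
    exact re_eq_zero_of_isPencilSolution (by omega) hκ hμ
      (fun l _ _ => (mul_sub_le_cConst l).trans hA) hd hU hU0 hp

/-! ### Definiteness of the Hessian on the slice -/

/-- `P = A - (n - 1) sin² θ`, while `A > c_n ≥ 2 (n - 2) > n - 1`. The first mode thus needs only
its determinant to be checked. -/
theorem modeOneP_pos {n : ℕ} (hn : 4 ≤ n) {θ κ : ℝ} (h : cConst n < ringCoeff n θ κ) :
    0 < modeOneP n θ κ := by
  have h1 := mul_sub_le_cConst (n := n) 2
  have hn' : (4 : ℝ) ≤ n := by exact_mod_cast hn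
  have h2 : modeOneP n θ κ = ringCoeff n θ κ - (n - 1) * (1 - Real.cos θ ^ 2) := by
    rw [modeOneP, ringCoeff]
    ring
  have h3 : ((n : ℝ) - 1) * (1 - Real.cos θ ^ 2) ≤ n - 1 := by
    have := mul_nonneg (by linarith : (0 : ℝ) ≤ n - 1) (sq_nonneg (Real.cos θ))
    linarith
  push_cast at h1
  linarith

/-- The cross terms between real and imaginary parts cancel by symmetry of the Hessian. -/
theorem ringHessian_conjVec_re {n : ℕ} (hn : 3 ≤ n) {θ κ : ℝ} (hκ : κ ≠ 0) (h0 : 0 < θ)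
    (h1 : θ < Real.pi) (a b a' b' : Fin n → ℝ) :
    (ringHessian θ κ (ofRealVec a b + Complex.I • ofRealVec a' b')
      (conjVec (ofRealVec a b + Complex.I • ofRealVec a' b'))).re =
      Real.sin θ ^ 2 * (hessian (ringPoleVorticity n κ) ![0, 0, angularVelocity n θ κ]
        (ringPole n θ) (sliceVec n θ κ a b) (sliceVec n θ κ a b) +
        hessian (ringPoleVorticity n κ) ![0, 0, angularVelocity n θ κ]
        (ringPole n θ) (sliceVec n θ κ a' b') (sliceVec n θ κ a' b')) := by
  have hc : conjVec (ofRealVec a b + Complex.I • ofRealVec a' b')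
      = ofRealVec a b + (-Complex.I) • ofRealVec a' b' := by
    refine Prod.ext (funext fun s => ?_) (funext fun s => ?_) <;> simp [conjVec, ofRealVec]
  rw [hc, ringHessian_add_left, ringHessian_add_right, ringHessian_add_right,
    ringHessian_smul_left, ringHessian_smul_left, ringHessian_smul_right, ringHessian_smul_right,
    ringHessian_comm θ κ (ofRealVec a' b') (ofRealVec a b),
    ← ofReal_hessian_sliceVec hn hκ h0 h1, ← ofReal_hessian_sliceVec hn hκ h0 h1,
    ← ofReal_hessian_sliceVec hn hκ h0 h1, mul_add,
    ← Complex.ofReal_re (_ + _)]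
  congr 1
  push_cast
  linear_combination -(Complex.sin θ ^ 2 * hessian (ringPoleVorticity n κ)
    ![0, 0, angularVelocity n θ κ] (ringPole n θ) (sliceVec n θ κ a' b') (sliceVec n θ κ a' b')) *
    Complex.I_sq

/-- Taking `c = 1` and `c = -1` treats positive and negative definiteness together. -/
theorem ringHessian_conjVec_of_forall {n : ℕ} (hn : 3 ≤ n) {θ κ : ℝ} (hκ : κ ≠ 0)
    (h0 : 0 < θ) (h1 : θ < Real.pi) (hμ : κ + n * Real.cos θ ≠ 0) (c : ℝ)
    (h : ∀ v ∈ symplecticSlice (ringPoleVorticity n κ) (ringPole n θ), v ≠ 0 →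
      0 < c * hessian (ringPoleVorticity n κ) ![0, 0, angularVelocity n θ κ] (ringPole n θ) v v)
    {U : RingVec n} (hU : U ∈ ringSlice n) (hU0 : U ≠ 0) :
    0 < c * (ringHessian θ κ U (conjVec U)).re := by
  have hs := Real.sin_pos_of_pos_of_lt_pi h0 h1
  obtain ⟨a, b, a', b', hab, hab', rfl⟩ := exists_eq_ofRealVec_add hU
  rw [ringHessian_conjVec_re hn hκ h0 h1, mul_left_comm, mul_add]
  refine mul_pos (by positivity) ?_
  have hle : ∀ a b, ofRealVec a b ∈ ringSlice n → 0 ≤ c * hessian (ringPoleVorticity n κ)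
      ![0, 0, angularVelocity n θ κ] (ringPole n θ) (sliceVec n θ κ a b) (sliceVec n θ κ a b) :=
    fun a b hab => by
      by_cases hv : sliceVec n θ κ a b = 0
      · rw [hv, hessian, map_zero, mul_zero]
      · exact (h _ (sliceVec_mem hn hκ hs.ne' hμ hab) hv).le
  by_cases hV : ofRealVec a b = 0
  · have hV' : ofRealVec a' b' ≠ 0 := fun hV' => hU0 (by rw [hV, hV', smul_zero, add_zero])
    exact add_pos_of_nonneg_of_pos (hle a b hab)
      (h _ (sliceVec_mem hn hκ hs.ne' hμ hab') (sliceVec_ne_zero θ κ hV'))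
  · exact add_pos_of_pos_of_nonneg
      (h _ (sliceVec_mem hn hκ hs.ne' hμ hab) (sliceVec_ne_zero θ κ hV)) (hle a' b' hab')

theorem mode_vec_ne_zero {n : ℕ} (hn : 1 ≤ n) (l : ℤ) {α β : ℂ} (h : α ≠ 0 ∨ β ≠ 0) :
    ((α • mode n l, β • mode n l) : RingVec n) ≠ 0 := by
  intro h0
  have h1 := congrFun (congrArg Prod.fst h0) (⟨0, by omega⟩ : Fin n)
  have h2 := congrFun (congrArg Prod.snd h0) (⟨0, by omega⟩ : Fin n)
  simp [mode_ne_zero] at h1 h2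
  tauto

theorem hessianDefinite_ringPole_iff {n : ℕ} (hn : 4 ≤ n) {θ κ : ℝ} (hκ : κ ≠ 0)
    (h0 : 0 < θ) (h1 : θ < Real.pi) (hμ : κ + n * Real.cos θ ≠ 0) :
    HessianDefinite (ringPoleVorticity n κ) (ringPole n θ) ![0, 0, angularVelocity n θ κ] ↔
      kappaZero n θ < κ ∧ modeOne n θ κ < 0 := by
  have hs := Real.sin_pos_of_pos_of_lt_pi h0 h1
  have hn3 : 3 ≤ n := by omega
  have hnpos : (0 : ℝ) < n := by exact_mod_cast (by omega : 0 < n)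
  have hdet : 0 < modeOneP n θ κ * modeOneT n θ κ - modeOneQ n θ ^ 2 ↔ modeOne n θ κ < 0 := by
    rw [modeOne_hessian_det hκ, div_pos_iff_of_pos_right (by positivity), neg_pos]
  rw [← cConst_lt_ringCoeff_iff hs.ne', ← hdet]
  constructor
  · rintro (h | h)
    · have hpos : ∀ U ∈ ringSlice n, U ≠ 0 → 0 < (ringHessian θ κ U (conjVec U)).re :=
        fun U hU hU0 => by
          simpa using ringHessian_conjVec_of_forall hn3 hκ h0 h1 hμ 1 (by simpa using h) hU hU0
      have hA : cConst n < ringCoeff n θ κ := by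
        -- The co-latitude mode of frequency `⌊n/2⌋` has the smallest middle coefficient, `A - c_n`.
        have h2 := hpos _ (mode_mem (n := n) (l := n / 2) (by omega) (by omega) ((1 : ℝ) : ℂ)
          ((0 : ℝ) : ℂ)) (mode_vec_ne_zero (by omega) _ (Or.inl (by simp)))
        rw [ringHessian_mode_conjVec (by omega) (by omega), Complex.ofReal_re,
          half_mul_sub_eq_cConst, mul_pos_iff_of_pos_left hnpos] at h2
        linarith
      refine ⟨hA, ?_⟩
      have hp := modeOneP_pos hn hA
      -- On `(-Q, P)` the first form takes the value `P (P T - Q²)`, which isolates the determinant.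
      have h2 := hpos _ (modeOneVec_mem (n := n) hn3 θ (Or.inl rfl)
        ((-modeOneQ n θ : ℝ) : ℂ) ((modeOneP n θ κ : ℝ) : ℂ))
        (modeOneVec_ne_zero hn3 θ (Or.inr (Complex.ofReal_ne_zero.2 hp.ne')))
      rw [ringHessian_modeOneVec_conjVec hn3, Complex.ofReal_re,
        mul_pos_iff_of_pos_left hnpos] at h2
      refine pos_of_mul_pos_right (a := modeOneP n θ κ) ?_ hp.le
      linarith
    -- Negative definiteness is impossible: the longitude mode of frequency `2` has the positive
    -- value `n · 2 (n - 2)`.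
    · have h2 := ringHessian_conjVec_of_forall hn3 hκ h0 h1 hμ (-1)
        (by simpa using h) (mode_mem (n := n) (l := 2) (by omega) (by omega) ((0 : ℝ) : ℂ)
          ((1 : ℝ) : ℂ)) (mode_vec_ne_zero (by omega) _ (Or.inr (by simp)))
      rw [ringHessian_mode_conjVec (by omega) (by omega), Complex.ofReal_re] at h2
      have hn' : (4 : ℝ) ≤ n := by exact_mod_cast hn
      have h3 : 0 < (n : ℝ) * (2 * (n - 2)) := by
        exact mul_pos hnpos (by linarith)
      push_cast at h2
      linarith
  · rintro ⟨hA, hd⟩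
    refine Or.inl fun v hv hv0 => ?_
    obtain ⟨a, b, hab, rfl⟩ := exists_eq_sliceVec hn3 hκ hs.ne' hμ hv
    have hab0 : ofRealVec a b ≠ 0 := fun h => hv0 (by
      have hz : sliceVec n θ κ 0 0 = 0 := by
        have := sliceVec_smul n θ κ 0 0 0
        rwa [zero_smul, zero_smul] at this
      rw [(ofRealVec_eq_zero_iff.1 h).1, (ofRealVec_eq_zero_iff.1 h).2, hz])
    have h2 := ringHessian_ofRealVec_pos hn3
      (fun l _ _ => (mul_sub_le_cConst l).trans_lt hA) (modeOneP_pos hn hA) hd hab hab0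
    rw [← ofReal_hessian_sliceVec hn3 hκ h0 h1, Complex.ofReal_re] at h2
    exact pos_of_mul_pos_right h2 (sq_nonneg _)

end

end PointVortex

/-! ### The criterion for ellipticity. -/

theorem mainTheorem3 (n : ℕ) (hn : 4 ≤ n) (θ₀ : ℝ) (hθ₀ : 0 < θ₀) (hθ₀' : θ₀ < Real.pi)
    (κ : ℝ) (hκ : κ ≠ 0)
    (hμ : PointVortex.momentum (PointVortex.ringPoleVorticity n κ)
      (PointVortex.ringPole n θ₀) ≠ 0) :
    PointVortex.IsElliptic (PointVortex.ringPoleVorticity n κ) (PointVortex.ringPole n θ₀) ↔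
      PointVortex.kappaZero n θ₀ ≤ κ ∧
      (κ = PointVortex.kappaZero n θ₀ ∨ 0 ≤ PointVortex.modeOne n θ₀ κ) ∧
      8 * PointVortex.aConst n θ₀ * κ ≤
        (n * Real.sin θ₀ ^ 2 + 4 * ((n : ℝ) - 1) * Real.cos θ₀) ^ 2 := by
  have hn3 : 3 ≤ n := by omega
  have hμ' : κ + n * Real.cos θ₀ ≠ 0 := fun h => hμ (by
    rw [PointVortex.momentum_ringPole hn3, h]
    ext m
    fin_cases m <;> rfl)
  -- Uniqueness of the angular velocity removes the quantifier over `ξ`.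
  have hell : PointVortex.IsElliptic (PointVortex.ringPoleVorticity n κ)
      (PointVortex.ringPole n θ₀) ↔
      PointVortex.SpectrallyStable (PointVortex.ringPoleVorticity n κ) (PointVortex.ringPole n θ₀)
        ![0, 0, PointVortex.angularVelocity n θ₀ κ] ∧
      ¬ PointVortex.HessianDefinite (PointVortex.ringPoleVorticity n κ)
        (PointVortex.ringPole n θ₀) ![0, 0, PointVortex.angularVelocity n θ₀ κ] := by
    constructor
    · rintro ⟨ξ, hξ, hstab, hdef⟩
      obtain rfl := PointVortex.eq_angularVelocity_of_isRelativeEquilibrium hn3 hκ hθ₀ hθ₀' hξ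
      exact ⟨hstab, hdef⟩
    · rintro ⟨hstab, hdef⟩
      exact ⟨_, PointVortex.isRelativeEquilibrium_ringPole hn3 κ hθ₀ hθ₀', hstab, hdef⟩
  rw [hell, PointVortex.spectrallyStable_ringPole_iff hn hκ hθ₀ hθ₀' hμ',
    PointVortex.hessianDefinite_ringPole_iff hn hκ hθ₀ hθ₀' hμ', not_and, not_lt]
  constructor
  · rintro ⟨⟨h1, h2⟩, h3⟩
    -- Under `κ₀ ≤ κ`, failure of definiteness means `κ = κ₀` or `modeOne ≥ 0`.
    exact ⟨h1, h1.eq_or_lt.imp Eq.symm h3, h2⟩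
  · rintro ⟨h1, h3, h2⟩
    exact ⟨⟨h1, h2⟩, fun h => h3.resolve_left h.ne'⟩
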